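/- **Setting.** Let $\Omega\subset\mathbb C\times\mathbb R$ be a non-empty connected open set, let $f=f(\zeta,u)$ be a smooth complex-valued function on $\Omega$, holomorphic in $\zeta$, and consider on $M=\Omega\times\mathbb R$ (coordinates $\zeta,u,v$) the vacuum pp-wave metric $$ds^2=2\,d\zeta\,d\bar\zeta-2\,du\,dv-(f+\bar f)\,du^2 .$$ Let $(e_1,e_2,e_3,e_4)=(\delta,\delta^*,\Delta,D)$, with $e_2=\bar e_1$ and $\Delta,D$ real, be a smooth complex null tetrad on $M$ with dual coframe $\omega^1,\dots,\omega^4$, so that $ds^2=2\omega^1\omega^2-2\omega^3\omega^4$; $D$ is a multiple of $\partial_v$, and $\delta\bar\zeta=0$. Write $\omega_{ab}=g(e_a,\nabla e_b)$ for the Levi-Civita connection forms, $\Omega_{ab}$ for the curvature forms, and $$\alpha=-\tfrac12(\omega_{12}+\omega_{34})(e_2),\quad \gamma=-\tfrac12(\omega_{12}+\omega_{34})(e_3),\quad \mu=\omega_{23}(e_1),\quad \Psi_4=\Omega_{23}(e_2,e_3).$$ Assume that the tetrad is normalized by $\Psi_4=1$, $\gamma=0$, and that $\alpha\ne0$ everywhere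 on $M$. Put $$A=\frac{\delta^*\alpha}{\alpha^2},\qquad B=\mu A-\mu^*=B_1+iB_2,\qquad X=\frac{B}{AA^*-1}=X_1+iX_2\ \ (\text{where }AA^*\ne1),$$ where $^*$ is complex conjugation and $B_1,B_2,X_1,X_2$ are real. For a smooth real vector field $V$ on $M$ write $V=V^1\delta+V^2\delta^*+V^3\Delta+V^4D$. The metric is a *$G_2$-precursor* if there is such a $V$ with $$\mathcal L_V\omega^1=\mathcal L_V\omega^3=0\quad\text{and}\quad V^1\not\equiv0\ \text{ or }\ V^3\not\equiv0.\tag{P}$$ It is of type $(0,2)$ if $d\alpha\wedge d\alpha^*\neq0$ at every point of $M$. "$f$ has the form …" means: near every point of $M$ there is a change of coordinates $$\hat\zeta=e^{ic}(\zeta+h(u)),\qquad \hat u=(u+u_0)/a,\qquad \hat v=a\bigl(v+h'(u)\bar\zeta+\overline{h'(u)}\,\zeta+s(u)\bigr)$$ ($a,c,u_0$ real, $a\neq0$; $h$ complex-valued, $s$ real-valued, both smooth) such that in the new coordinates the metric is the pp-wave metric of a function of the given form; there $F$ is an analytic function of one complex variable, and $g,g_1,g_2$ are complex-valued functions of the real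 variable $\hat u$ (hats are omitted in the forms below). **Proposition.** 1. (Class $\mathrm B_{23}$.) Suppose $B_1\neq0$ and $AA^*\ne1$ everywhere on $M$. Then the metric is a $G_2$-precursor if and only if, for some real constant $k$, $B_2/B_1=k$ and $\Delta X_1=2X_1^2$ on $M$. For each real $k$, the latter two conditions hold if and only if $f$ has the form $F(u^{-ik}\zeta)u^{-2}+g(u)\zeta$, $u>0$. 2. (Class $\mathrm C_{23}$.) Suppose $B_1=0$, $\mu\neq0$ and $AA^*\neq1$ everywhere on $M$. The following are equivalent: (i) the metric is a $G_2$-precursor; (ii) $\Delta X_2=0$ on $M$; (iii) $f$ has the form $F(e^{iu}\zeta)+g(u)\zeta$. 3. (Class $\mathrm L_{23}$.) The following are equivalent: (i) there is a smooth real $V$ with $\mathcal L_V\omega^1=\mathcal L_V\omega^3=0$, $V^1\not\equiv0$, $V^3\equiv0$; (ii) $A=1$ on $M$; (iii) $f$ has the form $g_1(u)\log\zeta+g_2(u)\zeta$ (principal logarithm, off its cut). 4. (Class $\mathrm A_{23}$.) The following are equivalent: (i) there is a smooth real $V$ with $\mathcal L_V\omega^1=\mathcal L_V\omega^3=0$,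 $V^1\equiv0$, $V^3\not\equiv0$; (ii) $\mu=0$ on $M$; (iii) $f$ has the form $F(\zeta)+g(u)\zeta$. 5. (Completeness.) Suppose that the metric is of type $(0,2)$ and that $AA^*=1$ either everywhere on $M$ or nowhere on $M$. Then the metric is a $G_2$-precursor if and only if one of the following holds on $M$: * $B_1\ne0$ and $AA^*\neq1$ everywhere, and for some real constant $k$, $B_2/B_1=k$ and $\Delta X_1=2X_1^2$; * $B_1=0$, $\mu\ne0$ and $AA^*\ne1$ everywhere, and $\Delta X_2=0$; * $A=1$ everywhere; * $\mu=0$ everywhere. -/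

import Mathlib

open Complex Topology
open scoped ContDiff ComplexConjugate

/-! ## Coordinates and tensor calculus -/

/-- A spacetime point with coordinates `(ζ, u, v)`, where `ζ` is complex and `u`, `v` are real. -/
abbrev Spacetime : Type := ℂ × ℝ × ℝ

/-- The four complex coordinate functions `(x⁰, x¹, x², x³) = (ζ, ζ*, u, v)`. -/
noncomputable def coordFn (i : Fin 4) (p : Spacetime) : ℂ :=
  ![p.1, conj p.1, (p.2.1 : ℂ), (p.2.2 : ℂ)] i

/-- The coordinate derivatives `∂/∂ζ`, `∂/∂ζ*` (Wirtinger derivatives), `∂/∂u`, `∂/∂v` of a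
complex-valued function. -/
noncomputable def pd (i : Fin 4) (φ : Spacetime → ℂ) (p : Spacetime) : ℂ :=
  ![(fderiv ℝ φ p (1, 0, 0) - I * fderiv ℝ φ p (I, 0, 0)) / 2,
    (fderiv ℝ φ p (1, 0, 0) + I * fderiv ℝ φ p (I, 0, 0)) / 2,
    fderiv ℝ φ p (0, 1, 0),
    fderiv ℝ φ p (0, 0, 1)] i

/-- Complexified tangent vectors (or covectors), given by their components with respect to
`∂/∂ζ, ∂/∂ζ*, ∂/∂u, ∂/∂v` (respectively `dζ, dζ*, du, dv`). -/
abbrev CVec : Type := Fin 4 → ℂ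

/-- Complex conjugation of complexified tangent vectors: it exchanges `∂/∂ζ` and `∂/∂ζ*`. -/
noncomputable def conjVec (X : CVec) : CVec :=
  ![conj (X 1), conj (X 0), conj (X 2), conj (X 3)]

/-- The derivative `X φ` of a complex function along a complex vector field. -/
noncomputable def vecDeriv (X : Spacetime → CVec) (φ : Spacetime → ℂ) (p : Spacetime) : ℂ :=
  ∑ i, X p i * pd i φ p

/-- The Lie derivative `𝓛_V θ` of a complex 1-form:
`(𝓛_V θ)_i = V^j ∂_j θ_i + θ_j ∂_i V^j`. -/
noncomputable def lieDerivForm (V θ : Spacetime → CVec) (p : Spacetime) : CVec := fun i =>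
  ∑ j, (V p j * pd j (fun q => θ q i) p + θ p j * pd i (fun q => V q j) p)

/-- Evaluation of a 1-form on a vector field. -/
noncomputable def pairing (θ X : Spacetime → CVec) (p : Spacetime) : ℂ := ∑ i, θ p i * X p i

/-! ## Vacuum pp-waves -/

/-- The spacetime region over a set `Ω` of values of `(ζ, u)`; the coordinate `v` is free. -/
def region (Ω : Set (ℂ × ℝ)) : Set Spacetime := {p | (p.1, p.2.1) ∈ Ω}

/-- `f = f(ζ, u)` is a smooth function on `Ω` that is analytic in `ζ`. -/
def IsProfile (f : ℂ × ℝ → ℂ) (Ω : Set (ℂ × ℝ)) : Prop :=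
  ContDiffOn ℝ ∞ f Ω ∧ ∀ x ∈ Ω, DifferentiableAt ℂ (fun z : ℂ => f (z, x.2)) x.1

/-- The components, in the coordinates `(ζ, ζ*, u, v)`, of the vacuum pp-wave metric
`ds² = 2 dζ dζ* - 2 du dv - (f + f*) du²`. -/
noncomputable def ppMetric (f : ℂ × ℝ → ℂ) (p : Spacetime) : Matrix (Fin 4) (Fin 4) ℂ :=
  !![0, 1, 0, 0;
     1, 0, 0, 0;
     0, 0, -(f (p.1, p.2.1) + conj (f (p.1, p.2.1))), -1;
     0, 0, -1, 0]

/-- The (complex bilinear) scalar product of two complexified vectors. -/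
noncomputable def ppInner (f : ℂ × ℝ → ℂ) (p : Spacetime) (X Y : CVec) : ℂ :=
  ∑ i, ∑ j, ppMetric f p i j * X i * Y j

/-- Christoffel symbols of the first kind, `g(∇_{∂_i} ∂_j, ∂_k)`. -/
noncomputable def christoffel (f : ℂ × ℝ → ℂ) (p : Spacetime) (i j k : Fin 4) : ℂ :=
  (pd i (fun q => ppMetric f q j k) p + pd j (fun q => ppMetric f q i k) p
    - pd k (fun q => ppMetric f q i j) p) / 2

/-! ## Null tetrads, spin coefficients and curvature -/

/-- The constant scalar products of a complex null tetrad `(e₁, e₂, e₃, e₄) = (δ, δ*, Δ, D)`;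
the metric is `2 ω¹ ω² - 2 ω³ ω⁴` in terms of the dual coframe.  This matrix is its own
inverse.  The Lean index `a : Fin 4` is the tetrad index `a + 1`. -/
def nullEta : Matrix (Fin 4) (Fin 4) ℂ :=
  !![0, 1, 0, 0;
     1, 0, 0, 0;
     0, 0, 0, -1;
     0, 0, -1, 0]

/-- The coframe dual to a null tetrad: `ω^a = η^{ab} g(e_b, ·)`. -/
noncomputable def coframe (f : ℂ × ℝ → ℂ) (e : Fin 4 → Spacetime → CVec) (a : Fin 4)
    (p : Spacetime) : CVec := fun i =>
  ∑ b, nullEta a b * ∑ j, ppMetric f p i j * e b p j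

/-- The Levi-Civita connection 1-forms `ω_{ab} = g(e_a, ∇ e_b)` of a tetrad. -/
noncomputable def connForm (f : ℂ × ℝ → ℂ) (e : Fin 4 → Spacetime → CVec) (a b : Fin 4)
    (p : Spacetime) : CVec := fun i =>
  ∑ j, ∑ k, (ppMetric f p j k * e a p j * pd i (fun q => e b q k) p
    + christoffel f p i k j * e b p k * e a p j)

/-- The components of the curvature 2-forms `Ω_{ab} = dω_{ab} + ω_{ac} ∧ ω^c_b`. -/
noncomputable def curvForm (f : ℂ × ℝ → ℂ) (e : Fin 4 → Spacetime → CVec) (a b : Fin 4)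
    (p : Spacetime) (i j : Fin 4) : ℂ :=
  pd i (fun q => connForm f e a b q j) p - pd j (fun q => connForm f e a b q i) p
    + ∑ c, ∑ d, nullEta c d * (connForm f e a c p i * connForm f e d b p j
        - connForm f e a c p j * connForm f e d b p i)

/-- The Weyl scalar `Ψ₄ = Ω₂₃(e₂, e₃)`. -/
noncomputable def weylPsi4 (f : ℂ × ℝ → ℂ) (e : Fin 4 → Spacetime → CVec)
    (p : Spacetime) : ℂ :=
  ∑ i, ∑ j, curvForm f e 1 2 p i j * e 1 p i * e 2 p j

/-- The Newman-Penrose scalar `α`: the `ω²` component of `-(ω₁₂ + ω₃₄) / 2`. -/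
noncomputable def npAlpha (f : ℂ × ℝ → ℂ) (e : Fin 4 → Spacetime → CVec)
    (p : Spacetime) : ℂ :=
  -(pairing (connForm f e 0 1) (e 1) p + pairing (connForm f e 2 3) (e 1) p) / 2

/-- The Newman-Penrose scalar `γ`: the `ω³` component of `-(ω₁₂ + ω₃₄) / 2`. -/
noncomputable def npGamma (f : ℂ × ℝ → ℂ) (e : Fin 4 → Spacetime → CVec)
    (p : Spacetime) : ℂ :=
  -(pairing (connForm f e 0 1) (e 2) p + pairing (connForm f e 2 3) (e 2) p) / 2

/-- The Newman-Penrose scalar `μ`: the `ω¹` component of `ω₂₃`. -/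
noncomputable def npMu (f : ℂ × ℝ → ℂ) (e : Fin 4 → Spacetime → CVec)
    (p : Spacetime) : ℂ :=
  pairing (connForm f e 1 2) (e 0) p

/-- `e = (δ, δ*, Δ, D)` is a smooth complex null tetrad on `M`, aligned with the covariantly
constant null vector field `∂_v`, oriented so that `δ ζ* = 0`, and normalized by
`Ψ₄ = 1`, `γ = 0`. -/
structure IsNormalizedTetrad (f : ℂ × ℝ → ℂ) (M : Set Spacetime)
    (e : Fin 4 → Spacetime → CVec) : Prop where
  smooth : ∀ a, ContDiffOn ℝ ∞ (e a) M
  conj_delta : ∀ p ∈ M, e 1 p = conjVec (e 0 p)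
  real_Delta : ∀ p ∈ M, conjVec (e 2 p) = e 2 p
  real_D : ∀ p ∈ M, conjVec (e 3 p) = e 3 p
  null : ∀ p ∈ M, ∀ a b, ppInner f p (e a p) (e b p) = nullEta a b
  aligned : ∀ p ∈ M, e 3 p 0 = 0 ∧ e 3 p 1 = 0 ∧ e 3 p 2 = 0
  oriented : ∀ p ∈ M, e 0 p 1 = 0
  psi4 : ∀ p ∈ M, weylPsi4 f e p = 1
  gamma : ∀ p ∈ M, npGamma f e p = 0

/-! ## The invariants -/

/-- `A = δ* α / α²`. -/
noncomputable def invA (f : ℂ × ℝ → ℂ) (e : Fin 4 → Spacetime → CVec) (p : Spacetime) : ℂ :=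
  vecDeriv (e 1) (npAlpha f e) p / npAlpha f e p ^ 2

/-- `B = μ A - μ*`. -/
noncomputable def invB (f : ℂ × ℝ → ℂ) (e : Fin 4 → Spacetime → CVec) (p : Spacetime) : ℂ :=
  npMu f e p * invA f e p - conj (npMu f e p)

/-- `X = B / (A A* - 1)`; used only where `A A* ≠ 1`. -/
noncomputable def invX (f : ℂ × ℝ → ℂ) (e : Fin 4 → Spacetime → CVec) (p : Spacetime) : ℂ :=
  invB f e p / (invA f e p * conj (invA f e p) - 1)

/-- `X₁ = Re X`, as a complex-valued function. -/
noncomputable def invX1 (f : ℂ × ℝ → ℂ) (e : Fin 4 → Spacetime → CVec) (p : Spacetime) : ℂ :=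
  ((invX f e p).re : ℂ)

/-- `X₂ = Im X`, as a complex-valued function. -/
noncomputable def invX2 (f : ℂ × ℝ → ℂ) (e : Fin 4 → Spacetime → CVec) (p : Spacetime) : ℂ :=
  ((invX f e p).im : ℂ)

/-- Type `(0,2)`: `dα ∧ dα* ≠ 0` at every point of `M`. -/
def IsTypeZeroTwo (f : ℂ × ℝ → ℂ) (M : Set Spacetime) (e : Fin 4 → Spacetime → CVec) : Prop :=
  ∀ p ∈ M, ∃ i j : Fin 4,
    pd i (npAlpha f e) p * pd j (fun q => conj (npAlpha f e q)) p
      ≠ pd j (npAlpha f e) p * pd i (fun q => conj (npAlpha f e q)) p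

/-! ## `G₂`-precursors -/

/-- `V` is a smooth real vector field on `M` with `𝓛_V ω¹ = 𝓛_V ω³ = 0`. -/
structure PreservesForms (f : ℂ × ℝ → ℂ) (M : Set Spacetime) (e : Fin 4 → Spacetime → CVec)
    (V : Spacetime → CVec) : Prop where
  smooth : ContDiffOn ℝ ∞ V M
  real : ∀ p ∈ M, conjVec (V p) = V p
  lie_one : ∀ p ∈ M, lieDerivForm V (coframe f e 0) p = 0
  lie_three : ∀ p ∈ M, lieDerivForm V (coframe f e 2) p = 0

/-- The component `V^a = ω^a(V)` of a vector field in the tetrad. -/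
noncomputable def frameComp (f : ℂ × ℝ → ℂ) (e : Fin 4 → Spacetime → CVec)
    (V : Spacetime → CVec) (a : Fin 4) (p : Spacetime) : ℂ :=
  pairing (coframe f e a) V p

/-- The metric is a `G₂`-precursor on `M`: some vector field preserves `ω¹` and `ω³`, and
`V¹` or `V³` is not the zero function. -/
def IsPrecursor (f : ℂ × ℝ → ℂ) (M : Set Spacetime) (e : Fin 4 → Spacetime → CVec) : Prop :=
  ∃ V, PreservesForms f M e V ∧
    ((∃ p ∈ M, frameComp f e V 0 p ≠ 0) ∨ (∃ p ∈ M, frameComp f e V 2 p ≠ 0))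

/-! ## Normal forms up to change of coordinates -/

/-- The change of coordinates
`ζ' = exp(i c) (ζ + h(u))`, `u' = (u + u₀) / a`,
`v' = a (v + h'(u) ζ* + h'(u)* ζ + s(u))`. -/
noncomputable def coordChange (c a u₀ : ℝ) (h : ℝ → ℂ) (s : ℝ → ℝ) (p : Spacetime) :
    Spacetime :=
  (exp (I * c) * (p.1 + h p.2.1), (p.2.1 + u₀) / a,
    a * (p.2.2 + 2 * (deriv h p.2.1 * conj p.1).re + s p.2.1))

/-- Near every point of `M` there are coordinates `(ζ', u', v')`, related to `(ζ, u, v)` by one of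
the form-preserving changes of coordinates above, in which the metric is the pp-wave metric of a
function `f'` of the form `P`.  (`P f' x` says that the function `f'` has the given form near the
point `x = (ζ', u')`.) -/
def HasNormalForm (f : ℂ × ℝ → ℂ) (M : Set Spacetime)
    (P : (ℂ × ℝ → ℂ) → ℂ × ℝ → Prop) : Prop :=
  ∀ p ∈ M, ∃ (c a u₀ : ℝ) (h : ℝ → ℂ) (s : ℝ → ℝ) (f' : ℂ × ℝ → ℂ),
    a ≠ 0 ∧
    (∀ᶠ t in 𝓝 p.2.1, ContDiffAt ℝ ∞ h t ∧ ContDiffAt ℝ ∞ s t) ∧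
    P f' ((coordChange c a u₀ h s p).1, (coordChange c a u₀ h s p).2.1) ∧
    ∀ᶠ q in 𝓝 p, ∀ i j : Fin 4,
      ppMetric f q i j =
        ∑ k, ∑ l, pd i (fun r => coordFn k (coordChange c a u₀ h s r)) q
          * pd j (fun r => coordFn l (coordChange c a u₀ h s r)) q
          * ppMetric f' (coordChange c a u₀ h s q) k l

/-- `f(ζ, u) = F(u^{-ik} ζ) u^{-2} + g(u) ζ` with `u > 0` and `F` analytic. -/
def FormB (k : ℝ) (f : ℂ × ℝ → ℂ) (x : ℂ × ℝ) : Prop :=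
  0 < x.2 ∧ ∃ (F : ℂ → ℂ) (g : ℝ → ℂ),
    AnalyticAt ℂ F ((x.2 : ℂ) ^ (-(I * k)) * x.1) ∧
    ∀ y : ℂ × ℝ, f y = F ((y.2 : ℂ) ^ (-(I * k)) * y.1) / (y.2 : ℂ) ^ 2 + g y.2 * y.1

/-- `f(ζ, u) = F(e^{iu} ζ) + g(u) ζ` with `F` analytic. -/
def FormC (f : ℂ × ℝ → ℂ) (x : ℂ × ℝ) : Prop :=
  ∃ (F : ℂ → ℂ) (g : ℝ → ℂ),
    AnalyticAt ℂ F (exp (I * x.2) * x.1) ∧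
    ∀ y : ℂ × ℝ, f y = F (exp (I * y.2) * y.1) + g y.2 * y.1

/-- `f(ζ, u) = g₁(u) log ζ + g₂(u) ζ`; the point `ζ` lies off the cut of the principal
logarithm. -/
def FormL (f : ℂ × ℝ → ℂ) (x : ℂ × ℝ) : Prop :=
  x.1 ∈ slitPlane ∧ ∃ g₁ g₂ : ℝ → ℂ,
    ∀ y : ℂ × ℝ, f y = g₁ y.2 * log y.1 + g₂ y.2 * y.1

/-- `f(ζ, u) = F(ζ) + g(u) ζ` with `F` analytic. -/
def FormA (f : ℂ × ℝ → ℂ) (x : ℂ × ℝ) : Prop :=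
  ∃ (F : ℂ → ℂ) (g : ℝ → ℂ), AnalyticAt ℂ F x.1 ∧
    ∀ y : ℂ × ℝ, f y = F y.1 + g y.2 * y.1

/-! ## The invariant conditions -/

/-- `B₂ / B₁ = k` and `Δ X₁ = 2 X₁²`. -/
def CondB (f : ℂ × ℝ → ℂ) (M : Set Spacetime) (e : Fin 4 → Spacetime → CVec) (k : ℝ) : Prop :=
  ∀ p ∈ M, (invB f e p).im / (invB f e p).re = k ∧
    vecDeriv (e 2) (invX1 f e) p = 2 * invX1 f e p ^ 2

/-- `Δ X₂ = 0`. -/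
def CondC (f : ℂ × ℝ → ℂ) (M : Set Spacetime) (e : Fin 4 → Spacetime → CVec) : Prop :=
  ∀ p ∈ M, vecDeriv (e 2) (invX2 f e) p = 0

/-- `B₁ ≠ 0` and `A A* ≠ 1` on `M`. -/
def GenericB (f : ℂ × ℝ → ℂ) (M : Set Spacetime) (e : Fin 4 → Spacetime → CVec) : Prop :=
  ∀ p ∈ M, (invB f e p).re ≠ 0 ∧ invA f e p * conj (invA f e p) ≠ 1

/-- `B₁ = 0`, `μ ≠ 0` and `A A* ≠ 1` on `M`. -/
def GenericC (f : ℂ × ℝ → ℂ) (M : Set Spacetime) (e : Fin 4 → Spacetime → CVec) : Prop :=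
  ∀ p ∈ M, (invB f e p).re = 0 ∧ npMu f e p ≠ 0 ∧ invA f e p * conj (invA f e p) ≠ 1

/-! ## Calculus of the coordinate derivatives -/

/-! The proof reduces everything to one function Q of (ζ, u), holomorphic in ζ, with Q² = f_ζζ/2.
Write D = d ∂_v and δ = a ∂_ζ + …, where d is real and |a| = 1. Then ω₁₂ + ω₃₄ = −d log(da) and Ψ₄ =
(f_ζζ)*/(2(da)²). So Ψ₄ = 1 makes Q = (da)* the required root, γ = 0 says that Δ annihilates Q, and
α ≠ 0 says Q_ζ ≠ 0. With β = −Q_u/Q_ζ (the velocity of the level curves of Q) and w = Q/Q_ζ one gets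
ω¹ = a*(dζ − β du), ω³ = d du, A* = −1 − 2w_ζ and μ = β_ζ/d (`exists_reducesTo`, `conj_invA`).

A real V preserves ω¹ and ω³ exactly when V^u = U := P₁u + m and V^ζ = βU − Pw, where P = P₁ + iP₂
and the real m are constants with β_ζ U − w_ζ P = iP₂. This is `PrecursorEq`; V^v is free. The point
is that V log Q = −P, that holomorphy together with reality leaves P a function of u alone, and that
equality of the mixed derivatives of Q then makes it constant. Moreover V¹ = −a*Pw and V³ = dU, so
being a precursor means having a solution (P, m) ≠ 0.

In terms of the invariants the equation reads P* + A*P + 2β_ζ U = 0. It is real-linear in P with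
determinant |A|² − 1, and where this is nonzero it is equivalent to P = −2U·Xd. A solution thus
gives Xd = −P/(2U): the argument of X is constant modulo π, and since Δd = 0, applying Δ to X
amounts to differentiating −P/(2U) in u. This yields the conditions on X₁ and X₂. Conversely, those
conditions make X₁d (or X₂d) a real function holomorphic in ζ, hence a function of u alone, and the
remaining differential equation in u is solved explicitly. The cases P₁ ≠ 0, P₁ = 0 ≠ P and P = 0
are B, C and A; U = 0 forces P imaginary and A = 1, which is L.

For the normal forms in A, B and C, let UE′ = iP₂E. The flow of V has the form ζ = E(u)y − h(u), and
UEQ is constant along it, so (UEQ)² is a function of (ζ + h)/E alone. Integrating f_ζζ = 2Q² twice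
gives f = F((ζ + h)/E)/U² up to terms affine in ζ; the linear one goes into g and the constant one
into the shift of v (`exists_potential`, `exists_normalForm`). Conversely, the metric sees only f +
f*, which determines f_ζζ, and differentiating the similarity relation along the flow returns the
precursor equation (`precursorEq_of_sq_eq`). In class L, A = 1 means w_ζ = −1, so f_ζζ is a function
of u divided by (ζ + h)².

For completeness, if |A| = 1 the equation yields BU = 0, while type (0,2) excludes B = 0; hence U =
0 and the class is L. If |A| ≠ 1 the three cases for P are exhaustive. -/

theorem ContDiffOn.differentiableAt_of_isOpen {E F : Type*} [NormedAddCommGroup E]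
    [NormedSpace ℝ E] [NormedAddCommGroup F] [NormedSpace ℝ F] {φ : E → F} {s : Set E}
    (h : ContDiffOn ℝ ∞ φ s) (hs : IsOpen s) {p : E} (hp : p ∈ s) : DifferentiableAt ℝ φ p :=
  (h.contDiffAt (hs.mem_nhds hp)).differentiableAt (by simp)

theorem pd_congr {φ ψ : Spacetime → ℂ} {p : Spacetime} (h : φ =ᶠ[𝓝 p] ψ) (i : Fin 4) :
    pd i φ p = pd i ψ p := by
  unfold pd; rw [h.fderiv_eq]

theorem pd_congr_on {M : Set Spacetime} (hM : IsOpen M) {φ ψ : Spacetime → ℂ}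
    (h : ∀ q ∈ M, φ q = ψ q) {p : Spacetime} (hp : p ∈ M) (i : Fin 4) :
    pd i φ p = pd i ψ p :=
  pd_congr (Filter.eventually_of_mem (hM.mem_nhds hp) h) i

@[simp] theorem pd_const (i : Fin 4) (c : ℂ) (p : Spacetime) : pd i (fun _ => c) p = 0 := by
  fin_cases i <;> simp [pd]

theorem pd_add {φ ψ : Spacetime → ℂ} {p : Spacetime} (hφ : DifferentiableAt ℝ φ p)
    (hψ : DifferentiableAt ℝ ψ p) (i : Fin 4) :
    pd i (fun q => φ q + ψ q) p = pd i φ p + pd i ψ p := by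
  fin_cases i <;> simp [pd, fderiv_fun_add hφ hψ] <;> ring

theorem pd_neg {φ : Spacetime → ℂ} {p : Spacetime} (i : Fin 4) :
    pd i (fun q => -φ q) p = -pd i φ p := by
  fin_cases i <;> simp [pd, fderiv_fun_neg] <;> ring

theorem pd_sub {φ ψ : Spacetime → ℂ} {p : Spacetime} (hφ : DifferentiableAt ℝ φ p)
    (hψ : DifferentiableAt ℝ ψ p) (i : Fin 4) :
    pd i (fun q => φ q - ψ q) p = pd i φ p - pd i ψ p := by
  fin_cases i <;> simp [pd, fderiv_fun_sub hφ hψ] <;> ring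

theorem pd_mul {φ ψ : Spacetime → ℂ} {p : Spacetime} (hφ : DifferentiableAt ℝ φ p)
    (hψ : DifferentiableAt ℝ ψ p) (i : Fin 4) :
    pd i (fun q => φ q * ψ q) p = pd i φ p * ψ p + φ p * pd i ψ p := by
  fin_cases i <;> simp [pd, fderiv_fun_mul hφ hψ] <;> ring

theorem pd_const_mul {φ : Spacetime → ℂ} {p : Spacetime} (c : ℂ)
    (hφ : DifferentiableAt ℝ φ p) (i : Fin 4) :
    pd i (fun q => c * φ q) p = c * pd i φ p := by
  rw [pd_mul (differentiableAt_const c) hφ]; simp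

theorem pd_inv {φ : Spacetime → ℂ} {p : Spacetime} (hφ : DifferentiableAt ℝ φ p)
    (h0 : φ p ≠ 0) (i : Fin 4) :
    pd i (fun q => (φ q)⁻¹) p = -pd i φ p / φ p ^ 2 := by
  have hinv : DifferentiableAt ℝ (fun q => (φ q)⁻¹) p := hφ.inv h0
  have h1 : (fun q => φ q * (φ q)⁻¹) =ᶠ[𝓝 p] fun _ => (1 : ℂ) := by
    filter_upwards [hφ.continuousAt.eventually_ne h0] with q hq
    exact mul_inv_cancel₀ hq
  have h2 := pd_mul hφ hinv i
  rw [pd_congr h1, pd_const] at h2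
  field_simp
  field_simp at h2
  linear_combination -h2

/-- Conjugation exchanges the two Wirtinger derivatives; `![1, 0, 2, 3]` is that exchange of ∂_ζ and
∂_ζ*, here and below. -/
theorem pd_conj {φ : Spacetime → ℂ} {p : Spacetime} (hφ : DifferentiableAt ℝ φ p) (i : Fin 4) :
    pd i (fun q => conj (φ q)) p = conj (pd (![1, 0, 2, 3] i) φ p) := by
  have h : fderiv ℝ (fun q => conj (φ q)) p = (conjCLE : ℂ →L[ℝ] ℂ).comp (fderiv ℝ φ p) :=
    (conjCLE.hasFDerivAt.comp p hφ.hasFDerivAt).fderiv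
  fin_cases i <;> simp [pd, h, map_ofNat]
  ring

theorem ContDiffOn.pd {φ : Spacetime → ℂ} {M : Set Spacetime} (h : ContDiffOn ℝ ∞ φ M)
    (hM : IsOpen M) (i : Fin 4) : ContDiffOn ℝ ∞ (pd i φ) M := by
  have h1 : ContDiffOn ℝ ∞ (fderiv ℝ φ) M := h.fderiv_of_isOpen hM (by simp)
  have h2 : ∀ w : Spacetime, ContDiffOn ℝ ∞ (fun q => fderiv ℝ φ q w) M := fun w =>
    h1.clm_apply contDiffOn_const
  fin_cases i
  · exact ((h2 (1, 0, 0)).sub (contDiffOn_const.mul (h2 (I, 0, 0)))).div_const 2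
  · exact ((h2 (1, 0, 0)).add (contDiffOn_const.mul (h2 (I, 0, 0)))).div_const 2
  · exact h2 (0, 1, 0)
  · exact h2 (0, 0, 1)

/-- Each `pd` is a constant-coefficient combination of real directional derivatives, so this is the
symmetry of the second real derivative. -/
theorem pd_comm {φ : Spacetime → ℂ} {M : Set Spacetime} (h : ContDiffOn ℝ ∞ φ M)
    (hM : IsOpen M) {p : Spacetime} (hp : p ∈ M) (i j : Fin 4) :
    pd i (pd j φ) p = pd j (pd i φ) p := by
  have h1 : ContDiffOn ℝ ∞ (fderiv ℝ φ) M := h.fderiv_of_isOpen hM (by simp)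
  have hd : DifferentiableAt ℝ (fderiv ℝ φ) p := h1.differentiableAt_of_isOpen hM hp
  have h2 : ∀ w : Spacetime, DifferentiableAt ℝ (fun q => fderiv ℝ φ q w) p := fun w =>
    hd.clm_apply (differentiableAt_const w)
  have h3 : ∀ w v : Spacetime, fderiv ℝ (fun q => fderiv ℝ φ q w) p v
      = fderiv ℝ (fderiv ℝ φ) p v w := fun w v => by
    rw [fderiv_clm_apply hd (differentiableAt_const w)]; simp
  have hs : ∀ v w : Spacetime, fderiv ℝ (fderiv ℝ φ) p v w = fderiv ℝ (fderiv ℝ φ) p w v :=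
    fun v w => ((h.contDiffAt (hM.mem_nhds hp)).isSymmSndFDerivAt
      (by rw [minSmoothness_of_isRCLikeNormedField]
          exact WithTop.coe_le_coe.2 (le_top : (2 : ℕ∞) ≤ ⊤))).eq v w
  have e0 : pd 0 φ = fun q => 2⁻¹ * (fderiv ℝ φ q (1, 0, 0) - I * fderiv ℝ φ q (I, 0, 0)) := by
    funext q; simp [pd]; ring
  have e1 : pd 1 φ = fun q => 2⁻¹ * (fderiv ℝ φ q (1, 0, 0) + I * fderiv ℝ φ q (I, 0, 0)) := by
    funext q; simp [pd]; ring
  have e2 : pd 2 φ = fun q => fderiv ℝ φ q (0, 1, 0) := by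
    funext q; simp [pd]
  have e3 : pd 3 φ = fun q => fderiv ℝ φ q (0, 0, 1) := by
    funext q; simp [pd]
  have hI := (h2 (I, 0, 0)).const_mul I
  have f0 : ∀ k, pd k (pd 0 φ) p = 2⁻¹ * (pd k (fun q => fderiv ℝ φ q (1, 0, 0)) p
      - I * pd k (fun q => fderiv ℝ φ q (I, 0, 0)) p) := fun k => by
    rw [e0, pd_const_mul _ ((h2 _).fun_sub hI), pd_sub (h2 _) hI, pd_const_mul _ (h2 _)]
  have f1 : ∀ k, pd k (pd 1 φ) p = 2⁻¹ * (pd k (fun q => fderiv ℝ φ q (1, 0, 0)) p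
      + I * pd k (fun q => fderiv ℝ φ q (I, 0, 0)) p) := fun k => by
    rw [e1, pd_const_mul _ ((h2 _).fun_add hI), pd_add (h2 _) hI, pd_const_mul _ (h2 _)]
  have key : ∀ w, ∀ k, pd k (fun q => fderiv ℝ φ q w) p =
      ![(fderiv ℝ (fderiv ℝ φ) p w (1, 0, 0) - I * fderiv ℝ (fderiv ℝ φ) p w (I, 0, 0)) / 2,
        (fderiv ℝ (fderiv ℝ φ) p w (1, 0, 0) + I * fderiv ℝ (fderiv ℝ φ) p w (I, 0, 0)) / 2,
        fderiv ℝ (fderiv ℝ φ) p w (0, 1, 0), fderiv ℝ (fderiv ℝ φ) p w (0, 0, 1)] k := by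
    intro w k
    simp only [pd, h3, hs w]
  have g0 : ∀ k, pd k (pd 0 φ) p = _ := fun k => by rw [f0, key, key]
  have g1 : ∀ k, pd k (pd 1 φ) p = _ := fun k => by rw [f1, key, key]
  have g2 : ∀ k, pd k (pd 2 φ) p = _ := fun k => by rw [e2, key]
  have g3 : ∀ k, pd k (pd 3 φ) p = _ := fun k => by rw [e3, key]
  have s1 := hs (1, 0, 0) (I, 0, 0)
  have s2 := hs (1, 0, 0) (0, 1, 0)
  have s3 := hs (1, 0, 0) (0, 0, 1)
  have s4 := hs (I, 0, 0) (0, 1, 0)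
  have s5 := hs (I, 0, 0) (0, 0, 1)
  have s6 := hs (0, 1, 0) (0, 0, 1)
  fin_cases i <;> fin_cases j <;> simp [g0, g1, g2, g3, s1, s2, s3, s4, s5, s6] <;> ring

theorem fderiv_eq_zero_of_pd_eq_zero {φ : Spacetime → ℂ} {p : Spacetime}
    (h : ∀ i, pd i φ p = 0) : fderiv ℝ φ p = 0 := by
  have h0 : (fderiv ℝ φ p (1, 0, 0) - I * fderiv ℝ φ p (I, 0, 0)) / 2 = 0 := h 0
  have h1 : (fderiv ℝ φ p (1, 0, 0) + I * fderiv ℝ φ p (I, 0, 0)) / 2 = 0 := h 1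
  have h2 : fderiv ℝ φ p (0, 1, 0) = 0 := h 2
  have h3 : fderiv ℝ φ p (0, 0, 1) = 0 := h 3
  have a1 : fderiv ℝ φ p (1, 0, 0) = 0 := by linear_combination h0 + h1
  have a2 : fderiv ℝ φ p (I, 0, 0) = 0 := by
    have : I * fderiv ℝ φ p (I, 0, 0) = 0 := by linear_combination h1 - h0
    simpa using this
  refine ContinuousLinearMap.ext fun ⟨z, u, v⟩ => ?_
  have : ((z, u, v) : Spacetime) = z.re • ((1, 0, 0) : Spacetime) + z.im • ((I, 0, 0) : Spacetime)
      + u • ((0, 1, 0) : Spacetime) + v • ((0, 0, 1) : Spacetime) := by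
    ext <;> simp
  rw [this]
  simp only [map_add, map_smul, a1, a2, h2, h3]
  simp

/-- Source of all global constants, in particular of P and m: this is where connectedness of Ω
enters. -/
theorem exists_eq_const_of_pd_eq_zero {φ : Spacetime → ℂ} {M : Set Spacetime} (hM : IsOpen M)
    (hc : IsPreconnected M) (hφ : ContDiffOn ℝ ∞ φ M) (h : ∀ p ∈ M, ∀ i, pd i φ p = 0) :
    ∃ c, ∀ p ∈ M, φ p = c :=
  hM.exists_is_const_of_fderiv_eq_zero hc (hφ.differentiableOn (by simp))
    fun p hp => fderiv_eq_zero_of_pd_eq_zero (h p hp)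

/-! ## Profiles: functions of `(ζ, u)` analytic in `ζ` -/

/-- The derivative along `ζ` of a function of `(ζ, u)` that is analytic in `ζ`. -/
noncomputable def zDeriv (φ : ℂ × ℝ → ℂ) (x : ℂ × ℝ) : ℂ := fderiv ℝ φ x (1, 0)

/-- The derivative along `u` of a function of `(ζ, u)`. -/
noncomputable def uDeriv (φ : ℂ × ℝ → ℂ) (x : ℂ × ℝ) : ℂ := fderiv ℝ φ x (0, 1)

/-- A function of `(ζ, u)` as a function on spacetime. -/
def spLift (φ : ℂ × ℝ → ℂ) (p : Spacetime) : ℂ := φ (p.1, p.2.1)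

theorem zDeriv_congr {φ ψ : ℂ × ℝ → ℂ} {x : ℂ × ℝ} (h : φ =ᶠ[𝓝 x] ψ) :
    zDeriv φ x = zDeriv ψ x := by
  unfold zDeriv; rw [h.fderiv_eq]

theorem uDeriv_congr {φ ψ : ℂ × ℝ → ℂ} {x : ℂ × ℝ} (h : φ =ᶠ[𝓝 x] ψ) :
    uDeriv φ x = uDeriv ψ x := by
  unfold uDeriv; rw [h.fderiv_eq]

@[simp] theorem zDeriv_const (c : ℂ) (x : ℂ × ℝ) : zDeriv (fun _ => c) x = 0 := by
  simp [zDeriv]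

@[simp] theorem uDeriv_const (c : ℂ) (x : ℂ × ℝ) : uDeriv (fun _ => c) x = 0 := by
  simp [uDeriv]

section
variable {φ ψ : ℂ × ℝ → ℂ} {x : ℂ × ℝ}

theorem zDeriv_mul (hφ : DifferentiableAt ℝ φ x) (hψ : DifferentiableAt ℝ ψ x) :
    zDeriv (fun y => φ y * ψ y) x = zDeriv φ x * ψ x + φ x * zDeriv ψ x := by
  simp [zDeriv, fderiv_fun_mul hφ hψ]; ring

theorem uDeriv_mul (hφ : DifferentiableAt ℝ φ x) (hψ : DifferentiableAt ℝ ψ x) :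
    uDeriv (fun y => φ y * ψ y) x = uDeriv φ x * ψ x + φ x * uDeriv ψ x := by
  simp [uDeriv, fderiv_fun_mul hφ hψ]; ring

theorem zDeriv_sub (hφ : DifferentiableAt ℝ φ x) (hψ : DifferentiableAt ℝ ψ x) :
    zDeriv (fun y => φ y - ψ y) x = zDeriv φ x - zDeriv ψ x := by
  simp [zDeriv, fderiv_fun_sub hφ hψ]

theorem uDeriv_sub (hφ : DifferentiableAt ℝ φ x) (hψ : DifferentiableAt ℝ ψ x) :
    uDeriv (fun y => φ y - ψ y) x = uDeriv φ x - uDeriv ψ x := by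
  simp [uDeriv, fderiv_fun_sub hφ hψ]

theorem zDeriv_add (hφ : DifferentiableAt ℝ φ x) (hψ : DifferentiableAt ℝ ψ x) :
    zDeriv (fun y => φ y + ψ y) x = zDeriv φ x + zDeriv ψ x := by
  simp [zDeriv, fderiv_fun_add hφ hψ]

theorem uDeriv_add (hφ : DifferentiableAt ℝ φ x) (hψ : DifferentiableAt ℝ ψ x) :
    uDeriv (fun y => φ y + ψ y) x = uDeriv φ x + uDeriv ψ x := by
  simp [uDeriv, fderiv_fun_add hφ hψ]

theorem zDeriv_neg : zDeriv (fun y => -φ y) x = -zDeriv φ x := by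
  simp [zDeriv, fderiv_fun_neg]

theorem zDeriv_const_mul (c : ℂ) (hφ : DifferentiableAt ℝ φ x) :
    zDeriv (fun y => c * φ y) x = c * zDeriv φ x := by
  rw [zDeriv_mul (differentiableAt_const c) hφ]; simp

theorem uDeriv_const_mul (c : ℂ) (hφ : DifferentiableAt ℝ φ x) :
    uDeriv (fun y => c * φ y) x = c * uDeriv φ x := by
  rw [uDeriv_mul (differentiableAt_const c) hφ]; simp

theorem hasDerivAt_uDeriv (hφ : DifferentiableAt ℝ φ x) :
    HasDerivAt (fun t : ℝ => φ (x.1, t)) (uDeriv φ x) x.2 := by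
  have h1 : HasDerivAt (fun t : ℝ => (x.1, t)) ((0 : ℂ), (1 : ℝ)) x.2 :=
    (hasDerivAt_const _ _).prodMk (hasDerivAt_id _)
  exact HasFDerivAt.comp_hasDerivAt (f := fun t : ℝ => (x.1, t)) x.2 hφ.hasFDerivAt h1

/-- Chain rule along a curve `t ↦ (z t, t)`, for a function analytic in `ζ`. -/
theorem hasDerivAt_comp_curve {Ω : Set (ℂ × ℝ)} (h : IsProfile φ Ω) (hΩ : IsOpen Ω)
    {z : ℝ → ℂ} {z' : ℂ} {t : ℝ} (hz : HasDerivAt z z' t) (ht : (z t, t) ∈ Ω)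
    (hI : fderiv ℝ φ (z t, t) (I, 0) = I * zDeriv φ (z t, t)) :
    HasDerivAt (fun t => φ (z t, t)) (z' * zDeriv φ (z t, t) + uDeriv φ (z t, t)) t := by
  have h1 : HasDerivAt (fun t : ℝ => (z t, t)) (z', (1 : ℝ)) t := hz.prodMk (hasDerivAt_id _)
  have h2 := HasFDerivAt.comp_hasDerivAt (f := fun t : ℝ => (z t, t)) t
    (h.1.differentiableAt_of_isOpen hΩ ht).hasFDerivAt h1
  have : ((z', (1 : ℝ)) : ℂ × ℝ) = z'.re • ((1, 0) : ℂ × ℝ) + z'.im • ((I, 0) : ℂ × ℝ)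
      + ((0, 1) : ℂ × ℝ) := by
    ext <;> simp
  have hv : fderiv ℝ φ (z t, t) (z', 1) = z' * zDeriv φ (z t, t) + uDeriv φ (z t, t) := by
    rw [this, map_add, map_add, map_smul, map_smul, hI]
    simp only [zDeriv, uDeriv, real_smul]
    nth_rewrite 3 [← re_add_im z']
    ring
  exact hv ▸ h2

end

theorem hasDerivAt_zDeriv_and_fderiv_I {φ : ℂ × ℝ → ℂ} {x : ℂ × ℝ}
    (h1 : DifferentiableAt ℝ φ x) (h2 : DifferentiableAt ℂ (fun z : ℂ => φ (z, x.2)) x.1) :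
    HasDerivAt (fun z : ℂ => φ (z, x.2)) (zDeriv φ x) x.1 ∧
      fderiv ℝ φ x (I, 0) = I * zDeriv φ x := by
  have hc : HasFDerivAt (fun z : ℂ => (z, x.2)) (ContinuousLinearMap.inl ℝ ℂ ℝ) x.1 :=
    hasFDerivAt_prodMk_left x.1 x.2
  have hr := HasFDerivAt.comp (f := fun z : ℂ => (z, x.2)) x.1 h1.hasFDerivAt hc
  have he := hr.unique (h2.hasDerivAt.hasFDerivAt.restrictScalars ℝ)
  have e1 := DFunLike.congr_fun he 1
  have e2 := DFunLike.congr_fun he I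
  simp at e1 e2
  have e3 : zDeriv φ x = deriv (fun z : ℂ => φ (z, x.2)) x.1 := e1
  exact ⟨e3 ▸ h2.hasDerivAt, by rw [e2, e3]⟩

namespace IsProfile

variable {φ ψ : ℂ × ℝ → ℂ} {Ω : Set (ℂ × ℝ)} {x : ℂ × ℝ}

theorem differentiableAt (h : IsProfile φ Ω) (hΩ : IsOpen Ω) (hx : x ∈ Ω) :
    DifferentiableAt ℝ φ x := h.1.differentiableAt_of_isOpen hΩ hx

theorem hasDerivAt_z (h : IsProfile φ Ω) (hΩ : IsOpen Ω) (hx : x ∈ Ω) :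
    HasDerivAt (fun z : ℂ => φ (z, x.2)) (zDeriv φ x) x.1 :=
  (hasDerivAt_zDeriv_and_fderiv_I (h.differentiableAt hΩ hx) (h.2 x hx)).1

theorem fderiv_I (h : IsProfile φ Ω) (hΩ : IsOpen Ω) (hx : x ∈ Ω) :
    fderiv ℝ φ x (I, 0) = I * zDeriv φ x :=
  (hasDerivAt_zDeriv_and_fderiv_I (h.differentiableAt hΩ hx) (h.2 x hx)).2

/-- These are the Cauchy–Riemann equations at fixed u: a real-linear map of ℂ that commutes with
multiplication by i is complex-linear. -/
theorem of_fderiv_I (h : ContDiffOn ℝ ∞ φ Ω) (hΩ : IsOpen Ω)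
    (hI : ∀ x ∈ Ω, fderiv ℝ φ x (I, 0) = I * fderiv ℝ φ x (1, 0)) : IsProfile φ Ω := by
  refine ⟨h, fun x hx => ?_⟩
  have hc : HasFDerivAt (fun z : ℂ => (z, x.2)) (ContinuousLinearMap.inl ℝ ℂ ℝ) x.1 :=
    hasFDerivAt_prodMk_left x.1 x.2
  have hr := HasFDerivAt.comp (f := fun z : ℂ => (z, x.2)) x.1
    (h.differentiableAt_of_isOpen hΩ hx).hasFDerivAt hc
  refine (differentiableAt_iff_restrictScalars ℝ hr.differentiableAt).2
    ⟨ContinuousLinearMap.toSpanSingleton ℂ (fderiv ℝ φ x (1, 0)), ?_⟩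
  erw [hr.fderiv]
  refine ContinuousLinearMap.ext fun z => ?_
  have : ((z, 0) : ℂ × ℝ) = z.re • ((1, 0) : ℂ × ℝ) + z.im • ((I, 0) : ℂ × ℝ) := by
    ext <;> simp
  simp only [ContinuousLinearMap.coe_restrictScalars', ContinuousLinearMap.comp_apply,
    ContinuousLinearMap.inl_apply, ContinuousLinearMap.toSpanSingleton_apply, this, map_add,
    map_smul, hI x hx, real_smul, smul_eq_mul]
  nth_rewrite 1 [← re_add_im z]
  ring

theorem congr (h : IsProfile φ Ω) (hΩ : IsOpen Ω) (he : ∀ x ∈ Ω, ψ x = φ x) :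
    IsProfile ψ Ω := by
  refine ⟨h.1.congr he, fun x hx => (h.2 x hx).congr_of_eventuallyEq ?_⟩
  have : ∀ᶠ z in 𝓝 x.1, (z, x.2) ∈ Ω :=
    (Continuous.prodMk_left x.2).continuousAt.eventually_mem (hΩ.mem_nhds hx)
  filter_upwards [this] with z hz using he _ hz

theorem mono (h : IsProfile φ Ω) {s : Set (ℂ × ℝ)} (hs : s ⊆ Ω) : IsProfile φ s :=
  ⟨h.1.mono hs, fun x hx => h.2 x (hs hx)⟩

theorem const (c : ℂ) : IsProfile (fun _ => c) Ω :=
  ⟨contDiffOn_const, fun _ _ => differentiableAt_const _⟩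

theorem fst : IsProfile (fun x => x.1) Ω :=
  ⟨contDiff_fst.contDiffOn, fun _ _ => differentiableAt_id⟩

theorem comp_snd {g : ℝ → ℂ} {s : Set ℝ} (h : ContDiffOn ℝ ∞ g s) (hs : ∀ x ∈ Ω, x.2 ∈ s) :
    IsProfile (fun x => g x.2) Ω :=
  ⟨h.comp contDiff_snd.contDiffOn hs, fun x _ =>
    (differentiableAt_const (g x.2) : DifferentiableAt ℂ (fun _ : ℂ => g x.2) x.1)⟩

theorem add (h : IsProfile φ Ω) (h' : IsProfile ψ Ω) : IsProfile (fun x => φ x + ψ x) Ω :=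
  ⟨h.1.add h'.1, fun x hx => (h.2 x hx).add (h'.2 x hx)⟩

theorem sub (h : IsProfile φ Ω) (h' : IsProfile ψ Ω) : IsProfile (fun x => φ x - ψ x) Ω :=
  ⟨h.1.sub h'.1, fun x hx => (h.2 x hx).sub (h'.2 x hx)⟩

theorem mul (h : IsProfile φ Ω) (h' : IsProfile ψ Ω) : IsProfile (fun x => φ x * ψ x) Ω :=
  ⟨h.1.mul h'.1, fun x hx => (h.2 x hx).mul (h'.2 x hx)⟩

theorem neg (h : IsProfile φ Ω) : IsProfile (fun x => -φ x) Ω :=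
  ⟨h.1.neg, fun x hx => (h.2 x hx).neg⟩

theorem div (h : IsProfile φ Ω) (h' : IsProfile ψ Ω) (h0 : ∀ x ∈ Ω, ψ x ≠ 0) :
    IsProfile (fun x => φ x / ψ x) Ω :=
  ⟨by simp only [div_eq_mul_inv]; exact h.1.mul (h'.1.inv h0),
    fun x hx => (h.2 x hx).div (h'.2 x hx) (h0 x hx)⟩

theorem comp_analytic {F : ℂ → ℂ} {s : Set ℂ} (h : IsProfile φ Ω) (hs : IsOpen s)
    (hF : DifferentiableOn ℂ F s) (hm : ∀ x ∈ Ω, φ x ∈ s) : IsProfile (fun x => F (φ x)) Ω :=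
  ⟨(((hF.contDiffOn (n := ∞) hs).restrict_scalars ℝ).comp h.1 hm), fun x hx =>
    DifferentiableAt.comp (f := fun z => φ (z, x.2)) x.1
      (hF.differentiableAt (hs.mem_nhds (hm x hx))) (h.2 x hx)⟩

theorem contDiffOn_fderiv_apply (h : IsProfile φ Ω) (hΩ : IsOpen Ω) (w : ℂ × ℝ) :
    ContDiffOn ℝ ∞ (fun y => fderiv ℝ φ y w) Ω :=
  (h.1.fderiv_of_isOpen hΩ (by simp)).clm_apply contDiffOn_const

theorem fderiv_fderiv_apply_comm (h : IsProfile φ Ω) (hΩ : IsOpen Ω) (hx : x ∈ Ω)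
    (v w : ℂ × ℝ) : fderiv ℝ (fun y => fderiv ℝ φ y w) x v
      = fderiv ℝ (fun y => fderiv ℝ φ y v) x w := by
  have hd : DifferentiableAt ℝ (fderiv ℝ φ) x :=
    ((h.1.fderiv_of_isOpen hΩ (by simp)) : ContDiffOn ℝ ∞ _ Ω).differentiableAt_of_isOpen hΩ hx
  rw [fderiv_clm_apply hd (differentiableAt_const w),
    fderiv_clm_apply hd (differentiableAt_const v)]
  simpa using ((h.1.contDiffAt (hΩ.mem_nhds hx)).isSymmSndFDerivAt
    (by rw [minSmoothness_of_isRCLikeNormedField]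
        exact WithTop.coe_le_coe.2 (le_top : (2 : ℕ∞) ≤ ⊤))).eq v w

/-- The Cauchy–Riemann equation has constant coefficients, so it survives directional
differentiation. Hence f_ζ, f_u, β and w all remain holomorphic in ζ. -/
theorem fderiv_apply (h : IsProfile φ Ω) (hΩ : IsOpen Ω) (w : ℂ × ℝ) :
    IsProfile (fun y => fderiv ℝ φ y w) Ω := by
  refine of_fderiv_I (h.contDiffOn_fderiv_apply hΩ w) hΩ fun x hx => ?_
  rw [h.fderiv_fderiv_apply_comm hΩ hx (I, 0) w, h.fderiv_fderiv_apply_comm hΩ hx (1, 0) w]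
  have : (fun y => fderiv ℝ φ y (I, 0)) =ᶠ[𝓝 x] fun y => I * fderiv ℝ φ y (1, 0) :=
    Filter.eventually_of_mem (hΩ.mem_nhds hx) fun y hy => h.fderiv_I hΩ hy
  rw [this.fderiv_eq, fderiv_const_mul
    ((h.contDiffOn_fderiv_apply hΩ _).differentiableAt_of_isOpen hΩ hx)]
  simp

theorem zDeriv (h : IsProfile φ Ω) (hΩ : IsOpen Ω) : IsProfile (zDeriv φ) Ω :=
  h.fderiv_apply hΩ _

theorem uDeriv (h : IsProfile φ Ω) (hΩ : IsOpen Ω) : IsProfile (uDeriv φ) Ω :=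
  h.fderiv_apply hΩ _

theorem zDeriv_uDeriv (h : IsProfile φ Ω) (hΩ : IsOpen Ω) (hx : x ∈ Ω) :
    _root_.zDeriv (_root_.uDeriv φ) x = _root_.uDeriv (_root_.zDeriv φ) x :=
  h.fderiv_fderiv_apply_comm hΩ hx _ _

theorem hasDerivAt_curve (h : IsProfile φ Ω) (hΩ : IsOpen Ω)
    {z : ℝ → ℂ} {z' : ℂ} {t : ℝ} (hz : HasDerivAt z z' t) (ht : (z t, t) ∈ Ω) :
    HasDerivAt (fun t => φ (z t, t))
      (z' * _root_.zDeriv φ (z t, t) + _root_.uDeriv φ (z t, t)) t :=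
  hasDerivAt_comp_curve h hΩ hz ht (h.fderiv_I hΩ ht)

/-- A real-valued function analytic in `ζ` does not depend on `ζ`. -/
theorem zDeriv_eq_zero_of_real (h : IsProfile φ Ω) (hΩ : IsOpen Ω)
    (hr : ∀ x ∈ Ω, conj (φ x) = φ x) (hx : x ∈ Ω) : _root_.zDeriv φ x = 0 := by
  have h1 : (conjCLE : ℂ →L[ℝ] ℂ).comp (fderiv ℝ φ x) = fderiv ℝ φ x := by
    rw [← (conjCLE.hasFDerivAt.comp x (h.differentiableAt hΩ hx).hasFDerivAt).fderiv]
    exact Filter.EventuallyEq.fderiv_eq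
      (Filter.eventually_of_mem (hΩ.mem_nhds hx) fun y hy => hr y hy)
  have e1 := DFunLike.congr_fun h1 (1, 0)
  have e2 := DFunLike.congr_fun h1 (I, 0)
  simp only [ContinuousLinearMap.comp_apply, ContinuousLinearEquiv.coe_coe, conjCLE_apply,
    h.fderiv_I hΩ hx, map_mul, conj_I] at e1 e2
  change conj (_root_.zDeriv φ x) = _root_.zDeriv φ x at e1
  rw [e1] at e2
  have : I * _root_.zDeriv φ x = 0 := by linear_combination -e2 / 2
  simpa using this

end IsProfile

section lift

variable {φ : ℂ × ℝ → ℂ} {Ω : Set (ℂ × ℝ)} {p : Spacetime}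

theorem isOpen_region (hΩ : IsOpen Ω) : IsOpen (region Ω) :=
  hΩ.preimage (by fun_prop : Continuous fun p : Spacetime => (p.1, p.2.1))

theorem isPreconnected_region (hΩ : IsConnected Ω) : IsPreconnected (region Ω) := by
  have h : region Ω = (fun y : (ℂ × ℝ) × ℝ => ((y.1.1, y.1.2, y.2) : Spacetime)) ''
      (Ω ×ˢ Set.univ) := by
    ext ⟨z, u, v⟩
    simp [region]
  rw [h]
  exact (hΩ.isPreconnected.prod isPreconnected_univ).image _ (by fun_prop)

theorem contDiffOn_lift (h : ContDiffOn ℝ ∞ φ Ω) : ContDiffOn ℝ ∞ (spLift φ) (region Ω) :=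
  h.comp (g := φ) (f := fun p : Spacetime => (p.1, p.2.1))
    (by fun_prop : ContDiff ℝ ∞ fun p : Spacetime => (p.1, p.2.1)).contDiffOn fun _ hp => hp

theorem fderiv_lift (hφ : DifferentiableAt ℝ φ (p.1, p.2.1)) (w : Spacetime) :
    fderiv ℝ (spLift φ) p w = fderiv ℝ φ (p.1, p.2.1) (w.1, w.2.1) := by
  have h1 : HasFDerivAt (fun p : Spacetime => (p.1, p.2.1))
      ((ContinuousLinearMap.fst ℝ ℂ (ℝ × ℝ)).prod ((ContinuousLinearMap.fst ℝ ℝ ℝ).comp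
        (ContinuousLinearMap.snd ℝ ℂ (ℝ × ℝ)))) p :=
    hasFDerivAt_fst.prodMk (hasFDerivAt_fst.comp p hasFDerivAt_snd)
  have h2 := HasFDerivAt.comp (g := φ) (f := fun p : Spacetime => (p.1, p.2.1)) p
    hφ.hasFDerivAt h1
  have h3 : fderiv ℝ (spLift φ) p = _ := h2.fderiv
  rw [h3]; rfl

theorem pd_lift (h : IsProfile φ Ω) (hΩ : IsOpen Ω) (hp : p ∈ region Ω) (i : Fin 4) :
    pd i (spLift φ) p = ![spLift (zDeriv φ) p, 0, spLift (uDeriv φ) p, 0] i := by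
  have hd := h.differentiableAt hΩ hp
  have hI := h.fderiv_I hΩ hp
  have e : ∀ w, fderiv ℝ (spLift φ) p w = _ := fderiv_lift hd
  fin_cases i
  · simp only [pd, e, hI]
    simp [spLift, zDeriv, ← mul_assoc]
  · simp only [pd, e, hI]
    simp [zDeriv, ← mul_assoc]
  · simp only [pd, e]
    simp [spLift, uDeriv]
  · simp only [pd, e]
    simp only [Fin.reduceFinMk, Matrix.cons_val]
    exact map_zero _

end lift

/-! ## The Levi-Civita connection of a pp-wave -/

section metric

variable {f : ℂ × ℝ → ℂ} {Ω : Set (ℂ × ℝ)} {p : Spacetime}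

/-- The coordinate derivatives of the function `f + f*` in the metric. -/
noncomputable def waveDeriv (f : ℂ × ℝ → ℂ) (p : Spacetime) (i : Fin 4) : ℂ :=
  ![spLift (zDeriv f) p, conj (spLift (zDeriv f) p),
    spLift (uDeriv f) p + conj (spLift (uDeriv f) p), 0] i

theorem differentiableAt_spLift (hf : IsProfile f Ω) (hΩ : IsOpen Ω) (hp : p ∈ region Ω) :
    DifferentiableAt ℝ (spLift f) p :=
  (contDiffOn_lift hf.1).differentiableAt_of_isOpen (isOpen_region hΩ) hp

theorem DifferentiableAt.conj_complex {E : Type*} [NormedAddCommGroup E] [NormedSpace ℝ E]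
    {φ : E → ℂ} {x : E} (h : DifferentiableAt ℝ φ x) :
    DifferentiableAt ℝ (fun q => conj (φ q)) x :=
  conjCLE.differentiableAt.comp x h

theorem ContDiffOn.conj_complex {E : Type*} [NormedAddCommGroup E] [NormedSpace ℝ E]
    {φ : E → ℂ} {s : Set E} (h : ContDiffOn ℝ ∞ φ s) :
    ContDiffOn ℝ ∞ (fun q => conj (φ q)) s :=
  conjCLE.contDiff.comp_contDiffOn h

theorem pd_wave (hf : IsProfile f Ω) (hΩ : IsOpen Ω) (hp : p ∈ region Ω) (i : Fin 4) :
    pd i (fun q : Spacetime => f (q.1, q.2.1) + conj (f (q.1, q.2.1))) p = waveDeriv f p i := by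
  have hd := differentiableAt_spLift hf hΩ hp
  have h1 := pd_add hd hd.conj_complex i
  rw [pd_conj hd, pd_lift hf hΩ hp, pd_lift hf hΩ hp] at h1
  refine Eq.trans h1 ?_
  fin_cases i <;> simp [waveDeriv]

theorem pd_ppMetric (hf : IsProfile f Ω) (hΩ : IsOpen Ω) (hp : p ∈ region Ω) (i j k : Fin 4) :
    pd i (fun q => ppMetric f q j k) p = if j = 2 ∧ k = 2 then -waveDeriv f p i else 0 := by
  rw [← pd_wave hf hΩ hp i, ← pd_neg]
  fin_cases j <;> fin_cases k <;> simp [ppMetric]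

theorem ppInner_eq (X Y : CVec) : ppInner f p X Y = X 0 * Y 1 + X 1 * Y 0
    - (f (p.1, p.2.1) + conj (f (p.1, p.2.1))) * X 2 * Y 2 - X 2 * Y 3 - X 3 * Y 2 := by
  simp [ppInner, Fin.sum_univ_four, ppMetric]; ring

theorem connForm_eq (hf : IsProfile f Ω) (hΩ : IsOpen Ω) (hp : p ∈ region Ω)
    (e : Fin 4 → Spacetime → CVec) (a b i : Fin 4) :
    connForm f e a b p i = e a p 0 * pd i (fun q => e b q 1) p
      + e a p 1 * pd i (fun q => e b q 0) p
      - (f (p.1, p.2.1) + conj (f (p.1, p.2.1))) * e a p 2 * pd i (fun q => e b q 2) p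
      - e a p 2 * pd i (fun q => e b q 3) p - e a p 3 * pd i (fun q => e b q 2) p
      + (-waveDeriv f p i * e b p 2 * e a p 2
        + if i = 2 then (e b p 2 * ∑ j, waveDeriv f p j * e a p j)
          - e a p 2 * ∑ j, waveDeriv f p j * e b p j else 0) / 2 := by
  simp only [connForm, christoffel, pd_ppMetric hf hΩ hp, Fin.sum_univ_four]
  by_cases hi : i = 2
  · subst hi
    simp [ppMetric]; ring
  · simp [ppMetric, hi]; ring

/-- This is ∇g = 0. For a tetrad with constant scalar products it gives the antisymmetry of ω_{ab}.
-/
theorem connForm_add_swap (hf : IsProfile f Ω) (hΩ : IsOpen Ω) (hp : p ∈ region Ω)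
    {e : Fin 4 → Spacetime → CVec} (hs : ∀ a, ContDiffOn ℝ ∞ (e a) (region Ω)) (a b i : Fin 4) :
    connForm f e a b p i + connForm f e b a p i
      = pd i (fun q => ppInner f q (e a q) (e b q)) p := by
  have hd : ∀ c j, DifferentiableAt ℝ (fun q => e c q j) p := fun c j =>
    differentiableAt_pi.1 ((hs c).differentiableAt_of_isOpen (isOpen_region hΩ) hp) j
  have hH : DifferentiableAt ℝ
      (fun q : Spacetime => f (q.1, q.2.1) + conj (f (q.1, q.2.1))) p :=
    (differentiableAt_spLift hf hΩ hp).add (differentiableAt_spLift hf hΩ hp).conj_complex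
  have m : ∀ j k, DifferentiableAt ℝ (fun q => e a q j * e b q k) p := fun j k =>
    (hd a j).mul (hd b k)
  have mH := hH.fun_mul (hd a 2)
  simp only [ppInner_eq]
  rw [pd_sub ((((m 0 1).fun_add (m 1 0)).fun_sub (mH.fun_mul (hd b 2))).fun_sub (m 2 3)) (m 3 2),
    pd_sub (((m 0 1).fun_add (m 1 0)).fun_sub (mH.fun_mul (hd b 2))) (m 2 3),
    pd_sub ((m 0 1).fun_add (m 1 0)) (mH.fun_mul (hd b 2)), pd_add (m 0 1) (m 1 0),
    pd_mul mH (hd b 2), pd_mul hH (hd a 2), pd_wave hf hΩ hp]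
  simp only [pd_mul (hd a _) (hd b _), connForm_eq hf hΩ hp]
  split_ifs <;> ring

end metric

/-! ## Connection and curvature of a normalized tetrad -/

section tetrad

variable {f : ℂ × ℝ → ℂ} {Ω : Set (ℂ × ℝ)} {e : Fin 4 → Spacetime → CVec} {p : Spacetime}

/-- Alignment, orientation and the null relations leave d = D^v real, a = δ^ζ of modulus one, and
Δ^ζ; the other components follow from these, and of Δ^v only the reality is recorded. -/
theorem IsNormalizedTetrad.components {M : Set Spacetime} (he : IsNormalizedTetrad f M e)
    (hp : p ∈ M) :
    (conj (e 3 p 3) = e 3 p 3 ∧ e 3 p 3 ≠ 0 ∧ e 0 p 0 * conj (e 0 p 0) = 1) ∧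
    (e 0 p 1 = 0 ∧ e 0 p 2 = 0 ∧ e 0 p 3 = e 0 p 0 * conj (e 2 p 0) * e 3 p 3) ∧
    (e 1 p 0 = 0 ∧ e 1 p 1 = conj (e 0 p 0) ∧ e 1 p 2 = 0 ∧
      e 1 p 3 = conj (e 0 p 0) * e 2 p 0 * e 3 p 3) ∧
    (e 2 p 1 = conj (e 2 p 0) ∧ e 2 p 2 = (e 3 p 3)⁻¹ ∧ conj (e 2 p 3) = e 2 p 3) ∧
    (e 3 p 0 = 0 ∧ e 3 p 1 = 0 ∧ e 3 p 2 = 0) := by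
  have h1 := he.conj_delta p hp
  have h2 := he.real_Delta p hp
  have h3 := he.real_D p hp
  obtain ⟨d0, d1, d2⟩ := he.aligned p hp
  have o := he.oriented p hp
  have n := he.null p hp
  simp only [ppInner_eq] at n
  have c1 := fun i => congrFun h1 i
  have c2 := fun i => congrFun h2 i
  have c3 := fun i => congrFun h3 i
  have e10 := c1 0
  have e11 := c1 1
  have e12 := c1 2
  have e13 := c1 3
  have e21 := c2 1
  have e22 := c2 2
  have e23 := c2 3
  have e33 := c3 3
  simp [conjVec] at e10 e11 e12 e13 e21 e22 e23 e33
  have n23 := n 2 3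
  have n03 := n 0 3
  have n01 := n 0 1
  have n02 := n 0 2
  simp [nullEta, d0, d1, d2, o, e10, e11, e12] at n23 n03 n01 n02
  have hd : e 3 p 3 ≠ 0 := fun h => by simp [h] at n23
  have o2 : e 0 p 2 = 0 := by
    rcases n03 with h | h
    · exact h
    · exact absurd h hd
  have hc : e 2 p 2 = (e 3 p 3)⁻¹ := by
    field_simp
    linear_combination n23
  have h03 : e 0 p 3 = e 0 p 0 * conj (e 2 p 0) * e 3 p 3 := by
    rw [o2, hc, ← e21] at n02
    field_simp at n02
    linear_combination -n02
  refine ⟨⟨e33, hd, ?_⟩, ⟨o, o2, h03⟩, ⟨?_, e11, ?_, ?_⟩, ⟨e21.symm, hc, e23⟩, d0, d1, d2⟩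
  · rw [o2] at n01; simpa using n01
  · rw [e10, o]; simp
  · rw [e12, o2]; simp
  · rw [e13, h03]; simp [e33]

/-- The product `D^v δ^ζ` of tetrad components. -/
noncomputable def tetradScale (e : Fin 4 → Spacetime → CVec) (p : Spacetime) : ℂ :=
  e 3 p 3 * e 0 p 0

theorem IsNormalizedTetrad.contDiffOn_component
    (he : IsNormalizedTetrad f (region Ω) e) (a j : Fin 4) :
    ContDiffOn ℝ ∞ (fun q => e a q j) (region Ω) :=
  contDiffOn_pi.1 (he.smooth a) j

theorem IsNormalizedTetrad.differentiableAt_component (he : IsNormalizedTetrad f (region Ω) e)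
    (hΩ : IsOpen Ω) (hp : p ∈ region Ω) (a j : Fin 4) :
    DifferentiableAt ℝ (fun q => e a q j) p :=
  (he.contDiffOn_component a j).differentiableAt_of_isOpen (isOpen_region hΩ) hp

theorem IsNormalizedTetrad.tetradScale_ne_zero
    (he : IsNormalizedTetrad f (region Ω) e) (hp : p ∈ region Ω) :
    tetradScale e p ≠ 0 := by
  obtain ⟨⟨_, hd, ha⟩, _⟩ := he.components hp
  exact mul_ne_zero hd fun h => by simp [h] at ha

/-- With D = d ∂_v and a = δ^ζ, ω₃₄ contributes −d log d and ω₁₂ contributes −d log a. The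
Christoffel terms drop out because neither D nor δ has a ∂_u component. -/
theorem IsNormalizedTetrad.connForm_zero_one_add (he : IsNormalizedTetrad f (region Ω) e)
    (hf : IsProfile f Ω) (hΩ : IsOpen Ω) (hp : p ∈ region Ω) (i : Fin 4) :
    connForm f e 0 1 p i + connForm f e 2 3 p i
      = -(pd i (tetradScale e) p / tetradScale e p) := by
  have D := he.differentiableAt_component hΩ hp
  obtain ⟨⟨hdr, hd, ha⟩, ⟨h01, h02, h03⟩, ⟨h10, h11, h12, h13⟩, ⟨h21, h22, h23⟩, h30, h31, h32⟩ :=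
    he.components hp
  have z := fun (q : Spacetime) (hq : q ∈ region Ω) => he.components hq
  have ha0 : e 0 p 0 ≠ 0 := fun h => by simp [h] at ha
  have p11 : pd i (fun q => e 1 q 1) p = pd i (fun q => conj (e 0 q 0)) p :=
    pd_congr_on (isOpen_region hΩ) (fun q hq => (z q hq).2.2.1.2.1) hp i
  have p3 : ∀ k, k ≠ 3 → pd i (fun q => e 3 q k) p = 0 := by
    intro k hk
    rw [pd_congr_on (isOpen_region hΩ) (ψ := fun _ => 0) _ hp i, pd_const]
    intro q hq
    obtain ⟨_, _, _, _, a0, a1, a2⟩ := z q hq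
    fin_cases k <;> simp_all
  have p12 : pd i (fun q => e 1 q 2) p = 0 := by
    rw [pd_congr_on (isOpen_region hΩ) (ψ := fun _ => 0) (fun q hq => (z q hq).2.2.1.2.2.1) hp i,
      pd_const]
  -- Derivative of |a|² = 1, which trades da* for −da.
  have hu : pd i (fun q => e 0 q 0) p * conj (e 0 p 0)
      + e 0 p 0 * pd i (fun q => conj (e 0 q 0)) p = 0 := by
    rw [← pd_mul (D 0 0) (D 0 0).conj_complex, pd_congr_on (isOpen_region hΩ)
      (ψ := fun _ => 1) (fun q hq => (z q hq).1.2.2) hp i, pd_const]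
  have hq : pd i (tetradScale e) p = _ := pd_mul (D 3 3) (D 0 0) i
  rw [connForm_eq hf hΩ hp, connForm_eq hf hΩ hp, hq, tetradScale, p3 0 (by decide),
    p3 1 (by decide), p3 2 (by decide), p12, p11]
  simp only [Fin.sum_univ_four, h01, h02, h10, h11, h12, h22, h30, h31, h32, waveDeriv]
  have ha' : conj (e 0 p 0) = (e 0 p 0)⁻¹ := eq_inv_of_mul_eq_one_right ha
  rw [ha'] at hu
  simp
  field_simp at hu ⊢
  linear_combination e 3 p 3 * hu

theorem IsNormalizedTetrad.connForm_one_two (he : IsNormalizedTetrad f (region Ω) e)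
    (hf : IsProfile f Ω) (hΩ : IsOpen Ω) (hp : p ∈ region Ω) (i : Fin 4) :
    connForm f e 1 2 p i = (tetradScale e p)⁻¹ * (pd i (fun q => e 2 q 0 * e 3 q 3) p
      + if i = 2 then conj (spLift (zDeriv f) p) / 2 else 0) := by
  have D := he.differentiableAt_component hΩ hp
  obtain ⟨⟨hdr, hd, ha⟩, ⟨h01, h02, h03⟩, ⟨h10, h11, h12, h13⟩, ⟨h21, h22, h23⟩, h30, h31, h32⟩ :=
    he.components hp
  have p22 : pd i (fun q => e 2 q 2) p = -pd i (fun q => e 3 q 3) p / e 3 p 3 ^ 2 := by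
    rw [← pd_inv (D 3 3) hd]
    exact pd_congr_on (isOpen_region hΩ) (fun q hq => (he.components hq).2.2.2.1.2.1) hp i
  have ha0 : e 0 p 0 ≠ 0 := fun h => by simp [h] at ha
  have ha' : conj (e 0 p 0) = (e 0 p 0)⁻¹ := eq_inv_of_mul_eq_one_right ha
  rw [connForm_eq hf hΩ hp, pd_mul (D 2 0) (D 3 3), p22]
  simp only [Fin.sum_univ_four, h10, h11, h12, h13, h22, waveDeriv, ha', tetradScale]
  by_cases hi : i = 2
  · subst hi
    simp
    field_simp
    ring
  · simp [hi]
    field_simp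
    ring

theorem IsNormalizedTetrad.connForm_swap (he : IsNormalizedTetrad f (region Ω) e)
    (hf : IsProfile f Ω) (hΩ : IsOpen Ω) (hp : p ∈ region Ω) (a b i : Fin 4) :
    connForm f e a b p i = -connForm f e b a p i := by
  have h := connForm_add_swap hf hΩ hp he.smooth a b i
  rw [pd_congr_on (isOpen_region hΩ) (ψ := fun _ => nullEta a b)
    (fun q hq => he.null q hq a b) hp i, pd_const] at h
  linear_combination h

/-- In the structure equation ω₂₃ is wedged only with ω₁₂ + ω₃₄, which is −d log of `tetradScale`;
this cancels the derivative of the prefactor of ω₂₃. The exact part of ω₂₃ dies by d² = 0, and only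
the term (f_ζ)* du survives. -/
theorem IsNormalizedTetrad.curvForm_one_two (he : IsNormalizedTetrad f (region Ω) e)
    (hf : IsProfile f Ω) (hΩ : IsOpen Ω) (hp : p ∈ region Ω) (i j : Fin 4) :
    curvForm f e 1 2 p i j = (tetradScale e p)⁻¹ / 2 *
      ((if j = 2 then pd i (fun q => conj (spLift (zDeriv f) q)) p else 0)
        - if i = 2 then pd j (fun q => conj (spLift (zDeriv f) q)) p else 0) := by
  have hM := isOpen_region hΩ
  have S := he.contDiffOn_component
  have hs0 := he.tetradScale_ne_zero hp
  have Sq : ContDiffOn ℝ ∞ (tetradScale e) (region Ω) := (S 3 3).mul (S 0 0)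
  have Dq := Sq.differentiableAt_of_isOpen hM hp
  have Dqi : DifferentiableAt ℝ (fun q => (tetradScale e q)⁻¹) p := Dq.inv hs0
  have Sb : ContDiffOn ℝ ∞ (fun q => e 2 q 0 * e 3 q 3) (region Ω) := (S 2 0).mul (S 3 3)
  have Sf : ContDiffOn ℝ ∞ (fun q => conj (spLift (zDeriv f) q)) (region Ω) :=
    (contDiffOn_lift (hf.zDeriv hΩ).1).conj_complex
  have Df := Sf.differentiableAt_of_isOpen hM hp
  have Db := fun k => ((Sb.pd hM k).differentiableAt_of_isOpen hM hp)
  have K : ∀ k l, pd k (fun q => connForm f e 1 2 q l) p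
      = -pd k (tetradScale e) p / tetradScale e p * connForm f e 1 2 p l
        + (tetradScale e p)⁻¹ * (pd k (pd l (fun q => e 2 q 0 * e 3 q 3)) p
          + if l = 2 then pd k (fun q => conj (spLift (zDeriv f) q)) p / 2 else 0) := by
    intro k l
    rw [pd_congr_on hM (fun q hq => he.connForm_one_two hf hΩ hq l) hp k,
      he.connForm_one_two hf hΩ hp]
    by_cases hl : l = 2
    · simp only [hl, if_true]
      have D1 : DifferentiableAt ℝ (fun q => conj (spLift (zDeriv f) q) / 2) p := by
        simp only [div_eq_mul_inv]
        exact Df.fun_mul (differentiableAt_const _)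
      rw [pd_mul Dqi ((Db 2).fun_add D1), pd_inv Dq hs0, pd_add (Db 2) D1]
      have : pd k (fun q => conj (spLift (zDeriv f) q) / 2) p
          = pd k (fun q => conj (spLift (zDeriv f) q)) p / 2 := by
        simp only [div_eq_inv_mul]
        exact pd_const_mul _ Df k
      rw [this]
      field_simp
    · simp only [hl, if_false, add_zero]
      rw [pd_mul Dqi (Db l), pd_inv Dq hs0]
      field_simp
  have c01 := he.connForm_swap hf hΩ hp
  have e10 := fun k => c01 1 0 k
  have e32 := fun k => c01 3 2 k
  have e11 : ∀ k, connForm f e 1 1 p k = 0 := fun k => by linear_combination c01 1 1 k / 2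
  have e22 : ∀ k, connForm f e 2 2 p k = 0 := fun k => by linear_combination c01 2 2 k / 2
  have s := he.connForm_zero_one_add hf hΩ hp
  simp only [curvForm, Fin.sum_univ_four, nullEta, K, pd_comm Sb hM hp i j]
  simp [e11, e22, e10, e32]
  linear_combination (norm := skip) connForm f e 1 2 p i * s j - connForm f e 1 2 p j * s i
  split_ifs <;> ring

theorem IsNormalizedTetrad.weylPsi4_eq (he : IsNormalizedTetrad f (region Ω) e)
    (hf : IsProfile f Ω) (hΩ : IsOpen Ω) (hp : p ∈ region Ω) :
    weylPsi4 f e p = conj (spLift (zDeriv (zDeriv f)) p) / 2 / tetradScale e p ^ 2 := by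
  obtain ⟨⟨hdr, hd, ha⟩, ⟨h01, h02, h03⟩, ⟨h10, h11, h12, h13⟩, ⟨h21, h22, h23⟩, h30, h31, h32⟩ :=
    he.components hp
  have ha0 : e 0 p 0 ≠ 0 := fun h => by simp [h] at ha
  have ha' : conj (e 0 p 0) = (e 0 p 0)⁻¹ := eq_inv_of_mul_eq_one_right ha
  have P : ∀ k, pd k (fun q => conj (spLift (zDeriv f) q)) p
      = conj (![spLift (zDeriv (zDeriv f)) p, 0, spLift (uDeriv (zDeriv f)) p, 0]
        (![1, 0, 2, 3] k)) := fun k => by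
    rw [pd_conj (differentiableAt_spLift (hf.zDeriv hΩ) hΩ hp), pd_lift (hf.zDeriv hΩ) hΩ hp]
  simp only [weylPsi4, he.curvForm_one_two hf hΩ hp, P, Fin.sum_univ_four, h10, h11, h12, h22]
  simp [tetradScale, ha']
  field_simp

end tetrad

/-! ## Reduction to the square root `Q` of `f_ζζ / 2` -/

/-- The `ζ`-velocity `β = -Q_u / Q_ζ` of the level curves of `Q`. -/
noncomputable def levelVelocity (Q : ℂ × ℝ → ℂ) (x : ℂ × ℝ) : ℂ := -uDeriv Q x / zDeriv Q x

/-- The inverse logarithmic derivative `w = Q / Q_ζ`. -/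
noncomputable def invLogDeriv (Q : ℂ × ℝ → ℂ) (x : ℂ × ℝ) : ℂ := Q x / zDeriv Q x

/-- The data of a normalized tetrad, expressed through a function `Q` of `(ζ, u)`, analytic in
`ζ`, with `Q² = f_ζζ / 2`. -/
structure ReducesTo (f : ℂ × ℝ → ℂ) (Ω : Set (ℂ × ℝ)) (e : Fin 4 → Spacetime → CVec)
    (Q : ℂ × ℝ → ℂ) : Prop where
  isOpen : IsOpen Ω
  profile_f : IsProfile f Ω
  tetrad : IsNormalizedTetrad f (region Ω) e
  profile : IsProfile Q Ω
  ne_zero : ∀ x ∈ Ω, Q x ≠ 0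
  zDeriv_ne_zero : ∀ x ∈ Ω, zDeriv Q x ≠ 0
  sq : ∀ x ∈ Ω, Q x ^ 2 = zDeriv (zDeriv f) x / 2
  scale : ∀ p ∈ region Ω, e 3 p 3 * e 0 p 0 = conj (spLift Q p)
  velocity : ∀ p ∈ region Ω, e 2 p 0 * e 3 p 3 = spLift (levelVelocity Q) p
  alpha : ∀ p ∈ region Ω, npAlpha f e p = conj (e 0 p 0 / spLift (invLogDeriv Q) p) / 2
  mu : ∀ p ∈ region Ω, npMu f e p = spLift (zDeriv (levelVelocity Q)) p / e 3 p 3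

theorem IsProfile.levelVelocity {Q : ℂ × ℝ → ℂ} {Ω : Set (ℂ × ℝ)} (h : IsProfile Q Ω)
    (hΩ : IsOpen Ω) (h0 : ∀ x ∈ Ω, _root_.zDeriv Q x ≠ 0) : IsProfile (levelVelocity Q) Ω :=
  (h.uDeriv hΩ).neg.div (h.zDeriv hΩ) h0

theorem IsProfile.invLogDeriv {Q : ℂ × ℝ → ℂ} {Ω : Set (ℂ × ℝ)} (h : IsProfile Q Ω)
    (hΩ : IsOpen Ω) (h0 : ∀ x ∈ Ω, _root_.zDeriv Q x ≠ 0) : IsProfile (invLogDeriv Q) Ω :=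
  h.div (h.zDeriv hΩ) h0

/-- A function on spacetime, restricted to `v = 0`. -/
def sliceZero (φ : Spacetime → ℂ) (x : ℂ × ℝ) : ℂ := φ (x.1, x.2, 0)

/-- A function with vanishing ∂_v is recovered from any slice, since each v-line lies entirely in
the region; v = 0 is an arbitrary choice. -/
theorem spLift_sliceZero {φ : Spacetime → ℂ} {Ω : Set (ℂ × ℝ)} (hΩ : IsOpen Ω)
    (hφ : ContDiffOn ℝ ∞ φ (region Ω)) (h3 : ∀ p ∈ region Ω, pd 3 φ p = 0) {p : Spacetime}
    (hp : p ∈ region Ω) : spLift (sliceZero φ) p = φ p := by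
  obtain ⟨z, u, v⟩ := p
  have hd : ∀ t : ℝ, HasDerivAt (fun t : ℝ => φ (z, u, t)) 0 t := by
    intro t
    have ht : ((z, u, t) : Spacetime) ∈ region Ω := hp
    have h1 : HasDerivAt (fun t : ℝ => ((z, u, t) : Spacetime)) (0, 0, 1) t :=
      (hasDerivAt_const _ _).prodMk ((hasDerivAt_const _ _).prodMk (hasDerivAt_id _))
    have h2 := HasFDerivAt.comp_hasDerivAt (f := fun t : ℝ => ((z, u, t) : Spacetime)) t
      (hφ.differentiableAt_of_isOpen (isOpen_region hΩ) ht).hasFDerivAt h1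
    have h4 : fderiv ℝ φ (z, u, t) (0, 0, 1) = 0 := h3 _ ht
    rwa [h4] at h2
  exact is_const_of_deriv_eq_zero (fun t => (hd t).differentiableAt) (fun t => (hd t).deriv) 0 v

theorem isProfile_sliceZero {φ : Spacetime → ℂ} {Ω : Set (ℂ × ℝ)} (hΩ : IsOpen Ω)
    (hφ : ContDiffOn ℝ ∞ φ (region Ω)) (h1 : ∀ p ∈ region Ω, pd 1 φ p = 0) :
    IsProfile (sliceZero φ) Ω := by
  have hs : ContDiffOn ℝ ∞ (sliceZero φ) Ω :=
    hφ.comp (f := fun x : ℂ × ℝ => ((x.1, x.2, 0) : Spacetime))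
      (by fun_prop : ContDiff ℝ ∞ fun x : ℂ × ℝ => ((x.1, x.2, 0) : Spacetime)).contDiffOn
      fun _ hx => hx
  refine IsProfile.of_fderiv_I hs hΩ fun x hx => ?_
  have hx' : ((x.1, x.2, 0) : Spacetime) ∈ region Ω := hx
  have hi : HasFDerivAt (fun x : ℂ × ℝ => ((x.1, x.2, 0) : Spacetime))
      ((ContinuousLinearMap.fst ℝ ℂ ℝ).prod ((ContinuousLinearMap.snd ℝ ℂ ℝ).prod 0)) x :=
    hasFDerivAt_fst.prodMk (hasFDerivAt_snd.prodMk (hasFDerivAt_const _ _))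
  have h2 := HasFDerivAt.comp (f := fun x : ℂ × ℝ => ((x.1, x.2, 0) : Spacetime)) x
    (hφ.differentiableAt_of_isOpen (isOpen_region hΩ) hx').hasFDerivAt hi
  have h3 : fderiv ℝ (sliceZero φ) x = _ := h2.fderiv
  have h4 : (fderiv ℝ φ (x.1, x.2, 0) (1, 0, 0) + I * fderiv ℝ φ (x.1, x.2, 0) (I, 0, 0)) / 2 = 0 :=
    h1 _ hx'
  rw [h3]
  simp only [ContinuousLinearMap.comp_apply, ContinuousLinearMap.prod_apply,
    ContinuousLinearMap.coe_fst', ContinuousLinearMap.coe_snd', zero_apply]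
  linear_combination -2 * I * h4 + (fderiv ℝ φ (x.1, x.2, 0) (I, 0, 0)) * I_sq

theorem IsNormalizedTetrad.exists_reducesTo {f : ℂ × ℝ → ℂ} {Ω : Set (ℂ × ℝ)}
    {e : Fin 4 → Spacetime → CVec} (he : IsNormalizedTetrad f (region Ω) e)
    (hf : IsProfile f Ω) (hΩ : IsOpen Ω) (hα : ∀ p ∈ region Ω, npAlpha f e p ≠ 0) :
    ∃ Q, ReducesTo f Ω e Q := by
  have hM := isOpen_region hΩ
  have S := he.contDiffOn_component
  have Sq : ContDiffOn ℝ ∞ (tetradScale e) (region Ω) := (S 3 3).mul (S 0 0)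
  have Dq := fun p (hp : p ∈ region Ω) => Sq.differentiableAt_of_isOpen hM hp
  have hff := (hf.zDeriv hΩ).zDeriv hΩ
  have hsq : ∀ p ∈ region Ω, tetradScale e p * tetradScale e p
      = 2⁻¹ * conj (spLift (zDeriv (zDeriv f)) p) := by
    intro p hp
    have h := he.psi4 p hp
    rw [he.weylPsi4_eq hf hΩ hp, div_eq_one_iff_eq (pow_ne_zero 2 (he.tetradScale_ne_zero hp))] at h
    rw [← pow_two, ← h]; ring
  -- The square of the scale is antiholomorphic in ζ and free of v, hence so is the nonvanishing
  -- scale itself.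
  have hq : ∀ p ∈ region Ω, ∀ i, i = 0 ∨ i = 3 → pd i (tetradScale e) p = 0 := by
    intro p hp i hi
    have h := pd_congr_on hM hsq hp i
    have Df := differentiableAt_spLift hff hΩ hp
    rw [pd_mul (Dq p hp) (Dq p hp), pd_const_mul _ Df.conj_complex, pd_conj Df,
      pd_lift hff hΩ hp] at h
    have h0 : tetradScale e p * pd i (tetradScale e) p = 0 := by
      rcases hi with rfl | rfl <;> simp at h <;> linear_combination h / 2
    exact (mul_eq_zero.1 h0).resolve_left (he.tetradScale_ne_zero hp)
  have Sc : ContDiffOn ℝ ∞ (fun q => conj (tetradScale e q)) (region Ω) := Sq.conj_complex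
  have hc3 : ∀ p ∈ region Ω, pd 3 (fun q => conj (tetradScale e q)) p = 0 := fun p hp => by
    rw [pd_conj (Dq p hp)]; simp [hq p hp 3]
  have hc1 : ∀ p ∈ region Ω, pd 1 (fun q => conj (tetradScale e q)) p = 0 := fun p hp => by
    rw [pd_conj (Dq p hp)]; simp [hq p hp 0]
  -- The tetrad itself supplies the root of f_ζζ/2, so no branch has to be chosen on Ω.
  obtain ⟨Q, hQ⟩ : ∃ Q, Q = sliceZero (fun q => conj (tetradScale e q)) := ⟨_, rfl⟩
  have hQp : IsProfile Q Ω := hQ ▸ isProfile_sliceZero hΩ Sc hc1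
  have hQl : ∀ p ∈ region Ω, tetradScale e p = conj (spLift Q p) := fun p hp => by
    rw [hQ, spLift_sliceZero hΩ Sc hc3 hp, conj_conj]
  have hQ0 : ∀ x ∈ Ω, Q x ≠ 0 := fun x hx => by
    have hx' : ((x.1, x.2, 0) : Spacetime) ∈ region Ω := hx
    have h1 := hQl _ hx'
    have h2 := he.tetradScale_ne_zero hx'
    rw [h1] at h2
    exact fun h => h2 (by simp [spLift, h])
  have hpd : ∀ p ∈ region Ω, ∀ i, pd i (tetradScale e) p
      = conj (![spLift (zDeriv Q) p, 0, spLift (uDeriv Q) p, 0] (![1, 0, 2, 3] i)) := by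
    intro p hp i
    rw [pd_congr_on hM hQl hp i, pd_conj (differentiableAt_spLift hQp hΩ hp),
      pd_lift hQp hΩ hp]
  -- α is half of δ* log of the scale, and the scale is Q*.
  have hal : ∀ p ∈ region Ω, npAlpha f e p
      = conj (e 0 p 0) * conj (spLift (zDeriv Q) p) / conj (spLift Q p) / 2 := by
    intro p hp
    obtain ⟨_, _, ⟨h10, h11, h12, h13⟩, _⟩ := he.components hp
    have s := he.connForm_zero_one_add hf hΩ hp
    have s1 := s 1
    have s3 := s 3
    simp [hpd p hp, hQl p hp] at s1 s3
    simp only [npAlpha, pairing, Fin.sum_univ_four, h10, h11, h12]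
    linear_combination -conj (e 0 p 0) * s1 / 2 - e 1 p 3 * s3 / 2
  have hz0 : ∀ x ∈ Ω, zDeriv Q x ≠ 0 := fun x hx h => by
    have hx' : ((x.1, x.2, 0) : Spacetime) ∈ region Ω := hx
    refine hα _ hx' ?_
    rw [hal _ hx']
    simp [spLift, h]
  have hvel : ∀ p ∈ region Ω, e 2 p 0 * e 3 p 3 = spLift (levelVelocity Q) p := by
    intro p hp
    obtain ⟨⟨hdr, hd, ha⟩, _, _, ⟨h21, h22, h23⟩, _⟩ := he.components hp
    have s := he.connForm_zero_one_add hf hΩ hp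
    have g := he.gamma p hp
    have s0 := s 0
    have s1 := s 1
    have s2 := s 2
    have s3 := s 3
    simp [hpd p hp, hQl p hp] at s0 s1 s2 s3
    have hq0 : conj (spLift Q p) ≠ 0 := by
      have : spLift Q p ≠ 0 := hQ0 _ hp
      simpa using this
    have hz : spLift (zDeriv Q) p ≠ 0 := hz0 _ hp
    simp only [npGamma, pairing, Fin.sum_univ_four, h21, h22] at g
    -- γ is half of Δ log of the scale, so γ = 0 means that Δ annihilates Q*. The conjugate
    -- relation, solved for Δ^ζ D^v, gives β.
    have g1 : conj (e 2 p 0) * (conj (spLift (zDeriv Q) p) / conj (spLift Q p))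
        + (e 3 p 3)⁻¹ * (conj (spLift (uDeriv Q) p) / conj (spLift Q p)) = 0 := by
      linear_combination 2 * g + e 2 p 0 * s0 + conj (e 2 p 0) * s1 + (e 3 p 3)⁻¹ * s2
        + e 2 p 3 * s3
    field_simp at g1
    have g2 := congrArg conj g1
    simp [hdr] at g2
    change e 2 p 0 * e 3 p 3 = -spLift (uDeriv Q) p / spLift (zDeriv Q) p
    field_simp
    linear_combination g2
  have hβ := hQp.levelVelocity hΩ hz0
  refine ⟨Q, hΩ, hf, he, hQp, hQ0, hz0, fun x hx => ?_, hQl, hvel, fun p hp => ?_, fun p hp => ?_⟩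
  · have hx' : ((x.1, x.2, 0) : Spacetime) ∈ region Ω := hx
    have h := congrArg conj (hsq _ hx')
    rw [hQl _ hx'] at h
    simp [spLift, map_ofNat] at h
    linear_combination h
  · rw [hal p hp]
    simp only [spLift, invLogDeriv, map_div₀]
    field_simp
  · obtain ⟨⟨hdr, hd, ha⟩, ⟨h01, h02, h03⟩, _⟩ := he.components hp
    have ha0 : e 0 p 0 ≠ 0 := fun h => by simp [h] at ha
    have c := he.connForm_one_two hf hΩ hp
    have c0 := c 0
    have c3 := c 3
    rw [pd_congr_on hM hvel hp, pd_lift hβ hΩ hp] at c0 c3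
    simp at c0 c3
    simp only [npMu, pairing, Fin.sum_univ_four, h01, h02, c0, c3, tetradScale]
    field_simp
    ring

/-! ## The invariants in terms of `Q` -/

namespace ReducesTo

variable {f : ℂ × ℝ → ℂ} {Ω : Set (ℂ × ℝ)} {e : Fin 4 → Spacetime → CVec} {Q : ℂ × ℝ → ℂ}
  {p : Spacetime} {x : ℂ × ℝ}

theorem isProfile_velocity (R : ReducesTo f Ω e Q) : IsProfile (levelVelocity Q) Ω :=
  R.profile.levelVelocity R.isOpen R.zDeriv_ne_zero

theorem isProfile_invLogDeriv (R : ReducesTo f Ω e Q) : IsProfile (invLogDeriv Q) Ω :=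
  R.profile.invLogDeriv R.isOpen R.zDeriv_ne_zero

theorem invLogDeriv_ne_zero (R : ReducesTo f Ω e Q) (hx : x ∈ Ω) : invLogDeriv Q x ≠ 0 :=
  div_ne_zero (R.ne_zero x hx) (R.zDeriv_ne_zero x hx)

/-- Equality of the mixed derivatives of Q, rewritten through wQ_ζ = Q and βQ_ζ = −Q_u. It is the
compatibility relation between w and β. -/
theorem uDeriv_invLogDeriv (R : ReducesTo f Ω e Q) (hx : x ∈ Ω) :
    uDeriv (invLogDeriv Q) x = zDeriv (levelVelocity Q) x * invLogDeriv Q x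
      - levelVelocity Q x * zDeriv (invLogDeriv Q) x := by
  have hΩ := R.isOpen
  have DQz := (R.profile.zDeriv hΩ).differentiableAt hΩ hx
  have Dw := R.isProfile_invLogDeriv.differentiableAt hΩ hx
  have Dβ := R.isProfile_velocity.differentiableAt hΩ hx
  have hw : (fun y => invLogDeriv Q y * zDeriv Q y) =ᶠ[𝓝 x] Q :=
    Filter.eventually_of_mem (hΩ.mem_nhds hx) fun y hy =>
      div_mul_cancel₀ _ (R.zDeriv_ne_zero y hy)
  have hβ : (fun y => levelVelocity Q y * zDeriv Q y) =ᶠ[𝓝 x] fun y => -uDeriv Q y :=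
    Filter.eventually_of_mem (hΩ.mem_nhds hx) fun y hy =>
      div_mul_cancel₀ _ (R.zDeriv_ne_zero y hy)
  have h1 := zDeriv_congr hw
  have h2 := uDeriv_congr hw
  have h3 := zDeriv_congr hβ
  have h4 := hβ.eq_of_nhds
  have h0 := R.zDeriv_ne_zero x hx
  rw [zDeriv_mul Dw DQz] at h1
  rw [uDeriv_mul Dw DQz] at h2
  rw [zDeriv_mul Dβ DQz, zDeriv_neg, R.profile.zDeriv_uDeriv hΩ hx] at h3
  refine mul_right_cancel₀ h0 ?_
  linear_combination h2 - invLogDeriv Q x * h3 + levelVelocity Q x * h1 + h4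

theorem D_ne_zero (R : ReducesTo f Ω e Q) (hp : p ∈ region Ω) : e 3 p 3 ≠ 0 :=
  (R.tetrad.components hp).1.2.1

theorem D_real (R : ReducesTo f Ω e Q) (hp : p ∈ region Ω) : conj (e 3 p 3) = e 3 p 3 :=
  (R.tetrad.components hp).1.1

theorem delta_unit (R : ReducesTo f Ω e Q) (hp : p ∈ region Ω) :
    e 0 p 0 * conj (e 0 p 0) = 1 :=
  (R.tetrad.components hp).1.2.2

theorem delta_ne_zero (R : ReducesTo f Ω e Q) (hp : p ∈ region Ω) : e 0 p 0 ≠ 0 := fun h => by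
  simpa [h] using R.delta_unit hp

theorem differentiableAt_component (R : ReducesTo f Ω e Q) (hp : p ∈ region Ω) (a j : Fin 4) :
    DifferentiableAt ℝ (fun q => e a q j) p := R.tetrad.differentiableAt_component R.isOpen hp a j

theorem coframe_zero (R : ReducesTo f Ω e Q) (hp : p ∈ region Ω) : coframe f e 0 p
    = ![conj (e 0 p 0), 0, -(conj (e 0 p 0) * spLift (levelVelocity Q) p), 0] := by
  obtain ⟨_, _, ⟨h10, h11, h12, h13⟩, _⟩ := R.tetrad.components hp
  rw [← R.velocity p hp]
  funext i
  fin_cases i <;> simp [coframe, Fin.sum_univ_four, nullEta, ppMetric, h10, h11, h12, h13,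
    mul_assoc]

theorem coframe_two (R : ReducesTo f Ω e Q) (hp : p ∈ region Ω) :
    coframe f e 2 p = ![0, 0, e 3 p 3, 0] := by
  obtain ⟨_, _, _, _, h30, h31, h32⟩ := R.tetrad.components hp
  funext i
  fin_cases i <;> simp [coframe, Fin.sum_univ_four, nullEta, ppMetric, h30, h31, h32]

theorem Delta_zero (R : ReducesTo f Ω e Q) (hp : p ∈ region Ω) :
    e 2 p 0 = spLift (levelVelocity Q) p / e 3 p 3 := by
  rw [← R.velocity p hp, mul_div_cancel_right₀ _ (R.D_ne_zero hp)]

theorem Delta_one (R : ReducesTo f Ω e Q) (hp : p ∈ region Ω) :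
    e 2 p 1 = conj (spLift (levelVelocity Q) p) / e 3 p 3 := by
  rw [(R.tetrad.components hp).2.2.2.1.1, R.Delta_zero hp, map_div₀, R.D_real hp]

theorem Delta_two (R : ReducesTo f Ω e Q) (hp : p ∈ region Ω) : e 2 p 2 = (e 3 p 3)⁻¹ :=
  (R.tetrad.components hp).2.2.2.1.2.1

theorem differentiableAt_spLift (R : ReducesTo f Ω e Q) (hp : p ∈ region Ω) :
    DifferentiableAt ℝ (spLift Q) p := _root_.differentiableAt_spLift R.profile R.isOpen hp

theorem spLift_eq (R : ReducesTo f Ω e Q) (hp : p ∈ region Ω) :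
    e 3 p 3 * conj (e 0 p 0) = spLift Q p := by
  have h := congrArg conj (R.scale p hp)
  rwa [map_mul, conj_conj, R.D_real hp] at h

/-- D^v is ±|Q| and the phase of δ is that of Q* up to the same sign. Working with the square avoids
fixing the sign: log D^v and log (δ^ζ)* have as derivatives half the sum and half the difference of
those of log Q and log Q*. -/
theorem D_mul_self (R : ReducesTo f Ω e Q) (hp : p ∈ region Ω) :
    e 3 p 3 * e 3 p 3 = spLift Q p * conj (spLift Q p) := by
  rw [← R.scale p hp, ← R.spLift_eq hp]
  linear_combination -e 3 p 3 * e 3 p 3 * R.delta_unit hp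

/-- The logarithmic coordinate derivatives of `Q`. -/
noncomputable def _root_.logPd (Q : ℂ × ℝ → ℂ) (p : Spacetime) (i : Fin 4) : ℂ :=
  ![(spLift (invLogDeriv Q) p)⁻¹, 0,
    -spLift (levelVelocity Q) p * (spLift (invLogDeriv Q) p)⁻¹, 0] i

/-- The logarithmic coordinate derivatives of the conjugate of `Q`. -/
noncomputable def _root_.logPdConj (Q : ℂ × ℝ → ℂ) (p : Spacetime) (i : Fin 4) : ℂ :=
  conj (logPd Q p (![1, 0, 2, 3] i))

theorem pd_spLift (R : ReducesTo f Ω e Q) (hp : p ∈ region Ω) (i : Fin 4) :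
    pd i (spLift Q) p = spLift Q p * logPd Q p i := by
  have h0 : spLift Q p ≠ 0 := R.ne_zero _ hp
  have h1 : spLift (zDeriv Q) p ≠ 0 := R.zDeriv_ne_zero _ hp
  have h2 : spLift (invLogDeriv Q) p = spLift Q p / spLift (zDeriv Q) p := rfl
  have h3 : spLift (levelVelocity Q) p = -spLift (uDeriv Q) p / spLift (zDeriv Q) p := rfl
  rw [pd_lift R.profile R.isOpen hp]
  fin_cases i <;> simp [logPd, h2, h3] <;> field_simp

theorem pd_conj_spLift (R : ReducesTo f Ω e Q) (hp : p ∈ region Ω) (i : Fin 4) :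
    pd i (fun q => conj (spLift Q q)) p = conj (spLift Q p) * logPdConj Q p i := by
  rw [pd_conj (R.differentiableAt_spLift hp), R.pd_spLift hp, map_mul, logPdConj]

theorem pd_D (R : ReducesTo f Ω e Q) (hp : p ∈ region Ω) (i : Fin 4) :
    pd i (fun q => e 3 q 3) p = e 3 p 3 * (logPd Q p i + logPdConj Q p i) / 2 := by
  have D := R.differentiableAt_component hp 3 3
  have h := pd_congr_on (isOpen_region R.isOpen) (fun q hq => R.D_mul_self hq) hp i
  rw [pd_mul D D, pd_mul (R.differentiableAt_spLift hp) (R.differentiableAt_spLift hp).conj_complex,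
    R.pd_spLift hp, R.pd_conj_spLift hp] at h
  refine mul_left_cancel₀ (R.D_ne_zero hp) ?_
  linear_combination h / 2 - (logPd Q p i + logPdConj Q p i) / 2 * R.D_mul_self hp

theorem pd_conj_delta (R : ReducesTo f Ω e Q) (hp : p ∈ region Ω) (i : Fin 4) :
    pd i (fun q => conj (e 0 q 0)) p
      = conj (e 0 p 0) * (logPd Q p i - logPdConj Q p i) / 2 := by
  have D := R.differentiableAt_component hp 3 3
  have Da := R.differentiableAt_component hp 0 0
  have h := pd_congr_on (isOpen_region R.isOpen) (fun q hq => R.spLift_eq hq) hp i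
  rw [pd_mul D Da.conj_complex, R.pd_D hp, R.pd_spLift hp, ← R.spLift_eq hp] at h
  refine mul_left_cancel₀ (R.D_ne_zero hp) ?_
  linear_combination h

theorem pd_conj_invLogDeriv_inv (R : ReducesTo f Ω e Q) (hp : p ∈ region Ω) (i : Fin 4) :
    pd i (fun q => conj ((spLift (invLogDeriv Q) q)⁻¹)) p
      = -conj (pd (![1, 0, 2, 3] i) (spLift (invLogDeriv Q)) p)
        * conj ((spLift (invLogDeriv Q) p)⁻¹) ^ 2 := by
  have Dw := _root_.differentiableAt_spLift R.isProfile_invLogDeriv R.isOpen hp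
  have h0 : spLift (invLogDeriv Q) p ≠ 0 := R.invLogDeriv_ne_zero hp
  rw [pd_conj (φ := fun q => (spLift (invLogDeriv Q) q)⁻¹) (Dw.inv h0), pd_inv Dw h0]
  simp [div_eq_mul_inv]

/-- The logarithmic coordinate derivatives of `α`. -/
noncomputable def _root_.logPdAlpha (Q : ℂ × ℝ → ℂ) (p : Spacetime) (i : Fin 4) : ℂ :=
  (logPd Q p i - logPdConj Q p i) / 2 - conj ((spLift (invLogDeriv Q) p)⁻¹)
    * conj (pd (![1, 0, 2, 3] i) (spLift (invLogDeriv Q)) p)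

theorem alpha_eq (R : ReducesTo f Ω e Q) (hp : p ∈ region Ω) :
    npAlpha f e p = 2⁻¹ * (conj (e 0 p 0) * conj ((spLift (invLogDeriv Q) p)⁻¹)) := by
  rw [R.alpha p hp]
  simp [div_eq_mul_inv]
  ring

theorem differentiableAt_alpha_factors (R : ReducesTo f Ω e Q) (hp : p ∈ region Ω) :
    DifferentiableAt ℝ (fun q => conj ((spLift (invLogDeriv Q) q)⁻¹)) p :=
  DifferentiableAt.conj_complex ((_root_.differentiableAt_spLift R.isProfile_invLogDeriv
    R.isOpen hp).inv (R.invLogDeriv_ne_zero hp))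

theorem pd_alpha (R : ReducesTo f Ω e Q) (hp : p ∈ region Ω) (i : Fin 4) :
    pd i (npAlpha f e) p = npAlpha f e p * logPdAlpha Q p i := by
  have Da := (R.differentiableAt_component hp 0 0).conj_complex
  have Dw := R.differentiableAt_alpha_factors hp
  rw [pd_congr_on (isOpen_region R.isOpen) (fun q hq => R.alpha_eq hq) hp i,
    pd_const_mul _ (Da.fun_mul Dw), pd_mul Da Dw, R.pd_conj_delta hp,
    R.pd_conj_invLogDeriv_inv hp, R.alpha_eq hp, logPdAlpha]
  ring

theorem differentiableAt_alpha (R : ReducesTo f Ω e Q) (hp : p ∈ region Ω) :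
    DifferentiableAt ℝ (npAlpha f e) p := by
  have Da := (R.differentiableAt_component hp 0 0).conj_complex
  have Dw := R.differentiableAt_alpha_factors hp
  refine ((Da.fun_mul Dw).const_mul 2⁻¹).congr_of_eventuallyEq ?_
  exact Filter.eventually_of_mem ((isOpen_region R.isOpen).mem_nhds hp) fun q hq => R.alpha_eq hq

/-- Since α = (a/w)*/2, δ* log α has one term from the phase a, giving −1, and one from w*, giving
−2(w_ζ)*. The conjugate is recorded because A*, unlike A, is holomorphic in ζ. -/
theorem conj_invA (R : ReducesTo f Ω e Q) (hp : p ∈ region Ω) :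
    conj (invA f e p) = -1 - 2 * spLift (zDeriv (invLogDeriv Q)) p := by
  have h1 := R.delta_ne_zero hp
  have h2 : spLift (invLogDeriv Q) p ≠ 0 := R.invLogDeriv_ne_zero hp
  have h1' : conj (e 0 p 0) ≠ 0 := by simpa using h1
  have h2' : conj (spLift (invLogDeriv Q) p) ≠ 0 := by simpa using h2
  obtain ⟨_, _, ⟨h10, h11, h12, h13⟩, _⟩ := R.tetrad.components hp
  have key : invA f e p = conj (-1 - 2 * spLift (zDeriv (invLogDeriv Q)) p) := by
    simp only [invA, vecDeriv, Fin.sum_univ_four, R.pd_alpha hp, h10, h11, h12, logPdAlpha,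
      logPdConj, logPd, pd_lift R.isProfile_invLogDeriv R.isOpen hp, R.alpha_eq hp]
    simp [map_ofNat]
    field_simp
  rw [key, conj_conj]

theorem invA_eq (R : ReducesTo f Ω e Q) (hp : p ∈ region Ω) :
    invA f e p = -1 - 2 * conj (spLift (zDeriv (invLogDeriv Q)) p) := by
  have h := congrArg conj (R.conj_invA hp)
  simpa [map_ofNat] using h

theorem invB_mul_D (R : ReducesTo f Ω e Q) (hp : p ∈ region Ω) :
    invB f e p * e 3 p 3 = spLift (zDeriv (levelVelocity Q)) p * invA f e p
      - conj (spLift (zDeriv (levelVelocity Q)) p) := by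
  have hd := R.D_ne_zero hp
  rw [invB, R.mu p hp, map_div₀, R.D_real hp]
  field_simp

/-- If `A A* = 1` and `B = 0` at a point, then `dα ∧ dα* = 0` there. -/
theorem invB_ne_zero_of_isTypeZeroTwo (R : ReducesTo f Ω e Q) (hp : p ∈ region Ω)
    (h : IsTypeZeroTwo f (region Ω) e) (hA : invA f e p * conj (invA f e p) = 1) :
    invB f e p ≠ 0 := by
  intro hB
  have hw0' : conj (spLift (invLogDeriv Q) p) ≠ 0 := by
    have h0 : spLift (invLogDeriv Q) p ≠ 0 := R.invLogDeriv_ne_zero hp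
    simpa using h0
  have hw0 : spLift (invLogDeriv Q) p ≠ 0 := R.invLogDeriv_ne_zero hp
  have hb := R.invB_mul_D hp
  rw [hB, zero_mul] at hb
  have hW := R.conj_invA hp
  have hW' := R.invA_eq hp
  have hu : spLift (uDeriv (invLogDeriv Q)) p
      = spLift (zDeriv (levelVelocity Q)) p * spLift (invLogDeriv Q) p
      - spLift (levelVelocity Q) p * spLift (zDeriv (invLogDeriv Q)) p :=
    R.uDeriv_invLogDeriv hp
  -- As 1-forms, (d log α)* = A* d log α, so dα* is a multiple of dα. Substituting B = 0 means
  -- (β_ζ)* = β_ζ A.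
  have key : ∀ i, conj (logPdAlpha Q p (![1, 0, 2, 3] i))
      = conj (invA f e p) * logPdAlpha Q p i := by
    intro i
    have e1 : conj (spLift (zDeriv (invLogDeriv Q)) p) = (-1 - invA f e p) / 2 := by
      linear_combination hW' / 2
    have e2 : spLift (zDeriv (invLogDeriv Q)) p = (-1 - conj (invA f e p)) / 2 := by
      linear_combination hW / 2
    have e3 : conj (spLift (zDeriv (levelVelocity Q)) p)
        = spLift (zDeriv (levelVelocity Q)) p * invA f e p := by linear_combination hb
    fin_cases i
    · simp [logPdAlpha, logPdConj, logPd, pd_lift R.isProfile_invLogDeriv R.isOpen hp, map_ofNat,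
        e2, hu]
      ring
    · simp [logPdAlpha, logPdConj, logPd, pd_lift R.isProfile_invLogDeriv R.isOpen hp, map_ofNat,
        e2, hu]
      linear_combination -(conj (spLift (invLogDeriv Q) p))⁻¹ / 2 * hA
    · simp [logPdAlpha, logPdConj, logPd, pd_lift R.isProfile_invLogDeriv R.isOpen hp, map_ofNat,
        e2, hu, e3]
      field_simp
      linear_combination conj (spLift (levelVelocity Q) p) * spLift (invLogDeriv Q) p * hA
    · simp [logPdAlpha, logPdConj, logPd, pd_lift R.isProfile_invLogDeriv R.isOpen hp]
  obtain ⟨i, j, hij⟩ := h p hp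
  refine hij ?_
  rw [pd_conj (R.differentiableAt_alpha hp), pd_conj (R.differentiableAt_alpha hp),
    R.pd_alpha hp, R.pd_alpha hp, R.pd_alpha hp, R.pd_alpha hp, map_mul, map_mul, key, key]
  ring

end ReducesTo

/-! ## Vector fields preserving `ω¹` and `ω³` -/

/-- The equation on `Q` that characterizes vector fields with `u`-component `U = P₁ u + m` and
`ζ`-component `β U - P w` that preserve `ω¹` and `ω³`. -/
def PrecursorEq (Q : ℂ × ℝ → ℂ) (P : ℂ) (m : ℝ) (x : ℂ × ℝ) : Prop :=
  zDeriv (levelVelocity Q) x * (P.re * x.2 + m) - zDeriv (invLogDeriv Q) x * P = I * P.im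

namespace ReducesTo

variable {f : ℂ × ℝ → ℂ} {Ω : Set (ℂ × ℝ)} {e : Fin 4 → Spacetime → CVec} {Q : ℂ × ℝ → ℂ}
  {p : Spacetime} {x : ℂ × ℝ} {V : Spacetime → CVec}

theorem frameComp_zero (R : ReducesTo f Ω e Q) (hp : p ∈ region Ω) : frameComp f e V 0 p
    = conj (e 0 p 0) * (V p 0 - spLift (levelVelocity Q) p * V p 2) := by
  simp [frameComp, pairing, R.coframe_zero hp, Fin.sum_univ_four]
  ring

theorem frameComp_two (R : ReducesTo f Ω e Q) (hp : p ∈ region Ω) :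
    frameComp f e V 2 p = e 3 p 3 * V p 2 := by
  simp [frameComp, pairing, R.coframe_two hp, Fin.sum_univ_four]

theorem lieDerivForm_coframe_two (R : ReducesTo f Ω e Q) (hp : p ∈ region Ω) (i : Fin 4) :
    lieDerivForm V (coframe f e 2) p i = (if i = 2 then ∑ j, V p j * pd j (fun q => e 3 q 3) p
      else 0) + e 3 p 3 * pd i (fun q => V q 2) p := by
  have h : ∀ j, pd j (fun q => coframe f e 2 q i) p
      = if i = 2 then pd j (fun q => e 3 q 3) p else 0 := by
    intro j
    rw [pd_congr_on (isOpen_region R.isOpen) (fun q hq => congrFun (R.coframe_two hq) i) hp j]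
    fin_cases i <;> simp
  simp only [lieDerivForm, h, R.coframe_two hp, Fin.sum_univ_four]
  by_cases hi : i = 2
  · simp [hi]; ring
  · simp [hi]

/-- Leibniz rule for ω¹ = a*(dζ − β du), with the nonvanishing a* factored out, so that 𝓛_V ω¹ = 0
becomes the vanishing of the bracket. -/
theorem lieDerivForm_coframe_zero (R : ReducesTo f Ω e Q) (hp : p ∈ region Ω) (i : Fin 4) :
    lieDerivForm V (coframe f e 0) p i = conj (e 0 p 0) *
      ((if i = 0 then ∑ j, V p j * (logPd Q p j - logPdConj Q p j) / 2 else 0)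
        - (if i = 2 then ∑ j, V p j * (spLift (levelVelocity Q) p
          * (logPd Q p j - logPdConj Q p j) / 2 + pd j (spLift (levelVelocity Q)) p) else 0)
        + pd i (fun q => V q 0) p - spLift (levelVelocity Q) p * pd i (fun q => V q 2) p) := by
  have Da := (R.differentiableAt_component hp 0 0).conj_complex
  have Dβ := _root_.differentiableAt_spLift R.isProfile_velocity R.isOpen hp
  have h : ∀ j, pd j (fun q => coframe f e 0 q i) p
      = conj (e 0 p 0) * ((if i = 0 then (logPd Q p j - logPdConj Q p j) / 2 else 0)
        - if i = 2 then spLift (levelVelocity Q) p * (logPd Q p j - logPdConj Q p j) / 2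
          + pd j (spLift (levelVelocity Q)) p else 0) := by
    intro j
    rw [pd_congr_on (isOpen_region R.isOpen) (fun q hq => congrFun (R.coframe_zero hq) i) hp j]
    fin_cases i
    · simp [R.pd_conj_delta hp]; ring
    · simp
    · simp only [Fin.reduceFinMk, Matrix.cons_val]
      rw [pd_neg, pd_mul Da Dβ, R.pd_conj_delta hp]
      simp
      ring
    · simp
  simp only [lieDerivForm, h, R.coframe_zero hp, Fin.sum_univ_four]
  by_cases h0 : i = 0
  · simp [h0]; ring
  · by_cases h2 : i = 2
    · simp [h2]; ring
    · simp [h0, h2]; ring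

/-- A real vector field preserves `ω¹` and `ω³` as soon as it satisfies these equations. -/
theorem preservesForms_of_precursorEq (R : ReducesTo f Ω e Q) {P : ℂ} {m : ℝ}
    (h : ∀ x ∈ Ω, PrecursorEq Q P m x) :
    ∃ V, PreservesForms f (region Ω) e V ∧ ∀ p ∈ region Ω,
      frameComp f e V 0 p = -conj (e 0 p 0) * P * spLift (invLogDeriv Q) p ∧
      frameComp f e V 2 p = e 3 p 3 * (P.re * p.2.1 + m) := by
  have hΩ := R.isOpen
  have pβ := R.isProfile_velocity
  have pw := R.isProfile_invLogDeriv
  obtain ⟨U, hU⟩ : ∃ U : ℂ × ℝ → ℂ, U = fun x => (P.re : ℂ) * x.2 + m := ⟨_, rfl⟩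
  have pU0 : IsProfile (fun x : ℂ × ℝ => (x.2 : ℂ)) Ω :=
    IsProfile.comp_snd (s := Set.univ) (g := fun t => (t : ℂ)) ofRealCLM.contDiff.contDiffOn
      fun _ _ => trivial
  have pU : IsProfile U Ω := hU ▸ ((IsProfile.const _).mul pU0).add (IsProfile.const _)
  have hUz : ∀ x ∈ Ω, zDeriv U x = 0 := fun x hx => pU.zDeriv_eq_zero_of_real hΩ
    (fun y _ => by simp [hU]) hx
  have hUu : ∀ x ∈ Ω, uDeriv U x = P.re := fun x hx => by
    have h1 := hasDerivAt_uDeriv (pU.differentiableAt hΩ hx)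
    have h2 : HasDerivAt (fun t : ℝ => U (x.1, t)) ((P.re : ℂ) * 1) x.2 := by
      rw [hU]
      exact ((ofRealCLM.hasDerivAt (x := x.2)).const_mul (P.re : ℂ)).add_const _
    rw [h1.unique h2, mul_one]
  obtain ⟨Z, hZ⟩ : ∃ Z : ℂ × ℝ → ℂ,
    Z = fun x => levelVelocity Q x * U x - P * invLogDeriv Q x := ⟨_, rfl⟩
  have pPw := (IsProfile.const P).mul pw
  have pZ : IsProfile Z Ω := hZ ▸ (pβ.mul pU).sub pPw
  have DU := fun x (hx : x ∈ Ω) => pU.differentiableAt hΩ hx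
  have Dβ := fun x (hx : x ∈ Ω) => pβ.differentiableAt hΩ hx
  have Dw := fun x (hx : x ∈ Ω) => pw.differentiableAt hΩ hx
  have hZz : ∀ x ∈ Ω, zDeriv Z x = I * P.im := fun x hx => by
    rw [hZ, zDeriv_sub ((Dβ x hx).fun_mul (DU x hx)) ((Dw x hx).const_mul P),
      zDeriv_mul (Dβ x hx) (DU x hx), zDeriv_const_mul _ (Dw x hx), hUz x hx, ← h x hx, hU]
    ring
  have hZu : ∀ x ∈ Ω, uDeriv Z x = uDeriv (levelVelocity Q) x * U x + levelVelocity Q x * P.re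
      - P * uDeriv (invLogDeriv Q) x := fun x hx => by
    rw [hZ, uDeriv_sub ((Dβ x hx).fun_mul (DU x hx)) ((Dw x hx).const_mul P),
      uDeriv_mul (Dβ x hx) (DU x hx), uDeriv_const_mul _ (Dw x hx), hUu x hx]
  -- The v-component may be zero: neither form contains dv or depends on v.
  obtain ⟨V, hV⟩ : ∃ V : Spacetime → CVec,
    V = fun p => ![spLift Z p, conj (spLift Z p), spLift U p, 0] := ⟨_, rfl⟩
  have V0 : (fun q => V q 0) = spLift Z := by rw [hV]; rfl
  have V2 : (fun q => V q 2) = spLift U := by rw [hV]; rfl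
  have Vp : ∀ q, V q = ![spLift Z q, conj (spLift Z q), spLift U q, 0] := fun q => by rw [hV]
  have sZ := contDiffOn_lift pZ.1
  -- V log Q = −P: the direction (β, 1) in (ζ, u) is tangent to the level curves of Q, so only −Pw
  -- contributes. The two sums are V log Q ± V log Q*.
  have sum_D : ∀ p ∈ region Ω, ∑ j, V p j * (logPd Q p j + logPdConj Q p j) = -2 * P.re ∧
      ∑ j, V p j * (logPd Q p j - logPdConj Q p j) = -2 * I * P.im := by
    intro p hp
    have w0 : spLift (invLogDeriv Q) p ≠ 0 := R.invLogDeriv_ne_zero hp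
    have w0' : conj (spLift (invLogDeriv Q) p) ≠ 0 := by simpa using w0
    have hZp : spLift Z p = spLift (levelVelocity Q) p * spLift U p
      - P * spLift (invLogDeriv Q) p := by rw [hZ]; rfl
    have hUr : conj (spLift U p) = spLift U p := by simp [hU, spLift]
    have e1 : spLift Z p * (spLift (invLogDeriv Q) p)⁻¹
        + spLift U p * (-spLift (levelVelocity Q) p * (spLift (invLogDeriv Q) p)⁻¹) = -P := by
      rw [hZp]; field_simp; ring
    have e2 : conj (spLift Z p) * conj ((spLift (invLogDeriv Q) p)⁻¹)
        + spLift U p * conj (-spLift (levelVelocity Q) p * (spLift (invLogDeriv Q) p)⁻¹)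
          = -conj P := by
      have := congrArg conj e1
      rw [map_add, map_mul, map_mul, map_neg, hUr] at this
      exact this
    have c1 := add_conj P
    have c2 := sub_conj P
    push_cast at c1 c2
    constructor
    · simp only [Fin.sum_univ_four, Vp, logPd, logPdConj, Matrix.cons_val, map_zero]
      linear_combination e1 + e2 - c1
    · simp only [Fin.sum_univ_four, Vp, logPd, logPdConj, Matrix.cons_val, map_zero]
      linear_combination e1 - e2 - c2
  refine ⟨V, ⟨?_, ?_, ?_, ?_⟩, ?_⟩
  · rw [contDiffOn_pi]
    intro i
    rw [hV]
    fin_cases i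
    · exact sZ
    · exact sZ.conj_complex
    · exact contDiffOn_lift pU.1
    · exact contDiffOn_const
  · intro p _
    rw [Vp]
    funext i
    fin_cases i <;> simp [conjVec, spLift, hU]
  · intro p hp
    funext i
    have hs := (sum_D p hp).2
    have hx : (p.1, p.2.1) ∈ Ω := hp
    have hu := R.uDeriv_invLogDeriv hx
    have hq := h _ hx
    rw [R.lieDerivForm_coframe_zero hp, V0, V2, pd_lift pZ hΩ hp, pd_lift pU hΩ hp]
    fin_cases i
    · have : ∑ j, V p j * (logPd Q p j - logPdConj Q p j) / 2 = -I * P.im := by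
        rw [← Finset.sum_div, hs]; ring
      simp [this, spLift, hZz _ hx, hUz _ hx]
    · simp
    · have : ∑ j, V p j * (spLift (levelVelocity Q) p * (logPd Q p j - logPdConj Q p j) / 2
          + pd j (spLift (levelVelocity Q)) p) = spLift (levelVelocity Q) p / 2
          * (∑ j, V p j * (logPd Q p j - logPdConj Q p j))
          + ∑ j, V p j * pd j (spLift (levelVelocity Q)) p := by
        simp only [Fin.sum_univ_four]; ring
      simp only [this, hs]
      simp only [Fin.sum_univ_four, pd_lift pβ hΩ hp, Vp]
      simp [spLift, hZu _ hx, hUu _ hx]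
      right
      rw [hZ, hu]
      simp only [hU]
      unfold PrecursorEq at hq
      linear_combination -levelVelocity Q (p.1, p.2.1) * hq
    · simp
  · intro p hp
    funext i
    have hs := (sum_D p hp).1
    have hx : (p.1, p.2.1) ∈ Ω := hp
    rw [R.lieDerivForm_coframe_two hp, V2, pd_lift pU hΩ hp]
    have : ∑ j, V p j * pd j (fun q => e 3 q 3) p = e 3 p 3 / 2
        * ∑ j, V p j * (logPd Q p j + logPdConj Q p j) := by
      simp only [Fin.sum_univ_four, R.pd_D hp]; ring
    rw [this, hs]
    fin_cases i
    · simp [spLift, hUz _ hx]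
    · simp
    · simp [spLift, hUu _ hx]; ring
    · simp
  · intro p hp
    rw [R.frameComp_zero hp, R.frameComp_two hp, Vp]
    constructor
    · simp [spLift, hZ]; ring
    · simp [spLift, hU]

/-- Put U = V^u and Z = V^ζ. The dv and dζ* components of the two equations say that U depends on u
only and that Z is holomorphic in ζ and free of v. The others fix the scaling: V log d = −U_u is
real and V log a* = −Z_ζ is imaginary, so V log Q = −(U_u + Z_ζ). -/
theorem precursorEq_of_preservesForms (R : ReducesTo f Ω e Q) (hΩc : IsConnected Ω)
    (hV : PreservesForms f (region Ω) e V) :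
    ∃ (P : ℂ) (m : ℝ), (∀ x ∈ Ω, PrecursorEq Q P m x) ∧ ∀ p ∈ region Ω,
      frameComp f e V 0 p = -conj (e 0 p 0) * P * spLift (invLogDeriv Q) p ∧
      frameComp f e V 2 p = e 3 p 3 * (P.re * p.2.1 + m) := by
  have hΩ := R.isOpen
  have hM := isOpen_region hΩ
  have hMc := isPreconnected_region hΩc
  have pβ := R.isProfile_velocity
  have pw := R.isProfile_invLogDeriv
  have SV : ∀ j, ContDiffOn ℝ ∞ (fun q => V q j) (region Ω) := contDiffOn_pi.1 hV.smooth
  have DV := fun p (hp : p ∈ region Ω) j => (SV j).differentiableAt_of_isOpen hM hp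
  have DVd := fun p (hp : p ∈ region Ω) j k => ((SV j).pd hM k).differentiableAt_of_isOpen hM hp
  have Dβ := fun p (hp : p ∈ region Ω) => _root_.differentiableAt_spLift pβ hΩ hp
  have Dw := fun p (hp : p ∈ region Ω) => _root_.differentiableAt_spLift pw hΩ hp
  have vr : ∀ p ∈ region Ω, V p 1 = conj (V p 0) ∧ conj (V p 2) = V p 2 := by
    intro p hp
    have h := hV.real p hp
    have h1 := congrFun h 1
    have h2 := congrFun h 2
    simp [conjVec] at h1 h2
    exact ⟨h1.symm, h2⟩
  have l2 : ∀ p ∈ region Ω, ∀ i, (if i = 2 then ∑ j, V p j * pd j (fun q => e 3 q 3) p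
      else 0) + e 3 p 3 * pd i (fun q => V q 2) p = 0 := fun p hp i => by
    rw [← R.lieDerivForm_coframe_two hp, hV.lie_three p hp]; rfl
  have l0 : ∀ p ∈ region Ω, ∀ i,
      ((if i = 0 then ∑ j, V p j * (logPd Q p j - logPdConj Q p j) / 2 else 0)
        - (if i = 2 then ∑ j, V p j * (spLift (levelVelocity Q) p
          * (logPd Q p j - logPdConj Q p j) / 2 + pd j (spLift (levelVelocity Q)) p) else 0)
        + pd i (fun q => V q 0) p - spLift (levelVelocity Q) p * pd i (fun q => V q 2) p) = 0 := by
    intro p hp i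
    have h : lieDerivForm V (coframe f e 0) p i = 0 := by rw [hV.lie_one p hp]; rfl
    rw [R.lieDerivForm_coframe_zero hp] at h
    exact (mul_eq_zero.1 h).resolve_left (by simpa using R.delta_ne_zero hp)
  have U0 : ∀ p ∈ region Ω, ∀ i, i ≠ 2 → pd i (fun q => V q 2) p = 0 := by
    intro p hp i hi
    have h := l2 p hp i
    simp only [hi, if_false, zero_add] at h
    exact (mul_eq_zero.1 h).resolve_left (R.D_ne_zero hp)
  have Z0 : ∀ p ∈ region Ω, ∀ i, i = 1 ∨ i = 3 → pd i (fun q => V q 0) p = 0 := by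
    intro p hp i hi
    have h := l0 p hp i
    rcases hi with rfl | rfl
    · simpa [U0 p hp 1] using h
    · simpa [U0 p hp 3] using h
  have eD : ∀ p ∈ region Ω, ∑ j, V p j * (logPd Q p j + logPdConj Q p j)
      = -2 * pd 2 (fun q => V q 2) p := by
    intro p hp
    have h := l2 p hp 2
    simp only [if_true] at h
    have : ∑ j, V p j * pd j (fun q => e 3 q 3) p = e 3 p 3 / 2
        * ∑ j, V p j * (logPd Q p j + logPdConj Q p j) := by
      simp only [Fin.sum_univ_four, R.pd_D hp]; ring
    rw [this] at h
    refine mul_left_cancel₀ (R.D_ne_zero hp) ?_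
    linear_combination 2 * h
  have eA : ∀ p ∈ region Ω, ∑ j, V p j * (logPd Q p j - logPdConj Q p j)
      = -2 * pd 0 (fun q => V q 0) p := by
    intro p hp
    have h := l0 p hp 0
    simp [U0 p hp 0] at h
    rw [← Finset.sum_div] at h
    linear_combination 2 * h
  -- U_u will be the real part and Z_ζ the imaginary part of P.
  obtain ⟨P, hP⟩ : ∃ P : Spacetime → ℂ,
    P = fun q => pd 2 (fun q => V q 2) q + pd 0 (fun q => V q 0) q := ⟨_, rfl⟩
  have SP : ContDiffOn ℝ ∞ P (region Ω) := hP ▸ ((SV 2).pd hM 2).add ((SV 0).pd hM 0)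
  have DP := fun p (hp : p ∈ region Ω) => SP.differentiableAt_of_isOpen hM hp
  have eZ : ∀ p ∈ region Ω, V p 0 = spLift (levelVelocity Q) p * V p 2
      - P p * spLift (invLogDeriv Q) p := by
    intro p hp
    have w0 : spLift (invLogDeriv Q) p ≠ 0 := R.invLogDeriv_ne_zero hp
    have h1 := eD p hp
    have h2 := eA p hp
    have h3 : ∑ j, V p j * logPd Q p j = -P p := by
      rw [hP]
      simp only [Fin.sum_univ_four] at h1 h2 ⊢
      linear_combination (h1 + h2) / 2
    simp only [Fin.sum_univ_four, logPd, Matrix.cons_val] at h3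
    field_simp at h3
    linear_combination h3
  -- Z_ζ = −V log a*, with |a| = 1 and V real.
  have Zim : ∀ p ∈ region Ω, conj (pd 0 (fun q => V q 0) p) = -pd 0 (fun q => V q 0) p := by
    intro p hp
    have h := eA p hp
    have h' := congrArg conj h
    simp only [Fin.sum_univ_four, (vr p hp).1, logPd, logPdConj, Matrix.cons_val, map_zero,
      map_add, map_mul, map_sub, map_neg, conj_conj, (vr p hp).2, map_ofNat] at h h'
    linear_combination h / 2 + h' / 2
  have Ure : ∀ p ∈ region Ω, conj (pd 2 (fun q => V q 2) p) = pd 2 (fun q => V q 2) p := by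
    intro p hp
    have h := pd_congr_on hM (fun q hq => (vr q hq).2) hp 2
    rw [pd_conj (DV p hp 2)] at h
    exact h
  have dU : ∀ p ∈ region Ω, ∀ i, i ≠ 2 → pd i (pd 2 (fun q => V q 2)) p = 0 := by
    intro p hp i hi
    rw [pd_comm (SV 2) hM hp, pd_congr_on hM (ψ := fun _ => 0) (fun q hq => U0 q hq i hi) hp,
      pd_const]
  have dZ : ∀ p ∈ region Ω, ∀ i, i ≠ 2 → pd i (pd 0 (fun q => V q 0)) p = 0 := by
    intro p hp i hi
    have h13 : ∀ i, i = 1 ∨ i = 3 → pd i (pd 0 (fun q => V q 0)) p = 0 := by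
      intro i hi
      rw [pd_comm (SV 0) hM hp, pd_congr_on hM (ψ := fun _ => 0) (fun q hq => Z0 q hq i hi) hp,
        pd_const]
    -- Z_ζ is holomorphic in ζ and imaginary; conjugating the ζ*-derivative kills its ζ-derivative
    -- as well.
    have h := pd_congr_on hM (fun q hq => Zim q hq) hp 1
    rw [pd_conj (DVd p hp 0 0), pd_neg, h13 1 (Or.inl rfl)] at h
    fin_cases i
    · simpa using h
    · exact h13 1 (Or.inl rfl)
    · exact absurd rfl hi
    · exact h13 3 (Or.inr rfl)
  have dP : ∀ p ∈ region Ω, ∀ i, i ≠ 2 → pd i P p = 0 := by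
    intro p hp i hi
    rw [hP, pd_add (DVd p hp 2 2) (DVd p hp 0 0), dU p hp i hi, dZ p hp i hi, add_zero]
  have eZd : ∀ p ∈ region Ω, ∀ i, pd i (fun q => V q 0) p
      = pd i (spLift (levelVelocity Q)) p * V p 2
        + spLift (levelVelocity Q) p * pd i (fun q => V q 2) p
        - (pd i P p * spLift (invLogDeriv Q) p + P p * pd i (spLift (invLogDeriv Q)) p) := by
    intro p hp i
    rw [pd_congr_on hM eZ hp, pd_sub ((Dβ p hp).fun_mul (DV p hp 2)) ((DP p hp).fun_mul (Dw p hp)),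
      pd_mul (Dβ p hp) (DV p hp 2), pd_mul (DP p hp) (Dw p hp)]
  have eZ0 : ∀ p ∈ region Ω, pd 0 (fun q => V q 0) p
      = spLift (zDeriv (levelVelocity Q)) p * V p 2
        - P p * spLift (zDeriv (invLogDeriv Q)) p := by
    intro p hp
    rw [eZd p hp, dP p hp 0 (by decide), U0 p hp 0 (by decide), pd_lift pβ hΩ hp,
      pd_lift pw hΩ hp]
    simp
  -- Comparing the du component of 𝓛_V ω¹ = 0 with the u-derivative of Z = βU − Pw, and inserting
  -- w_u = β_ζ w − βw_ζ, everything cancels except wP_u.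
  have dP2 : ∀ p ∈ region Ω, pd 2 P p = 0 := by
    intro p hp
    have w0 : spLift (invLogDeriv Q) p ≠ 0 := R.invLogDeriv_ne_zero hp
    have hu : spLift (uDeriv (invLogDeriv Q)) p
      = spLift (zDeriv (levelVelocity Q)) p * spLift (invLogDeriv Q) p
      - spLift (levelVelocity Q) p * spLift (zDeriv (invLogDeriv Q)) p := R.uDeriv_invLogDeriv hp
    have h := l0 p hp 2
    have ha := eA p hp
    have h3 := eZd p hp 2
    have h5 := eZ0 p hp
    have : ∑ j, V p j * (spLift (levelVelocity Q) p * (logPd Q p j - logPdConj Q p j) / 2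
        + pd j (spLift (levelVelocity Q)) p) = spLift (levelVelocity Q) p / 2
        * (∑ j, V p j * (logPd Q p j - logPdConj Q p j))
        + ∑ j, V p j * pd j (spLift (levelVelocity Q)) p := by
      simp only [Fin.sum_univ_four]; ring
    rw [this, ha] at h
    simp only [Fin.sum_univ_four, pd_lift pβ hΩ hp, pd_lift pw hΩ hp, hu, eZ p hp] at h h3
    simp at h h3
    refine mul_left_cancel₀ w0 ?_
    linear_combination -h + h3 + spLift (levelVelocity Q) p * h5
  obtain ⟨P₀, hP₀⟩ := exists_eq_const_of_pd_eq_zero hM hMc SP fun p hp i => by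
    by_cases hi : i = 2
    · rw [hi]; exact dP2 p hp
    · exact dP p hp i hi
  have hre : ∀ p ∈ region Ω, pd 2 (fun q => V q 2) p = P₀.re := by
    intro p hp
    have h := hP₀ p hp
    have h' := congrArg conj h
    rw [hP] at h h'
    simp only [map_add, Ure p hp, Zim p hp] at h h'
    have c := add_conj P₀
    push_cast at c
    linear_combination (h + h') / 2 + c / 2
  have him : ∀ p ∈ region Ω, pd 0 (fun q => V q 0) p = I * P₀.im := by
    intro p hp
    have h := hP₀ p hp
    rw [hP] at h
    simp only [hre p hp] at h
    have c := re_add_im P₀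
    linear_combination h - c
  have pu : IsProfile (fun x : ℂ × ℝ => (P₀.re : ℂ) * x.2) Ω :=
    (IsProfile.const _).mul (IsProfile.comp_snd (s := Set.univ) (g := fun t => (t : ℂ))
      ofRealCLM.contDiff.contDiffOn fun _ _ => trivial)
  have hpu : ∀ x ∈ Ω, zDeriv (fun x : ℂ × ℝ => (P₀.re : ℂ) * x.2) x = 0 ∧
      uDeriv (fun x : ℂ × ℝ => (P₀.re : ℂ) * x.2) x = P₀.re := fun x hx => by
    refine ⟨pu.zDeriv_eq_zero_of_real hΩ (fun y _ => by simp) hx, ?_⟩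
    have h1 := hasDerivAt_uDeriv (pu.differentiableAt hΩ hx)
    have h2 : HasDerivAt (fun t : ℝ => (P₀.re : ℂ) * t) ((P₀.re : ℂ) * 1) x.2 :=
      (ofRealCLM.hasDerivAt (x := x.2)).const_mul (P₀.re : ℂ)
    rw [h1.unique h2, mul_one]
  obtain ⟨c, hc⟩ := exists_eq_const_of_pd_eq_zero
    (φ := fun q => V q 2 - spLift (fun x : ℂ × ℝ => (P₀.re : ℂ) * x.2) q) hM hMc
    ((SV 2).sub (contDiffOn_lift pu.1)) fun p hp i => by
      rw [pd_sub (DV p hp 2) (_root_.differentiableAt_spLift pu hΩ hp), pd_lift pu hΩ hp]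
      have h1 := (hpu _ hp).1
      have h2 := (hpu _ hp).2
      by_cases hi : i = 2
      · rw [hi, hre p hp]; simp [spLift, h2]
      · rw [U0 p hp i hi]
        fin_cases i
        · simp [spLift, h1]
        · simp
        · exact absurd rfl hi
        · simp
  have hUr : ∀ p ∈ region Ω, V p 2 = (P₀.re : ℂ) * p.2.1 + c.re := by
    intro p hp
    have h : V p 2 - (P₀.re : ℂ) * p.2.1 = c := hc p hp
    have h' := congrArg conj h
    simp only [map_sub, map_mul, (vr p hp).2, conj_ofReal] at h'
    have hcc := add_conj c
    push_cast at hcc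
    linear_combination (h + h') / 2 + hcc / 2
  refine ⟨P₀, c.re, fun x hx => ?_, fun p hp => ⟨?_, ?_⟩⟩
  · have hx' : ((x.1, x.2, 0) : Spacetime) ∈ region Ω := hx
    have h := eZ0 _ hx'
    rw [him _ hx', hUr _ hx', hP₀ _ hx'] at h
    simp only [spLift] at h
    unfold PrecursorEq
    linear_combination -h
  · rw [R.frameComp_zero hp, eZ p hp, hP₀ p hp]; ring
  · rw [R.frameComp_two hp, hUr p hp]

end ReducesTo

/-! ## The invariant conditions for precursors -/

theorem IsProfile.exists_eq_const {φ : ℂ × ℝ → ℂ} {Ω : Set (ℂ × ℝ)} (h : IsProfile φ Ω)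
    (hΩ : IsOpen Ω) (hΩc : IsConnected Ω) (hz : ∀ x ∈ Ω, _root_.zDeriv φ x = 0)
    (hu : ∀ x ∈ Ω, _root_.uDeriv φ x = 0) : ∃ c, ∀ x ∈ Ω, φ x = c := by
  obtain ⟨c, hc⟩ := exists_eq_const_of_pd_eq_zero (isOpen_region hΩ) (isPreconnected_region hΩc)
    (contDiffOn_lift h.1) fun p hp i => by
      rw [pd_lift h hΩ hp]
      fin_cases i <;> simp [spLift, hz _ hp, hu _ hp]
  exact ⟨c, fun x hx => hc (x.1, x.2, 0) hx⟩

theorem eq_zero_of_affine_eq_zero {Ω : Set (ℂ × ℝ)} (hΩ : IsOpen Ω) (hne : Ω.Nonempty)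
    {r m : ℝ} (h : ∀ x ∈ Ω, r * x.2 + m = 0) : r = 0 ∧ m = 0 := by
  obtain ⟨x, hx⟩ := hne
  have h1 : ∀ᶠ t in 𝓝 x.2, (x.1, t) ∈ Ω :=
    (Continuous.prodMk_right x.1).continuousAt.eventually_mem (hΩ.mem_nhds hx)
  have h2 : HasDerivAt (fun t : ℝ => r * t + m) (r * 1) x.2 :=
    ((hasDerivAt_id x.2).const_mul r).add_const m
  have h3 : (fun t : ℝ => r * t + m) =ᶠ[𝓝 x.2] fun _ => 0 := by
    filter_upwards [h1] with t ht using h _ ht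
  have h4 := h2.unique ((hasDerivAt_const x.2 (0 : ℝ)).congr_of_eventuallyEq h3)
  have hr : r = 0 := by linarith
  have := h x hx
  rw [hr] at this
  exact ⟨hr, by linarith⟩

/-- The equation is real-linear in (P, m); this allows the normalization Re P = 1. -/
theorem PrecursorEq.smul {Q : ℂ × ℝ → ℂ} {P : ℂ} {m : ℝ} {x : ℂ × ℝ} (h : PrecursorEq Q P m x)
    (r : ℝ) : PrecursorEq Q (r * P) (r * m) x := by
  unfold PrecursorEq at h ⊢
  rw [re_ofReal_mul, im_ofReal_mul]
  push_cast
  linear_combination (r : ℂ) * h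

namespace ReducesTo

variable {f : ℂ × ℝ → ℂ} {Ω : Set (ℂ × ℝ)} {e : Fin 4 → Spacetime → CVec} {Q : ℂ × ℝ → ℂ}
  {p : Spacetime} {P : ℂ} {m : ℝ}

/-- Substitute w_ζ = −(1 + A*)/2 and 2i Im P = P − P*. -/
theorem precursorEq_iff (R : ReducesTo f Ω e Q) (hp : p ∈ region Ω) :
    PrecursorEq Q P m (p.1, p.2.1) ↔ conj P + conj (invA f e p) * P
      + 2 * spLift (zDeriv (levelVelocity Q)) p * (P.re * p.2.1 + m) = 0 := by
  rw [R.conj_invA hp, PrecursorEq]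
  have c := sub_conj P
  push_cast at c
  simp only [spLift]
  constructor <;> intro h
  · linear_combination 2 * h - c
  · linear_combination h / 2 + c / 2

/-- The definition of X, read as Bd = β_ζ A − (β_ζ)*, is a real-linear equation for β_ζ; this is its
solution when |A| ≠ 1. -/
theorem zDeriv_velocity_eq (R : ReducesTo f Ω e Q) (hp : p ∈ region Ω)
    (hA : invA f e p * conj (invA f e p) ≠ 1) :
    spLift (zDeriv (levelVelocity Q)) p = conj (invX f e p * e 3 p 3)
      + conj (invA f e p) * (invX f e p * e 3 p 3) := by
  have h0 : invA f e p * conj (invA f e p) - 1 ≠ 0 := sub_ne_zero.2 hA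
  have h0' : conj (invA f e p) * invA f e p - 1 ≠ 0 := by rwa [mul_comm]
  have h1 : invX f e p * e 3 p 3 = (spLift (zDeriv (levelVelocity Q)) p * invA f e p
      - conj (spLift (zDeriv (levelVelocity Q)) p)) / (invA f e p * conj (invA f e p) - 1) := by
    rw [← R.invB_mul_D hp, invX]; ring
  rw [h1]
  simp
  field_simp
  ring

/-- P* + A*P = −2Uβ_ζ is real-linear in P with determinant |A|² − 1 up to sign, hence has exactly
one solution. Since β_ζ = (Xd)* + A*Xd and U is real, that solution is −2U·Xd. -/
theorem precursorEq_iff_of_ne (R : ReducesTo f Ω e Q) (hp : p ∈ region Ω)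
    (hA : invA f e p * conj (invA f e p) ≠ 1) :
    PrecursorEq Q P m (p.1, p.2.1) ↔ P = -2 * (P.re * p.2.1 + m) * (invX f e p * e 3 p 3) := by
  rw [R.precursorEq_iff hp, R.zDeriv_velocity_eq hp hA]
  have h0 : invA f e p * conj (invA f e p) - 1 ≠ 0 := sub_ne_zero.2 hA
  obtain ⟨U, hU⟩ : ∃ U : ℝ, U = P.re * p.2.1 + m := ⟨_, rfl⟩
  have hU' : (P.re : ℂ) * p.2.1 + m = U := by rw [hU]; push_cast; rfl
  rw [hU']
  constructor <;> intro h
  · have h' := congrArg conj h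
    simp [map_ofNat] at h h'
    have : (invA f e p * conj (invA f e p) - 1) * (P + 2 * U * (invX f e p * e 3 p 3)) = 0 := by
      linear_combination invA f e p * h - h'
    linear_combination (mul_eq_zero.1 this).resolve_left h0
  · have h' := congrArg conj h
    simp [map_ofNat] at h h' ⊢
    linear_combination h' + conj (invA f e p) * h

/-- The nontriviality conditions match because a, d and w never vanish: P ≠ 0 makes V¹ nonzero, and
P = 0, m ≠ 0 makes V³ nonzero. -/
theorem isPrecursor_iff (R : ReducesTo f Ω e Q) (hΩc : IsConnected Ω) :
    IsPrecursor f (region Ω) e ↔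
      ∃ (P : ℂ) (m : ℝ), (P ≠ 0 ∨ m ≠ 0) ∧ ∀ x ∈ Ω, PrecursorEq Q P m x := by
  constructor
  · rintro ⟨V, hV, hne⟩
    obtain ⟨P, m, hPm, hc⟩ := R.precursorEq_of_preservesForms hΩc hV
    refine ⟨P, m, ?_, hPm⟩
    by_contra! hcon
    obtain ⟨rfl, rfl⟩ := hcon
    rcases hne with ⟨p, hp, h⟩ | ⟨p, hp, h⟩
    · exact h (by simp [(hc p hp).1])
    · exact h (by simp [(hc p hp).2])
  · rintro ⟨P, m, hne, hPm⟩
    obtain ⟨V, hV, hc⟩ := R.preservesForms_of_precursorEq hPm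
    obtain ⟨x, hx⟩ := hΩc.nonempty
    have hx' : ((x.1, x.2, 0) : Spacetime) ∈ region Ω := hx
    refine ⟨V, hV, ?_⟩
    have h1 := R.delta_ne_zero hx'
    have h2 := R.D_ne_zero hx'
    have h3 : spLift (invLogDeriv Q) (x.1, x.2, 0) ≠ 0 := R.invLogDeriv_ne_zero hx
    by_cases hP : P = 0
    · right
      refine ⟨_, hx', ?_⟩
      have hm : m ≠ 0 := hne.resolve_left (by simpa using hP)
      rw [(hc _ hx').2, hP]
      simp [h2, hm]
    · left
      refine ⟨_, hx', ?_⟩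
      rw [(hc _ hx').1]
      simp [h1, h3, hP]

/-- With U = 0 the equation is P* + A*P = 0, and P* = −P ≠ 0. -/
theorem invA_eq_one_of_precursorEq (R : ReducesTo f Ω e Q) (hP : P ≠ 0)
    (hre : P.re = 0) (hm : m = 0) (h : ∀ x ∈ Ω, PrecursorEq Q P m x) (hp : p ∈ region Ω) :
    invA f e p = 1 := by
  have h1 := (R.precursorEq_iff hp).1 (h _ hp)
  have c := add_conj P
  rw [hre] at c h1
  rw [hm] at h1
  push_cast at c h1
  have h2 : conj (invA f e p) = 1 := by
    refine mul_right_cancel₀ hP ?_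
    linear_combination h1 - c
  simpa using congrArg conj h2

theorem exists_preservesForms_first_iff (R : ReducesTo f Ω e Q) (hΩc : IsConnected Ω) :
    (∃ V, PreservesForms f (region Ω) e V ∧
          (∃ p ∈ region Ω, frameComp f e V 0 p ≠ 0) ∧
          ∀ p ∈ region Ω, frameComp f e V 2 p = 0) ↔
        ∀ p ∈ region Ω, invA f e p = 1 := by
  constructor
  · rintro ⟨V, hV, ⟨p₀, hp₀, h0⟩, h2⟩
    obtain ⟨P, m, hPm, hc⟩ := R.precursorEq_of_preservesForms hΩc hV
    -- V³ = dU vanishes identically, and an affine function of u vanishing on an open set has zero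
    -- coefficients.
    have hU : ∀ x ∈ Ω, P.re * x.2 + m = 0 := fun x hx => by
      have hx' : ((x.1, x.2, 0) : Spacetime) ∈ region Ω := hx
      have h := h2 _ hx'
      rw [(hc _ hx').2] at h
      exact_mod_cast (mul_eq_zero.1 h).resolve_left (R.D_ne_zero hx')
    obtain ⟨hre, hm⟩ := eq_zero_of_affine_eq_zero R.isOpen hΩc.nonempty hU
    have hP : P ≠ 0 := fun hP => h0 (by rw [(hc p₀ hp₀).1, hP]; simp)
    exact fun p hp => R.invA_eq_one_of_precursorEq hP hre hm hPm hp
  · intro hA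
    obtain ⟨V, hV, hc⟩ := R.preservesForms_of_precursorEq (P := I) (m := 0) fun x hx => by
      have hx' : ((x.1, x.2, 0) : Spacetime) ∈ region Ω := hx
      refine (R.precursorEq_iff hx').2 ?_
      simp [hA _ hx']
    obtain ⟨x, hx⟩ := hΩc.nonempty
    have hx' : ((x.1, x.2, 0) : Spacetime) ∈ region Ω := hx
    have h1 := R.delta_ne_zero hx'
    have h3 : spLift (invLogDeriv Q) (x.1, x.2, 0) ≠ 0 := R.invLogDeriv_ne_zero hx
    refine ⟨V, hV, ⟨_, hx', ?_⟩, fun p hp => ?_⟩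
    · rw [(hc _ hx').1]
      simp [h1, h3]
    · rw [(hc _ hp).2]
      simp

theorem mu_eq_zero_iff (R : ReducesTo f Ω e Q) (hp : p ∈ region Ω) :
    npMu f e p = 0 ↔ spLift (zDeriv (levelVelocity Q)) p = 0 := by
  rw [R.mu p hp, div_eq_zero_iff]
  simp [R.D_ne_zero hp]

theorem mu_eq_zero_of_precursorEq (R : ReducesTo f Ω e Q) (hm : m ≠ 0) (hp : p ∈ region Ω)
    (h : PrecursorEq Q 0 m (p.1, p.2.1)) : npMu f e p = 0 := by
  rw [R.mu_eq_zero_iff hp]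
  have h1 := (R.precursorEq_iff hp).1 h
  simpa [hm] using h1

theorem precursorEq_of_mu_eq_zero (R : ReducesTo f Ω e Q) (hp : p ∈ region Ω)
    (h : npMu f e p = 0) : PrecursorEq Q 0 1 (p.1, p.2.1) := by
  rw [R.precursorEq_iff hp, (R.mu_eq_zero_iff hp).1 h]
  simp

theorem exists_preservesForms_third_iff (R : ReducesTo f Ω e Q) (hΩc : IsConnected Ω) :
    (∃ V, PreservesForms f (region Ω) e V ∧
          (∀ p ∈ region Ω, frameComp f e V 0 p = 0) ∧
          ∃ p ∈ region Ω, frameComp f e V 2 p ≠ 0) ↔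
        ∀ p ∈ region Ω, npMu f e p = 0 := by
  obtain ⟨x, hx⟩ := hΩc.nonempty
  have hx' : ((x.1, x.2, 0) : Spacetime) ∈ region Ω := hx
  have h1 := R.delta_ne_zero hx'
  have h2 := R.D_ne_zero hx'
  have h3 : spLift (invLogDeriv Q) (x.1, x.2, 0) ≠ 0 := R.invLogDeriv_ne_zero hx
  constructor
  · rintro ⟨V, hV, h0, p₀, hp₀, hp₂⟩
    obtain ⟨P, m, hPm, hc⟩ := R.precursorEq_of_preservesForms hΩc hV
    have hP : P = 0 := by
      have h := h0 _ hx'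
      rw [(hc _ hx').1] at h
      simpa [h1, h3] using h
    subst hP
    have hm : m ≠ 0 := fun hm => hp₂ (by rw [(hc _ hp₀).2, hm]; simp)
    exact fun p hp => R.mu_eq_zero_of_precursorEq hm hp (hPm _ hp)
  · intro hmu
    obtain ⟨V, hV, hc⟩ := R.preservesForms_of_precursorEq (P := 0) (m := 1) fun x hx =>
      R.precursorEq_of_mu_eq_zero (p := (x.1, x.2, 0)) hx (hmu (x.1, x.2, 0) hx)
    refine ⟨V, hV, fun p hp => ?_, _, hx', ?_⟩
    · rw [(hc _ hp).1]; simp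
    · rw [(hc _ hx').2]; simpa using h2

/-- Δ annihilates Q, hence also d = ±|Q|. So Δ acts only on φ, where its ζ-part sees nothing and its
u-component 1/d leaves φ_u/d². -/
theorem vecDeriv_Delta (R : ReducesTo f Ω e Q) (hp : p ∈ region Ω) {φ : ℂ × ℝ → ℂ}
    {Ω' : Set (ℂ × ℝ)} (hΩ' : IsOpen Ω') (hφ : IsProfile φ Ω') (hp' : p ∈ region Ω')
    (hz : zDeriv φ (p.1, p.2.1) = 0) {ψ : Spacetime → ℂ}
    (hψ : ψ =ᶠ[𝓝 p] fun q => spLift φ q * (e 3 q 3)⁻¹) :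
    vecDeriv (e 2) ψ p = uDeriv φ (p.1, p.2.1) / e 3 p 3 ^ 2 := by
  have hd := R.D_ne_zero hp
  have D3 := R.differentiableAt_component hp 3 3
  have Dφ := _root_.differentiableAt_spLift hφ hΩ' hp'
  have h : ∀ i, pd i ψ p = ![0, 0, uDeriv φ (p.1, p.2.1), 0] i * (e 3 p 3)⁻¹
      - spLift φ p * (logPd Q p i + logPdConj Q p i) / 2 * (e 3 p 3)⁻¹ := by
    intro i
    rw [pd_congr hψ, pd_mul Dφ (D3.fun_inv hd), pd_inv D3 hd, R.pd_D hp, pd_lift hφ hΩ' hp']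
    have : ![spLift (zDeriv φ) p, 0, spLift (uDeriv φ) p, 0] i
        = ![0, 0, uDeriv φ (p.1, p.2.1), 0] i := by
      fin_cases i <;> simp [spLift, hz]
    rw [this]
    field_simp
    ring
  simp only [vecDeriv, Fin.sum_univ_four, h, R.Delta_zero hp, R.Delta_one hp, R.Delta_two hp,
    logPd, logPdConj]
  simp
  field_simp
  ring

/-- AA* − 1 is real, so B and X differ by a nonzero real factor: B₂/B₁ = X₂/X₁, and B₁ = 0 exactly
when X₁ = 0. -/
theorem invB_eq (hA : invA f e p * conj (invA f e p) ≠ 1) :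
    ∃ r : ℝ, r ≠ 0 ∧ invB f e p = r * invX f e p := by
  have h0 : invA f e p * conj (invA f e p) - 1 ≠ 0 := sub_ne_zero.2 hA
  have h1 : invA f e p * conj (invA f e p) - 1 = ((normSq (invA f e p) - 1 : ℝ) : ℂ) := by
    rw [mul_conj]; push_cast; rfl
  refine ⟨normSq (invA f e p) - 1, fun h => h0 (by rw [h1, h]; simp), ?_⟩
  rw [← h1, invX]
  field_simp

theorem D_eq_ofReal (R : ReducesTo f Ω e Q) (hp : p ∈ region Ω) :
    ∃ d : ℝ, d ≠ 0 ∧ e 3 p 3 = d := by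
  have h := conj_eq_iff_real.1 (R.D_real hp)
  obtain ⟨d, hd⟩ := h
  exact ⟨d, fun h => R.D_ne_zero hp (by rw [hd, h]; simp), hd⟩

end ReducesTo

/-! ### Evolution of X along Δ and the classification of precursors -/

namespace ReducesTo

variable {f : ℂ × ℝ → ℂ} {Ω : Set (ℂ × ℝ)} {e : Fin 4 → Spacetime → CVec} {Q : ℂ × ℝ → ℂ}
  {p : Spacetime} {P : ℂ} {m k : ℝ}

theorem eventually_region (R : ReducesTo f Ω e Q) (hp : p ∈ region Ω) {S : ℂ × ℝ → Prop}
    (h : ∀ᶠ x in 𝓝 (p.1, p.2.1), S x) : ∀ᶠ q in 𝓝 p, q ∈ region Ω ∧ S (q.1, q.2.1) := by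
  have hc : ContinuousAt (fun q : Spacetime => (q.1, q.2.1)) p := by fun_prop
  filter_upwards [(isOpen_region R.isOpen).mem_nhds hp, hc.eventually h] with q h1 h2
  exact ⟨h1, h2⟩

theorem zDeriv_velocity_ne_zero (R : ReducesTo f Ω e Q) (hp : p ∈ region Ω)
    (hB : invB f e p ≠ 0) : spLift (zDeriv (levelVelocity Q)) p ≠ 0 := fun h => by
  have h1 := R.invB_mul_D hp
  rw [h] at h1
  exact mul_ne_zero hB (R.D_ne_zero hp) (by simpa using h1)

/-- At a zero of U the equation P = −2U·Xd would give P = 0, then m = 0. So Ω avoids the value of u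
where the flow of V is singular. -/
theorem affine_ne_zero_of_precursorEq (R : ReducesTo f Ω e Q) (hp : p ∈ region Ω)
    (hA : invA f e p * conj (invA f e p) ≠ 1) (h : PrecursorEq Q P m (p.1, p.2.1))
    (hne : P ≠ 0 ∨ m ≠ 0) : P.re * p.2.1 + m ≠ 0 := by
  intro hU
  have h1 := (R.precursorEq_iff_of_ne hp hA).1 h
  have hU' : (P.re : ℂ) * p.2.1 + m = 0 := by exact_mod_cast hU
  have hP : P = 0 := by rw [h1, hU']; simp
  rw [hP] at hU
  exact hne.elim (fun h => h hP) fun h => h (by simpa using hU)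

/-- `X D` is determined by a solution of the precursor equation. -/
theorem invX_mul_D_of_precursorEq (R : ReducesTo f Ω e Q) (hp : p ∈ region Ω)
    (hA : invA f e p * conj (invA f e p) ≠ 1) (h : PrecursorEq Q P m (p.1, p.2.1))
    (hne : P ≠ 0 ∨ m ≠ 0) :
    invX f e p * e 3 p 3 = P * ((-1 / (2 * (P.re * p.2.1 + m)) : ℝ) : ℂ) := by
  have h0 := R.affine_ne_zero_of_precursorEq hp hA h hne
  have h1 := (R.precursorEq_iff_of_ne hp hA).1 h
  have h0' : (P.re : ℂ) * p.2.1 + m ≠ 0 := by exact_mod_cast h0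
  push_cast
  field_simp
  linear_combination h1

theorem invX_components (R : ReducesTo f Ω e Q) (hp : p ∈ region Ω) {y : ℂ}
    (h : invX f e p * e 3 p 3 = y) : invX1 f e p = (y.re : ℂ) * (e 3 p 3)⁻¹ ∧
      invX2 f e p = (y.im : ℂ) * (e 3 p 3)⁻¹ := by
  obtain ⟨d, hd, he⟩ := R.D_eq_ofReal hp
  rw [he] at h ⊢
  have hd' : (d : ℂ) ≠ 0 := by exact_mod_cast hd
  constructor
  · rw [invX1, ← h, re_mul_ofReal]
    push_cast
    field_simp
  · rw [invX2, ← h, im_mul_ofReal]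
    push_cast
    field_simp

theorem isProfile_inv_affine (r m : ℝ) : IsProfile
    (fun x : ℂ × ℝ => ((-1 / (2 * (r * x.2 + m)) : ℝ) : ℂ)) {x | r * x.2 + m ≠ 0} := by
  refine IsProfile.comp_snd (g := fun t => ((-1 / (2 * (r * t + m)) : ℝ) : ℂ))
    (s := {t | r * t + m ≠ 0}) ?_ fun x hx => hx
  refine ofRealCLM.contDiff.comp_contDiffOn ?_
  refine ContDiffOn.div contDiffOn_const (by fun_prop) fun t ht => ?_
  exact mul_ne_zero two_ne_zero ht

theorem isOpen_affine_ne_zero (r m : ℝ) : IsOpen {x : ℂ × ℝ | r * x.2 + m ≠ 0} :=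
  isOpen_ne_fun (by fun_prop) continuous_const

/-- For φ = −1/(2(ru + m)) one has φ′ = 2rφ²; with r = 1 this is the origin of ΔX₁ = 2X₁². -/
theorem derivs_inv_affine {r m : ℝ} {x : ℂ × ℝ} (hx : r * x.2 + m ≠ 0) :
    zDeriv (fun x : ℂ × ℝ => ((-1 / (2 * (r * x.2 + m)) : ℝ) : ℂ)) x = 0 ∧
    uDeriv (fun x : ℂ × ℝ => ((-1 / (2 * (r * x.2 + m)) : ℝ) : ℂ)) x
      = (2 * r * (-1 / (2 * (r * x.2 + m))) ^ 2 : ℝ) := by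
  have h := isProfile_inv_affine r m
  have ho := isOpen_affine_ne_zero r m
  refine ⟨h.zDeriv_eq_zero_of_real ho (fun _ _ => conj_ofReal _) hx, ?_⟩
  have h1 := hasDerivAt_uDeriv (h.differentiableAt ho hx)
  have h2 : HasDerivAt (fun t : ℝ => 2 * (r * t + m)) (2 * (r * 1)) x.2 :=
    (((hasDerivAt_id x.2).const_mul r).add_const m).const_mul 2
  have h3 := ((hasDerivAt_const x.2 (-1 : ℝ)).div h2 (mul_ne_zero two_ne_zero hx)).ofReal_comp
  rw [h1.unique h3]
  congr 1
  field_simp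
  ring

/-- A local solution of the precursor equation determines `Δ X₁` and `Δ X₂`. -/
theorem vecDeriv_invX_of_precursorEq (R : ReducesTo f Ω e Q) (hp : p ∈ region Ω)
    (hA : ∀ q ∈ region Ω, invA f e q * conj (invA f e q) ≠ 1)
    (h : ∀ᶠ x in 𝓝 (p.1, p.2.1), PrecursorEq Q P m x) (hne : P ≠ 0 ∨ m ≠ 0) :
    ∃ r : ℝ, r ≠ 0 ∧ invX f e p * e 3 p 3 = P * r ∧
      vecDeriv (e 2) (invX1 f e) p = P.re * (2 * P.re * r ^ 2) / e 3 p 3 ^ 2 ∧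
      vecDeriv (e 2) (invX2 f e) p = P.im * (2 * P.re * r ^ 2) / e 3 p 3 ^ 2 := by
  have h0 := R.affine_ne_zero_of_precursorEq hp (hA p hp) h.self_of_nhds hne
  have hX := R.invX_mul_D_of_precursorEq hp (hA p hp) h.self_of_nhds hne
  have hpr := isProfile_inv_affine P.re m
  have ho := isOpen_affine_ne_zero P.re m
  obtain ⟨hz, hu⟩ := derivs_inv_affine (x := (p.1, p.2.1)) h0
  have Dφ := hpr.differentiableAt ho (x := (p.1, p.2.1)) h0
  have hpr' : ∀ c : ℝ, IsProfile (fun x : ℂ × ℝ => (c : ℂ)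
      * ((-1 / (2 * (P.re * x.2 + m)) : ℝ) : ℂ)) {x | P.re * x.2 + m ≠ 0} := fun c =>
    (IsProfile.const _).mul hpr
  have hz' : ∀ c : ℝ, zDeriv (fun x : ℂ × ℝ => (c : ℂ)
      * ((-1 / (2 * (P.re * x.2 + m)) : ℝ) : ℂ)) (p.1, p.2.1) = 0 := fun c => by
    rw [zDeriv_const_mul _ Dφ, hz, mul_zero]
  have hev := R.eventually_region hp h
  refine ⟨_, ?_, hX, ?_, ?_⟩
  · exact div_ne_zero (by norm_num) (mul_ne_zero two_ne_zero h0)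
  · rw [R.vecDeriv_Delta hp ho (hpr' P.re) h0 (hz' P.re), uDeriv_const_mul _ Dφ, hu]
    · push_cast; ring
    · filter_upwards [hev] with q hq
      rw [(R.invX_components hq.1 (R.invX_mul_D_of_precursorEq hq.1 (hA q hq.1) hq.2 hne)).1,
        re_mul_ofReal]
      simp [spLift]
  · rw [R.vecDeriv_Delta hp ho (hpr' P.im) h0 (hz' P.im), uDeriv_const_mul _ Dφ, hu]
    · push_cast; ring
    · filter_upwards [hev] with q hq
      rw [(R.invX_components hq.1 (R.invX_mul_D_of_precursorEq hq.1 (hA q hq.1) hq.2 hne)).2,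
        im_mul_ofReal]
      simp [spLift]

/-- The constant m may change from point to point, as it does for local normal forms, because the
condition on X does not involve it. -/
theorem condB_of_eventually (R : ReducesTo f Ω e Q) (hB : GenericB f (region Ω) e)
    (h : ∀ p ∈ region Ω, ∃ m : ℝ, ∀ᶠ x in 𝓝 (p.1, p.2.1), PrecursorEq Q (1 + I * k) m x) :
    CondB f (region Ω) e k := by
  intro p hp
  obtain ⟨m, hm⟩ := h p hp
  have hre : (1 + I * (k : ℂ)).re = 1 := by simp
  have him : (1 + I * (k : ℂ)).im = k := by simp
  have hne : 1 + I * (k : ℂ) ≠ 0 := fun h => by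
    have := congrArg re h
    simp at this
  obtain ⟨r, hr, hX, h1, -⟩ := R.vecDeriv_invX_of_precursorEq hp (fun q hq => (hB q hq).2) hm
    (Or.inl hne)
  have hc := R.invX_components hp hX
  obtain ⟨s, hs, hBX⟩ := invB_eq (hB p hp).2
  have hd := R.D_ne_zero hp
  rw [re_mul_ofReal, hre, im_mul_ofReal, him] at hc
  constructor
  · have e1 : (invX f e p).im = k * (invX f e p).re := by
      have h1 : invX2 f e p = k * invX1 f e p := by
        rw [hc.1, hc.2]; push_cast; ring
      rw [invX1, invX2] at h1
      exact_mod_cast h1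
    have h0 := (hB p hp).1
    rw [hBX, re_ofReal_mul] at h0
    have h0' := right_ne_zero_of_mul h0
    rw [hBX, im_ofReal_mul, re_ofReal_mul, e1]
    field_simp
  · rw [h1, hc.1, hre]
    push_cast
    field_simp

theorem condC_of_eventually (R : ReducesTo f Ω e Q) (hC : GenericC f (region Ω) e)
    (h : ∀ p ∈ region Ω, ∃ m : ℝ, ∀ᶠ x in 𝓝 (p.1, p.2.1), PrecursorEq Q (-I) m x) :
    CondC f (region Ω) e := by
  intro p hp
  obtain ⟨m, hm⟩ := h p hp
  obtain ⟨r, hr, hX, -, h2⟩ := R.vecDeriv_invX_of_precursorEq hp (fun q hq => (hC q hq).2.2) hm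
    (Or.inl (by simp))
  rw [h2]
  simp

/-- Constancy of X₂/X₁ turns φ = X₁d into a quotient of holomorphic functions, yet φ is real; so it
depends on u only. Then ΔX₁ = 2X₁² becomes φ′ = 2φ², so that 1/φ + 2u is constant. -/
theorem exists_precursorEq_of_condB (R : ReducesTo f Ω e Q) (hΩc : IsConnected Ω)
    (hB : GenericB f (region Ω) e) (hk : CondB f (region Ω) e k) :
    ∃ m : ℝ, ∀ x ∈ Ω, PrecursorEq Q (1 + I * k) m x := by
  have hΩ := R.isOpen
  have lifted : ∀ x ∈ Ω, ((x.1, x.2, 0) : Spacetime) ∈ region Ω := fun x hx => hx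
  -- β_ζ = (Xd)* + A*Xd with X = X₁(1 + ik), solved for X₁d; the second summand of the denominator
  -- is A*(1 + ik).
  obtain ⟨φ, hφ⟩ : ∃ φ : ℂ × ℝ → ℂ, φ = fun x => zDeriv (levelVelocity Q) x
    / ((1 - I * k) + (-1 - 2 * zDeriv (invLogDeriv Q) x) * (1 + I * k)) := ⟨_, rfl⟩
  have hX : ∀ p ∈ region Ω, invX f e p = invX1 f e p * (1 + I * k) := by
    intro p hp
    obtain ⟨s, hs, hBX⟩ := invB_eq (hB p hp).2
    have h1 := (hk p hp).1
    have h0 := (hB p hp).1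
    rw [div_eq_iff h0, hBX, im_ofReal_mul, re_ofReal_mul] at h1
    have h2 : (invX f e p).im = k * (invX f e p).re := mul_left_cancel₀ hs (by linarith)
    rw [invX1]
    apply Complex.ext <;> simp [h2]
    ring
  have hv : ∀ p ∈ region Ω, spLift (zDeriv (levelVelocity Q)) p = invX1 f e p * e 3 p 3
      * ((1 - I * k) + (-1 - 2 * spLift (zDeriv (invLogDeriv Q)) p) * (1 + I * k)) := by
    intro p hp
    have hr : conj (invX1 f e p) = invX1 f e p := conj_ofReal _
    rw [R.zDeriv_velocity_eq hp (hB p hp).2, hX p hp, R.conj_invA hp]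
    simp [R.D_real hp, hr]
    ring
  have hb : ∀ p ∈ region Ω, spLift (zDeriv (levelVelocity Q)) p ≠ 0 := fun p hp =>
    R.zDeriv_velocity_ne_zero hp fun h => (hB p hp).1 (by simp [h])
  have hden : ∀ p ∈ region Ω,
      (1 - I * k) + (-1 - 2 * spLift (zDeriv (invLogDeriv Q)) p) * (1 + I * k) ≠ 0 :=
    fun p hp h => hb p hp (by rw [hv p hp, h, mul_zero])
  have hφX : ∀ p ∈ region Ω, spLift φ p = invX1 f e p * e 3 p 3 := by
    intro p hp
    have h : spLift φ p = spLift (zDeriv (levelVelocity Q)) p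
      / ((1 - I * k) + (-1 - 2 * spLift (zDeriv (invLogDeriv Q)) p) * (1 + I * k)) := by
      rw [hφ]; rfl
    rw [h, hv p hp, mul_div_cancel_right₀ _ (hden p hp)]
  have pφ : IsProfile φ Ω := by
    rw [hφ]
    exact (R.isProfile_velocity.zDeriv hΩ).div ((IsProfile.const _).add (((IsProfile.const _).sub
      ((IsProfile.const _).mul (R.isProfile_invLogDeriv.zDeriv hΩ))).mul (IsProfile.const _)))
      fun x hx => hden (x.1, x.2, 0) hx
  have rφ : ∀ x ∈ Ω, conj (φ x) = φ x := fun x hx => by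
    have h := hφX _ (lifted x hx)
    have hr : conj (invX1 f e (x.1, x.2, 0)) = invX1 f e (x.1, x.2, 0) := conj_ofReal _
    change φ x = _ at h
    rw [h, map_mul, hr, R.D_real (lifted x hx)]
  have zφ : ∀ x ∈ Ω, zDeriv φ x = 0 := fun x hx => pφ.zDeriv_eq_zero_of_real hΩ rφ hx
  have φ0 : ∀ x ∈ Ω, φ x ≠ 0 := fun x hx => div_ne_zero (hb _ (lifted x hx)) (hden _ (lifted x hx))
    |> fun h => by rw [hφ]; exact h
  have uφ : ∀ x ∈ Ω, uDeriv φ x = 2 * φ x ^ 2 := fun x hx => by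
    have hp := lifted x hx
    have h1 := R.vecDeriv_Delta (ψ := invX1 f e) hp hΩ pφ hp (zφ _ hx) (by
      filter_upwards [(isOpen_region hΩ).mem_nhds hp] with q hq
      rw [hφX q hq, mul_assoc, mul_inv_cancel₀ (R.D_ne_zero hq), mul_one])
    have h2 := hφX _ hp
    have hd := R.D_ne_zero hp
    rw [(hk _ hp).2] at h1
    change φ x = _ at h2
    rw [h2]
    field_simp at h1
    linear_combination -h1
  have pu : IsProfile (fun x : ℂ × ℝ => (x.2 : ℂ)) Ω :=
    IsProfile.comp_snd (s := Set.univ) (g := fun t => (t : ℂ)) ofRealCLM.contDiff.contDiffOn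
      fun _ _ => trivial
  have pψ : IsProfile (fun x : ℂ × ℝ => 1 / φ x + 2 * x.2) Ω :=
    ((IsProfile.const _).div pφ φ0).add ((IsProfile.const _).mul pu)
  obtain ⟨c, hc⟩ := pψ.exists_eq_const hΩ hΩc
    (fun x hx => pψ.zDeriv_eq_zero_of_real hΩ (fun y hy => by simp [rφ y hy, map_ofNat]) hx)
    fun x hx => by
      have h1 := hasDerivAt_uDeriv (pφ.differentiableAt hΩ hx)
      have h2 := hasDerivAt_uDeriv (pψ.differentiableAt hΩ hx)
      have h3 := ((hasDerivAt_const x.2 (1 : ℂ)).div h1 (φ0 x hx)).add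
        ((ofRealCLM.hasDerivAt (x := x.2)).const_mul (2 : ℂ))
      have h4 := h2.unique h3
      have h0 := φ0 x hx
      rw [h4, uφ x hx]
      simp
      field_simp
      ring
  have cr : conj c = c := by
    obtain ⟨x, hx⟩ := hΩc.nonempty
    rw [← hc x hx]
    simp [rφ x hx, map_ofNat]
  obtain ⟨c', rfl⟩ := conj_eq_iff_real.1 cr
  -- From 1/φ + 2u = c′ one gets φ = −1/(2(u − c′/2)), so U = u − c′/2.
  refine ⟨-c' / 2, fun x hx => ?_⟩
  have hp := lifted x hx
  refine (R.precursorEq_iff_of_ne hp (hB _ hp).2).2 ?_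
  have h1 := hφX _ hp
  have h2 := hc x hx
  have h0 := φ0 x hx
  change φ x = _ at h1
  rw [hX _ hp]
  simp
  have h3 : invX1 f e (x.1, x.2, 0) * (1 + I * k) * e 3 (x.1, x.2, 0) 3 = φ x * (1 + I * k) := by
    rw [h1]; ring
  rw [h3]
  field_simp at h2
  linear_combination (1 + I * (k : ℂ)) * h2

/-- As in class B, with X = iX₂: the function X₂d is real and holomorphic, hence free of ζ, and ΔX₂
= 0 makes it constant. -/
theorem exists_precursorEq_of_condC (R : ReducesTo f Ω e Q) (hΩc : IsConnected Ω)
    (hC : GenericC f (region Ω) e) (hX2 : CondC f (region Ω) e) :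
    ∃ m : ℝ, ∀ x ∈ Ω, PrecursorEq Q (-I) m x := by
  have hΩ := R.isOpen
  have lifted : ∀ x ∈ Ω, ((x.1, x.2, 0) : Spacetime) ∈ region Ω := fun x hx => hx
  obtain ⟨φ, hφ⟩ : ∃ φ : ℂ × ℝ → ℂ, φ = fun x => zDeriv (levelVelocity Q) x
    / (I * (-2 - 2 * zDeriv (invLogDeriv Q) x)) := ⟨_, rfl⟩
  have hX : ∀ p ∈ region Ω, invX f e p = I * invX2 f e p := by
    intro p hp
    obtain ⟨s, hs, hBX⟩ := invB_eq (hC p hp).2.2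
    have h1 := (hC p hp).1
    rw [hBX, re_ofReal_mul] at h1
    have h2 : (invX f e p).re = 0 := (mul_eq_zero.1 h1).resolve_left hs
    rw [invX2]
    apply Complex.ext <;> simp [h2]
  have hv : ∀ p ∈ region Ω, spLift (zDeriv (levelVelocity Q)) p = invX2 f e p * e 3 p 3
      * (I * (-2 - 2 * spLift (zDeriv (invLogDeriv Q)) p)) := by
    intro p hp
    have hr : conj (invX2 f e p) = invX2 f e p := conj_ofReal _
    rw [R.zDeriv_velocity_eq hp (hC p hp).2.2, hX p hp, R.conj_invA hp]
    simp [R.D_real hp, hr]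
    ring
  have hb : ∀ p ∈ region Ω, spLift (zDeriv (levelVelocity Q)) p ≠ 0 := fun p hp h =>
    (hC p hp).2.1 ((R.mu_eq_zero_iff hp).2 h)
  have hden : ∀ p ∈ region Ω, I * (-2 - 2 * spLift (zDeriv (invLogDeriv Q)) p) ≠ 0 :=
    fun p hp h => hb p hp (by rw [hv p hp, h, mul_zero])
  have hφX : ∀ p ∈ region Ω, spLift φ p = invX2 f e p * e 3 p 3 := by
    intro p hp
    have h : spLift φ p = spLift (zDeriv (levelVelocity Q)) p
      / (I * (-2 - 2 * spLift (zDeriv (invLogDeriv Q)) p)) := by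
      rw [hφ]; rfl
    rw [h, hv p hp, mul_div_cancel_right₀ _ (hden p hp)]
  have pφ : IsProfile φ Ω := by
    rw [hφ]
    exact (R.isProfile_velocity.zDeriv hΩ).div ((IsProfile.const _).mul ((IsProfile.const _).sub
      ((IsProfile.const _).mul (R.isProfile_invLogDeriv.zDeriv hΩ))))
      fun x hx => hden (x.1, x.2, 0) hx
  have rφ : ∀ x ∈ Ω, conj (φ x) = φ x := fun x hx => by
    have h := hφX _ (lifted x hx)
    have hr : conj (invX2 f e (x.1, x.2, 0)) = invX2 f e (x.1, x.2, 0) := conj_ofReal _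
    change φ x = _ at h
    rw [h, map_mul, hr, R.D_real (lifted x hx)]
  have zφ : ∀ x ∈ Ω, zDeriv φ x = 0 := fun x hx => pφ.zDeriv_eq_zero_of_real hΩ rφ hx
  obtain ⟨c, hc⟩ := pφ.exists_eq_const hΩ hΩc zφ fun x hx => by
    have hp := lifted x hx
    have h1 := R.vecDeriv_Delta (ψ := invX2 f e) hp hΩ pφ hp (zφ _ hx) (by
      filter_upwards [(isOpen_region hΩ).mem_nhds hp] with q hq
      rw [hφX q hq, mul_assoc, mul_inv_cancel₀ (R.D_ne_zero hq), mul_one])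
    rw [hX2 _ hp] at h1
    have hd := R.D_ne_zero hp
    field_simp at h1
    rw [zero_mul] at h1
    exact h1.symm
  have c0 : c ≠ 0 := by
    obtain ⟨x, hx⟩ := hΩc.nonempty
    have h1 : zDeriv (levelVelocity Q) x ≠ 0 := hb (x.1, x.2, 0) hx
    have h2 : I * (-2 - 2 * zDeriv (invLogDeriv Q) x) ≠ 0 := hden (x.1, x.2, 0) hx
    rw [← hc x hx, hφ]
    exact div_ne_zero h1 h2
  have cr : conj c = c := by
    obtain ⟨x, hx⟩ := hΩc.nonempty
    rw [← hc x hx, rφ x hx]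
  obtain ⟨c', rfl⟩ := conj_eq_iff_real.1 cr
  -- With Xd = ic′ and U = m, the relation −i = −2U·Xd fixes m.
  refine ⟨1 / (2 * c'), fun x hx => ?_⟩
  have hp := lifted x hx
  refine (R.precursorEq_iff_of_ne hp (hC _ hp).2.2).2 ?_
  have h1 := hφX _ hp
  change φ x = _ at h1
  rw [hc x hx] at h1
  rw [hX _ hp, mul_assoc I, ← h1]
  simp
  field_simp

theorem isPrecursor_iff_condB (R : ReducesTo f Ω e Q) (hΩc : IsConnected Ω)
    (hB : GenericB f (region Ω) e) :
    IsPrecursor f (region Ω) e ↔ ∃ k : ℝ, CondB f (region Ω) e k := by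
  rw [R.isPrecursor_iff hΩc]
  constructor
  · rintro ⟨P, m, hne, hPm⟩
    obtain ⟨x, hx⟩ := hΩc.nonempty
    have hp : ((x.1, x.2, 0) : Spacetime) ∈ region Ω := hx
    have h1 := R.invX_mul_D_of_precursorEq hp (hB _ hp).2 (hPm x hx) hne
    obtain ⟨s, hs, hBX⟩ := invB_eq (hB _ hp).2
    -- Xd is a real multiple of P, so Re P = 0 would give X₁ = 0 and then B₁ = 0.
    have hre : P.re ≠ 0 := by
      intro hre
      have h2 := (R.invX_components hp h1).1
      rw [re_mul_ofReal, hre] at h2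
      simp [invX1] at h2
      exact (hB _ hp).1 (by rw [hBX, re_ofReal_mul, h2, mul_zero])
    refine ⟨P.im / P.re, R.condB_of_eventually hB fun p hp => ⟨P.re⁻¹ * m, ?_⟩⟩
    have : 1 + I * ((P.im / P.re : ℝ) : ℂ) = ((P.re⁻¹ : ℝ) : ℂ) * P := by
      apply Complex.ext <;> simp <;> field_simp
    rw [this]
    exact Filter.eventually_of_mem (R.isOpen.mem_nhds hp) fun y hy => (hPm y hy).smul _
  · rintro ⟨k, hk⟩
    obtain ⟨m, hm⟩ := R.exists_precursorEq_of_condB hΩc hB hk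
    refine ⟨1 + I * k, m, Or.inl fun h => ?_, hm⟩
    have := congrArg re h
    simp at this

theorem isPrecursor_iff_condC (R : ReducesTo f Ω e Q) (hΩc : IsConnected Ω)
    (hC : GenericC f (region Ω) e) :
    IsPrecursor f (region Ω) e ↔ CondC f (region Ω) e := by
  rw [R.isPrecursor_iff hΩc]
  constructor
  · rintro ⟨P, m, hne, hPm⟩
    intro p hp
    obtain ⟨r, hr, hX, -, h2⟩ := R.vecDeriv_invX_of_precursorEq hp (fun q hq => (hC q hq).2.2)
      (Filter.eventually_of_mem (R.isOpen.mem_nhds hp) hPm) hne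
    obtain ⟨s, hs, hBX⟩ := invB_eq (hC _ hp).2.2
    have h1 := (hC p hp).1
    rw [hBX, re_ofReal_mul] at h1
    have h3 := (R.invX_components hp hX).1
    rw [invX1, (mul_eq_zero.1 h1).resolve_left hs, re_mul_ofReal] at h3
    have hre : P.re = 0 := by
      have h4 := R.D_ne_zero hp
      have h5 := h3.symm
      simp [hr, h4] at h5
      exact h5
    rw [h2, hre]
    simp
  · intro h
    obtain ⟨m, hm⟩ := R.exists_precursorEq_of_condC hΩc hC h
    exact ⟨-I, m, Or.inl (by simp), hm⟩

/-- The class is read off from (P, m): U = 0 gives L when |A| = 1; otherwise P = 0, P₁ = 0 ≠ P and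
P₁ ≠ 0 give A, C and B. -/
theorem isPrecursor_iff_of_isTypeZeroTwo (R : ReducesTo f Ω e Q) (hΩc : IsConnected Ω)
    (hT : IsTypeZeroTwo f (region Ω) e)
    (hA : (∀ p ∈ region Ω, invA f e p * conj (invA f e p) = 1) ∨
        ∀ p ∈ region Ω, invA f e p * conj (invA f e p) ≠ 1) :
    IsPrecursor f (region Ω) e ↔
        (GenericB f (region Ω) e ∧ ∃ k : ℝ, CondB f (region Ω) e k) ∨
        (GenericC f (region Ω) e ∧ CondC f (region Ω) e) ∨
        (∀ p ∈ region Ω, invA f e p = 1) ∨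
        (∀ p ∈ region Ω, npMu f e p = 0) := by
  constructor
  · intro hpre
    obtain ⟨P, m, hne, hPm⟩ := (R.isPrecursor_iff hΩc).1 hpre
    rcases hA with hA | hA
    · right; right; left
      have hU : ∀ x ∈ Ω, P.re * x.2 + m = 0 := fun x hx => by
        have hp : ((x.1, x.2, 0) : Spacetime) ∈ region Ω := hx
        have h := (R.precursorEq_iff hp).1 (hPm x hx)
        have h' := congrArg conj h
        simp [map_ofNat] at h h'
        have hB := R.invB_ne_zero_of_isTypeZeroTwo hp hT (hA _ hp)
        have hBD := R.invB_mul_D hp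
        -- A times the equation minus its conjugate is (|A|² − 1)P + 2BdU.
        have : (invB f e (x.1, x.2, 0) * e 3 (x.1, x.2, 0) 3) * ((P.re : ℂ) * x.2 + m) = 0 := by
          rw [hBD]
          linear_combination (invA f e (x.1, x.2, 0) * h - h' - P * hA _ hp) / 2
        exact_mod_cast (mul_eq_zero.1 this).resolve_left (mul_ne_zero hB (R.D_ne_zero hp))
      obtain ⟨hre, hm⟩ := eq_zero_of_affine_eq_zero R.isOpen hΩc.nonempty hU
      exact fun p hp => R.invA_eq_one_of_precursorEq (hne.resolve_right (by simpa using hm)) hre hm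
        hPm hp
    · by_cases hP : P = 0
      · subst hP
        right; right; right
        exact fun p hp => R.mu_eq_zero_of_precursorEq (hne.resolve_left (by simp)) hp (hPm _ hp)
      · by_cases hre : P.re = 0
        · right; left
          have hC : GenericC f (region Ω) e := by
            intro p hp
            have h1 := R.invX_mul_D_of_precursorEq hp (hA _ hp) (hPm _ hp) hne
            have h0 := R.affine_ne_zero_of_precursorEq hp (hA _ hp) (hPm _ hp) hne
            obtain ⟨s, hs, hBX⟩ := invB_eq (hA _ hp)
            have h2 := (R.invX_components hp h1).1
            rw [re_mul_ofReal, hre] at h2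
            simp [invX1] at h2
            refine ⟨by rw [hBX, re_ofReal_mul, h2, mul_zero], fun hmu => ?_, hA p hp⟩
            -- μ = 0 would make B, hence Xd, vanish, whereas Xd = −P/(2U) is nonzero.
            have h3 := (R.mu_eq_zero_iff hp).1 hmu
            have h4 := R.invB_mul_D hp
            rw [h3, hBX, mul_assoc, h1] at h4
            simp [hs, hP] at h4
            rw [hre] at h0 h4
            simp at h4 h0
            exact h0 h4
          exact ⟨hC, (R.isPrecursor_iff_condC hΩc hC).1 hpre⟩
        · left
          have hB : GenericB f (region Ω) e := by
            intro p hp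
            have h1 := R.invX_mul_D_of_precursorEq hp (hA _ hp) (hPm _ hp) hne
            have h0 := R.affine_ne_zero_of_precursorEq hp (hA _ hp) (hPm _ hp) hne
            obtain ⟨s, hs, hBX⟩ := invB_eq (hA _ hp)
            have h2 := (R.invX_components hp h1).1
            rw [re_mul_ofReal] at h2
            refine ⟨fun hB => ?_, hA p hp⟩
            rw [hBX, re_ofReal_mul] at hB
            rw [invX1, (mul_eq_zero.1 hB).resolve_left hs] at h2
            have h3 := h2.symm
            rw [ofReal_zero, mul_eq_zero, ofReal_eq_zero] at h3
            rcases h3 with h3 | h3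
            · refine mul_ne_zero hre (div_ne_zero ?_ (mul_ne_zero two_ne_zero h0)) h3
              norm_num
            · exact inv_ne_zero (R.D_ne_zero hp) h3
          exact ⟨hB, (R.isPrecursor_iff_condB hΩc hB).1 hpre⟩
  · rintro (⟨hB, h⟩ | ⟨hC, h⟩ | h | h)
    · exact (R.isPrecursor_iff_condB hΩc hB).2 h
    · exact (R.isPrecursor_iff_condC hΩc hC).2 h
    · obtain ⟨V, hV, h0, -⟩ := (R.exists_preservesForms_first_iff hΩc).2 h
      exact ⟨V, hV, Or.inl h0⟩
    · obtain ⟨V, hV, -, h2⟩ := (R.exists_preservesForms_third_iff hΩc).2 h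
      exact ⟨V, hV, Or.inr h2⟩

end ReducesTo

/-! ## Form-preserving changes of coordinates -/

theorem exists_primitive {E : Type*} [NormedAddCommGroup E] [NormedSpace ℝ E] [CompleteSpace E]
    {σ : ℝ → E} {t₀ r : ℝ} (hσ : ContDiffOn ℝ ∞ σ (Metric.ball t₀ r)) :
    ∃ s : ℝ → E, ContDiffOn ℝ ∞ s (Metric.ball t₀ r) ∧
      ∀ t ∈ Metric.ball t₀ r, HasDerivAt s (σ t) t := by
  have hd : ∀ t ∈ Metric.ball t₀ r, HasDerivAt (fun t => ∫ τ in t₀..t, σ τ) (σ t) t := by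
    intro t ht
    have h0 : t₀ ∈ Metric.ball t₀ r :=
      Metric.mem_ball_self (lt_of_le_of_lt dist_nonneg (Metric.mem_ball.1 ht))
    have hsub : Set.uIcc t₀ t ⊆ Metric.ball t₀ r :=
      (convex_ball t₀ r).ordConnected.uIcc_subset h0 ht
    have hc := hσ.continuousOn
    exact intervalIntegral.integral_hasDerivAt_right (hc.mono hsub).intervalIntegrable
      (hc.stronglyMeasurableAtFilter Metric.isOpen_ball t ht)
      (hc.continuousAt (Metric.isOpen_ball.mem_nhds ht))
  refine ⟨_, ?_, hd⟩
  rw [contDiffOn_infty_iff_deriv_of_isOpen Metric.isOpen_ball]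
  exact ⟨fun t ht => (hd t ht).differentiableAt.differentiableWithinAt,
    hσ.congr fun t ht => (hd t ht).deriv⟩

theorem zDeriv_uDeriv_comp_snd {g : ℝ → ℂ} {S : Set ℝ} (hS : IsOpen S) (hg : ContDiffOn ℝ ∞ g S)
    {x : ℂ × ℝ} (hx : x.2 ∈ S) :
    IsProfile (fun y : ℂ × ℝ => g y.2) {y | y.2 ∈ S} ∧
    zDeriv (fun y : ℂ × ℝ => g y.2) x = 0 ∧ uDeriv (fun y : ℂ × ℝ => g y.2) x = deriv g x.2 := by
  have ho : IsOpen {y : ℂ × ℝ | y.2 ∈ S} := hS.preimage continuous_snd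
  have hp : IsProfile (fun y : ℂ × ℝ => g y.2) {y | y.2 ∈ S} := IsProfile.comp_snd hg fun _ h => h
  refine ⟨hp, ?_, ?_⟩
  · exact (hp.hasDerivAt_z ho hx).unique (hasDerivAt_const x.1 (g x.2))
  · exact (hasDerivAt_uDeriv (hp.differentiableAt ho hx)).unique
      (hg.differentiableAt_of_isOpen hS hx).hasDerivAt

theorem pd_v (p : Spacetime) (i : Fin 4) :
    pd i (fun q : Spacetime => (q.2.2 : ℂ)) p = ![0, 0, 0, 1] i ∧
      DifferentiableAt ℝ (fun q : Spacetime => (q.2.2 : ℂ)) p := by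
  have h : HasFDerivAt (fun q : Spacetime => (q.2.2 : ℂ)) (ofRealCLM.comp
      ((ContinuousLinearMap.snd ℝ ℝ ℝ).comp (ContinuousLinearMap.snd ℝ ℂ (ℝ × ℝ)))) p :=
    ContinuousLinearMap.hasFDerivAt (ofRealCLM.comp
      ((ContinuousLinearMap.snd ℝ ℝ ℝ).comp (ContinuousLinearMap.snd ℝ ℂ (ℝ × ℝ))))
  refine ⟨?_, h.differentiableAt⟩
  fin_cases i <;> simp [pd, h.fderiv]

section change

variable {c a u₀ : ℝ} {h : ℝ → ℂ} {s : ℝ → ℝ} {S : Set ℝ} {q : Spacetime}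

theorem pd_coordChange (hS : IsOpen S) (hh : ContDiffOn ℝ ∞ h S)
    (hs : ContDiffOn ℝ ∞ s S) (hq : q.2.1 ∈ S) (i k : Fin 4) :
    pd i (fun r => coordFn k (coordChange c a u₀ h s r)) q =
      ![![exp (I * c), 0, exp (I * c) * deriv h q.2.1, 0] i,
        ![0, conj (exp (I * c)), conj (exp (I * c) * deriv h q.2.1), 0] i,
        ![0, 0, (a : ℂ)⁻¹, 0] i,
        ![a * conj (deriv h q.2.1), a * deriv h q.2.1,
          a * (deriv (deriv h) q.2.1 * conj q.1 + conj (deriv (deriv h) q.2.1) * q.1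
            + ((deriv s q.2.1 : ℝ) : ℂ)), a] i] k := by
  have ho : IsOpen {y : ℂ × ℝ | y.2 ∈ S} := hS.preimage continuous_snd
  have hx : ((q.1, q.2.1) : ℂ × ℝ).2 ∈ S := hq
  have hq' : q ∈ region {y : ℂ × ℝ | y.2 ∈ S} := hq
  have hh' : ContDiffOn ℝ ∞ (deriv h) S := hh.deriv_of_isOpen hS (by simp)
  have hhc : ContDiffOn ℝ ∞ (fun t => conj (deriv h t)) S := hh'.conj_complex
  obtain ⟨ph, zh, uh⟩ := zDeriv_uDeriv_comp_snd hS hh hx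
  obtain ⟨pc, zc, uc⟩ := zDeriv_uDeriv_comp_snd hS hhc hx
  obtain ⟨ps, zs, us⟩ := zDeriv_uDeriv_comp_snd (g := fun t => (s t : ℂ)) hS
    (ofRealCLM.contDiff.comp_contDiffOn hs) hx
  have us' : deriv (fun t => (s t : ℂ)) q.2.1 = deriv s q.2.1 :=
    (hs.differentiableAt_of_isOpen hS hq).hasDerivAt.ofReal_comp.deriv
  have uc' : deriv (fun t => conj (deriv h t)) q.2.1 = conj (deriv (deriv h) q.2.1) :=
    ((hh'.differentiableAt_of_isOpen hS hq).hasDerivAt.star).deriv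
  have pf : IsProfile (fun x : ℂ × ℝ => x.1) {y : ℂ × ℝ | y.2 ∈ S} := IsProfile.fst
  have zf : zDeriv (fun x : ℂ × ℝ => x.1) (q.1, q.2.1) = 1 :=
    (pf.hasDerivAt_z ho (x := (q.1, q.2.1)) hx).unique (hasDerivAt_id q.1)
  have uf : uDeriv (fun x : ℂ × ℝ => x.1) (q.1, q.2.1) = 0 :=
    (hasDerivAt_uDeriv (pf.differentiableAt ho (x := (q.1, q.2.1)) hx)).unique
      (hasDerivAt_const q.2.1 q.1)
  have D := fun {φ : ℂ × ℝ → ℂ} (hφ : IsProfile φ {y : ℂ × ℝ | y.2 ∈ S}) =>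
    hφ.differentiableAt ho (x := (q.1, q.2.1)) hx
  have p0 : IsProfile (fun x : ℂ × ℝ => exp (I * c) * (x.1 + h x.2)) {y : ℂ × ℝ | y.2 ∈ S} :=
    (IsProfile.const _).mul (pf.add ph)
  have d0 : ∀ i, pd i (spLift fun x : ℂ × ℝ => exp (I * c) * (x.1 + h x.2)) q
      = ![exp (I * c), 0, exp (I * c) * deriv h q.2.1, 0] i := by
    intro i
    rw [pd_lift p0 ho hq']
    simp only [spLift]
    rw [zDeriv_const_mul _ (D (pf.add ph)), uDeriv_const_mul _ (D (pf.add ph)),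
      zDeriv_add (D pf) (D ph), uDeriv_add (D pf) (D ph), zf, uf, zh, uh]
    simp
  fin_cases k
  · exact d0 i
  · change pd i (fun r => conj (spLift (fun x : ℂ × ℝ => exp (I * c) * (x.1 + h x.2)) r)) q = _
    rw [pd_conj (differentiableAt_spLift p0 ho hq'), d0]
    fin_cases i <;> simp
  · have e : (fun r => coordFn ((fun i => i) ⟨2, by decide⟩) (coordChange c a u₀ h s r))
        = spLift fun x : ℂ × ℝ => (((x.2 + u₀) / a : ℝ) : ℂ) := by
      funext r
      simp [coordFn, coordChange, spLift]
    have hg : ContDiffOn ℝ ∞ (fun t : ℝ => (((t + u₀) / a : ℝ) : ℂ)) S :=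
      ofRealCLM.contDiff.comp_contDiffOn ((contDiff_id.add contDiff_const).div_const a).contDiffOn
    obtain ⟨pg, zg, ug⟩ := zDeriv_uDeriv_comp_snd hS hg hx
    have ug' : deriv (fun t : ℝ => (((t + u₀) / a : ℝ) : ℂ)) q.2.1 = ((1 / a : ℝ) : ℂ) :=
      ((((hasDerivAt_id q.2.1).add_const u₀).div_const a).ofReal_comp).deriv
    have := pd_lift pg ho hq' i
    simp only [spLift] at this
    rw [zg, ug, ug'] at this
    refine Eq.trans (congrArg (fun φ => pd i φ q) e) (this.trans ?_)
    fin_cases i <;> simp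
  · have pm : IsProfile (fun x : ℂ × ℝ => conj (deriv h x.2) * x.1) {y : ℂ × ℝ | y.2 ∈ S} :=
      pc.mul pf
    have e : (fun r => coordFn ((fun i => i) ⟨3, by decide⟩) (coordChange c a u₀ h s r))
        = fun r => (a : ℂ) * (((r.2.2 : ℂ) + (spLift (fun x => conj (deriv h x.2) * x.1) r
          + conj (spLift (fun x => conj (deriv h x.2) * x.1) r)))
          + spLift (fun x => (s x.2 : ℂ)) r) := by
      funext r
      have := add_conj (deriv h r.2.1 * conj r.1)
      simp [coordFn, coordChange, spLift] at this ⊢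
      left
      linear_combination -this
    have Dm := differentiableAt_spLift pm ho hq'
    have Ds := differentiableAt_spLift ps ho hq'
    have Dv := (pd_v q i).2
    refine Eq.trans (congrArg (fun φ => pd i φ q) e) ?_
    rw [pd_const_mul _ ((Dv.fun_add (Dm.fun_add Dm.conj_complex)).fun_add Ds),
      pd_add (Dv.fun_add (Dm.fun_add Dm.conj_complex)) Ds, pd_add Dv (Dm.fun_add Dm.conj_complex),
      pd_add Dm Dm.conj_complex, pd_conj Dm, pd_lift pm ho hq', pd_lift pm ho hq',
      pd_lift ps ho hq', (pd_v q i).1]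
    simp only [spLift]
    rw [zDeriv_mul (D pc) (D pf), uDeriv_mul (D pc) (D pf), zc, uc, uc', zf, uf, zs, us, us']
    fin_cases i <;> simp
    left
    ring

/-- The pullback of a pp-wave metric under a form-preserving change of coordinates is a pp-wave
metric exactly when the profiles are related by this equation. -/
theorem ppMetric_pullback_iff {f f' : ℂ × ℝ → ℂ} (ha : a ≠ 0) (hS : IsOpen S)
    (hh : ContDiffOn ℝ ∞ h S) (hs : ContDiffOn ℝ ∞ s S) (hq : q.2.1 ∈ S) :
    (∀ i j : Fin 4, ppMetric f q i j =
        ∑ k, ∑ l, pd i (fun r => coordFn k (coordChange c a u₀ h s r)) q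
          * pd j (fun r => coordFn l (coordChange c a u₀ h s r)) q
          * ppMetric f' (coordChange c a u₀ h s q) k l) ↔
    f (q.1, q.2.1) + conj (f (q.1, q.2.1)) =
      (f' (exp (I * c) * (q.1 + h q.2.1), (q.2.1 + u₀) / a)
        + conj (f' (exp (I * c) * (q.1 + h q.2.1), (q.2.1 + u₀) / a))) / a ^ 2
      + 2 * (conj (deriv (deriv h) q.2.1) * q.1 + deriv (deriv h) q.2.1 * conj q.1)
      + 2 * deriv s q.2.1 - 2 * (deriv h q.2.1 * conj (deriv h q.2.1)) := by
  have ha' : (a : ℂ) ≠ 0 := by exact_mod_cast ha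
  have hE : exp (I * c) * conj (exp (I * c)) = 1 := by
    rw [← exp_conj, ← exp_add]; simp
  obtain ⟨H, hH⟩ : ∃ H, H = f' (exp (I * c) * (q.1 + h q.2.1), (q.2.1 + u₀) / a)
        + conj (f' (exp (I * c) * (q.1 + h q.2.1), (q.2.1 + u₀) / a)) := ⟨_, rfl⟩
  have hm : ppMetric f' (coordChange c a u₀ h s q) = !![0, 1, 0, 0; 1, 0, 0, 0; 0, 0, -H, -1;
      0, 0, -1, 0] := by rw [hH]; rfl
  obtain ⟨E, hEd⟩ : ∃ E, E = exp (I * c) := ⟨_, rfl⟩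
  obtain ⟨h1, hh1⟩ : ∃ h1, h1 = deriv h q.2.1 := ⟨_, rfl⟩
  simp only [pd_coordChange hS hh hs hq, hm, ← hH, Fin.sum_univ_four]
  rw [← hEd] at hE
  simp only [← hEd, ← hh1]
  constructor
  · intro hij
    -- Only the du² component carries information; the others hold identically, by |e^{ic}| = 1.
    have h22 := hij 2 2
    simp [ppMetric] at h22
    field_simp at h22 ⊢
    linear_combination -h22 - 2 * (a : ℂ) ^ 2 * h1 * conj h1 * hE
  · intro heq i j
    fin_cases i <;> fin_cases j <;> simp [ppMetric] <;>
      first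
      | done
      | (field_simp; done)
      | (field_simp; linear_combination -hE)
      | (field_simp; linear_combination hE)
      | (field_simp; linear_combination (-conj h1 * hE))
      | (field_simp; linear_combination (-h1 * hE))
      | skip
    field_simp at heq ⊢
    linear_combination -heq - 2 * (a : ℂ) ^ 2 * h1 * conj h1 * hE

end change

/-- k takes imaginary values near z, so the Cauchy–Riemann equations kill k′. This recovers f_ζ from
f + f*, which is all that the metric sees. -/
theorem deriv_eq_zero_of_add_conj_eq_zero {k : ℂ → ℂ} {z : ℂ} (hk : DifferentiableAt ℂ k z)
    (h : ∀ᶠ y in 𝓝 z, k y + conj (k y) = 0) : deriv k z = 0 := by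
  have h1 := hk.hasDerivAt.hasFDerivAt.restrictScalars ℝ
  have h2 := h1.add (conjCLE.hasFDerivAt.comp z h1)
  have h3 := h2.unique ((hasFDerivAt_const (0 : ℂ) z).congr_of_eventuallyEq h)
  have e1 := DFunLike.congr_fun h3 1
  have e2 := DFunLike.congr_fun h3 I
  simp at e1 e2
  have : I * deriv k z = 0 := by linear_combination (I * e1 + e2) / 2
  simpa using this

/-- The hypotheses of a form-preserving change of coordinates near a point. -/
theorem exists_isOpen_contDiffOn {h : ℝ → ℂ} {s : ℝ → ℝ} {t₀ : ℝ}
    (H : ∀ᶠ t in 𝓝 t₀, ContDiffAt ℝ ∞ h t ∧ ContDiffAt ℝ ∞ s t) :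
    ∃ S : Set ℝ, IsOpen S ∧ t₀ ∈ S ∧ ContDiffOn ℝ ∞ h S ∧ ContDiffOn ℝ ∞ s S := by
  obtain ⟨S, hS, ho, ht⟩ := eventually_nhds_iff.1 H
  exact ⟨S, ho, ht, fun t ht => (hS t ht).1.contDiffWithinAt,
    fun t ht => (hS t ht).2.contDiffWithinAt⟩

/-- The relation between the real parts of the profiles determines f_ζ; the next ζ-derivative
removes the linear term g and the h″ term produced by the coordinate change. No regularity of Φ or g
in u is needed, since only derivatives at fixed u are taken. -/
theorem zDeriv_zDeriv_eq_of_normalForm {f : ℂ × ℝ → ℂ} {Ω : Set (ℂ × ℝ)} (hΩ : IsOpen Ω)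
    (hf : IsProfile f Ω) {p : Spacetime} (hp : p ∈ region Ω) {c a u₀ : ℝ} {h : ℝ → ℂ} {s : ℝ → ℝ}
    {Φ : ℂ × ℝ → ℂ} {g : ℝ → ℂ} (ha : a ≠ 0)
    (hs : ∀ᶠ t in 𝓝 p.2.1, ContDiffAt ℝ ∞ h t ∧ ContDiffAt ℝ ∞ s t)
    (hΦ : ∀ᶠ y in 𝓝 ((exp (I * c) * (p.1 + h p.2.1), (p.2.1 + u₀) / a) : ℂ × ℝ),
      DifferentiableAt ℂ (fun z => Φ (z, y.2)) y.1)
    (hm : ∀ᶠ q in 𝓝 p, ∀ i j : Fin 4,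
      ppMetric f q i j =
        ∑ k, ∑ l, pd i (fun r => coordFn k (coordChange c a u₀ h s r)) q
          * pd j (fun r => coordFn l (coordChange c a u₀ h s r)) q
          * ppMetric (fun y => Φ y + g y.2 * y.1) (coordChange c a u₀ h s q) k l) :
    ∀ᶠ x in 𝓝 ((p.1, p.2.1) : ℂ × ℝ), zDeriv (zDeriv f) x = exp (I * c) ^ 2 / a ^ 2
      * deriv (deriv fun z => Φ (z, (x.2 + u₀) / a)) (exp (I * c) * (x.1 + h x.2)) := by
  obtain ⟨S, hS, hpS, hh, hsS⟩ := exists_isOpen_contDiffOn hs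
  have ha' : (a : ℂ) ≠ 0 := by exact_mod_cast ha
  have hhc : ContinuousAt h p.2.1 := (hh.contDiffAt (hS.mem_nhds hpS)).continuousAt
  have hT : ContinuousAt (fun x : ℂ × ℝ => ((exp (I * c) * (x.1 + h x.2), (x.2 + u₀) / a) : ℂ × ℝ))
      (p.1, p.2.1) := by
    refine ContinuousAt.prodMk ?_ (by fun_prop)
    exact continuousAt_const.mul (continuousAt_fst.add
      (ContinuousAt.comp (f := fun x : ℂ × ℝ => x.2) (x := (p.1, p.2.1)) hhc continuousAt_snd))
  have hi : ContinuousAt (fun x : ℂ × ℝ => ((x.1, x.2, p.2.2) : Spacetime)) (p.1, p.2.1) := by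
    fun_prop
  have hev : ∀ᶠ x in 𝓝 ((p.1, p.2.1) : ℂ × ℝ), x ∈ Ω ∧
      DifferentiableAt ℂ (fun z => Φ (z, (x.2 + u₀) / a)) (exp (I * c) * (x.1 + h x.2)) ∧
      f x + conj (f x) = ((Φ (exp (I * c) * (x.1 + h x.2), (x.2 + u₀) / a)
          + g ((x.2 + u₀) / a) * (exp (I * c) * (x.1 + h x.2)))
        + conj (Φ (exp (I * c) * (x.1 + h x.2), (x.2 + u₀) / a)
          + g ((x.2 + u₀) / a) * (exp (I * c) * (x.1 + h x.2)))) / a ^ 2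
      + 2 * (conj (deriv (deriv h) x.2) * x.1 + deriv (deriv h) x.2 * conj x.1)
      + 2 * deriv s x.2 - 2 * (deriv h x.2 * conj (deriv h x.2)) := by
    filter_upwards [hΩ.mem_nhds hp, hT.eventually hΦ, hi.eventually hm,
      (continuousAt_snd (p := ((p.1, p.2.1) : ℂ × ℝ))).eventually_mem (hS.mem_nhds hpS)]
      with x h1 h2 h3 h4
    exact ⟨h1, h2, (ppMetric_pullback_iff (q := (x.1, x.2, p.2.2)) ha hS hh hsS h4).1 h3⟩
  filter_upwards [hev.eventually_nhds] with x hx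
  have hz : ∀ᶠ z in 𝓝 x.1, ∀ᶠ z' in 𝓝 z, (z', x.2) ∈ Ω ∧ _ :=
    (((Continuous.prodMk_left x.2).continuousAt (x := x.1)).eventually hx).eventually_nhds
  have hfz : ∀ z, (z, x.2) ∈ Ω → HasDerivAt (fun z => f (z, x.2)) (zDeriv f (z, x.2)) z :=
    fun z hz => hf.hasDerivAt_z hΩ (x := (z, x.2)) hz
  have hin : ∀ z, HasDerivAt (fun z : ℂ => exp (I * c) * (z + h x.2)) (exp (I * c)) z := fun z => by
    simpa using ((hasDerivAt_id z).add_const (h x.2)).const_mul (exp (I * c))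
  obtain ⟨φ, hφ⟩ : ∃ φ : ℂ → ℂ, φ = fun z => Φ (z, (x.2 + u₀) / a) := ⟨_, rfl⟩
  have key : ∀ᶠ z in 𝓝 x.1, zDeriv f (z, x.2)
      = (deriv φ (exp (I * c) * (z + h x.2)) * exp (I * c)
        + g ((x.2 + u₀) / a) * exp (I * c)) / a ^ 2
        + 2 * conj (deriv (deriv h) x.2) := by
    filter_upwards [hz] with z hz
    obtain ⟨hzΩ, hzΦ, -⟩ := hz.self_of_nhds
    have d1 : HasDerivAt (fun z => φ (exp (I * c) * (z + h x.2)))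
        (deriv φ (exp (I * c) * (z + h x.2)) * exp (I * c)) z := by
      rw [hφ]
      exact HasDerivAt.comp (h := fun z : ℂ => exp (I * c) * (z + h x.2)) z hzΦ.hasDerivAt (hin z)
    have d2 := ((d1.add ((hin z).const_mul (g ((x.2 + u₀) / a)))).div_const ((a : ℂ) ^ 2)).add
      ((hasDerivAt_id z).const_mul (2 * conj (deriv (deriv h) x.2)))
    have d3 := (hfz z hzΩ).sub (d2.add_const
      ((deriv s x.2 : ℝ) - deriv h x.2 * conj (deriv h x.2) : ℂ))
    have d4 := deriv_eq_zero_of_add_conj_eq_zero d3.differentiableAt (by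
      filter_upwards [hz] with z' hz'
      have h3 := hz'.2.2
      simp only [Pi.sub_apply, Pi.add_apply, id, hφ, map_sub, map_add, map_mul, map_div₀, map_pow,
        conj_ofReal, conj_conj, map_ofNat] at h3 ⊢
      linear_combination h3)
    rw [d3.deriv] at d4
    linear_combination d4
  have hzx : (x.1, x.2) ∈ Ω := hx.self_of_nhds.1
  have e1 := ((hf.zDeriv hΩ).hasDerivAt_z hΩ (x := x) hzx).congr_of_eventuallyEq
    (Filter.EventuallyEq.symm key)
  -- A second derivative of Φ requires holomorphy on a neighbourhood of the image point, obtained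
  -- through the inverse affine map.
  have hd : ∀ᶠ y in 𝓝 (exp (I * c) * (x.1 + h x.2)), DifferentiableAt ℂ φ y := by
    have hc : ContinuousAt (fun y : ℂ => ((exp (-(I * c)) * y - h x.2 : ℂ), x.2))
        (exp (I * c) * (x.1 + h x.2)) := by fun_prop
    have hval : exp (-(I * c)) * (exp (I * c) * (x.1 + h x.2)) - h x.2 = x.1 := by
      rw [← mul_assoc, ← exp_add]; simp
    have ht := hc.tendsto
    simp only [hval] at ht
    filter_upwards [ht.eventually hx] with y hy
    have h2 := hy.2.1
    have : exp (I * c) * (exp (-(I * c)) * y - h x.2 + h x.2) = y := by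
      rw [sub_add_cancel, ← mul_assoc, ← exp_add]; simp
    simp only [this] at h2
    rw [hφ]; exact h2
  have hdd : DifferentiableAt ℂ (deriv φ) (exp (I * c) * (x.1 + h x.2)) :=
    (analyticAt_iff_eventually_differentiableAt.2 hd).deriv.differentiableAt
  have d1 := HasDerivAt.comp (h := fun z : ℂ => exp (I * c) * (z + h x.2)) x.1 hdd.hasDerivAt
    (hin x.1)
  have d2 := (((d1.mul_const (exp (I * c))).add_const
    (g ((x.2 + u₀) / a) * exp (I * c))).div_const ((a : ℂ) ^ 2)).add_const
      (2 * conj (deriv (deriv h) x.2))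
  rw [e1.unique d2, hφ]
  ring

/-- Two profiles on a box with the same second `ζ`-derivative differ by an affine function. -/
theorem eq_add_affine_of_zDeriv_zDeriv_eq {φ ψ : ℂ × ℝ → ℂ} {x₀ : ℂ × ℝ} {r : ℝ}
    (hφ : IsProfile φ (Metric.ball x₀ r)) (hψ : IsProfile ψ (Metric.ball x₀ r))
    (h : ∀ x ∈ Metric.ball x₀ r, zDeriv (zDeriv φ) x = zDeriv (zDeriv ψ) x) :
    ∃ g₀ g₁ : ℝ → ℂ, ContDiffOn ℝ ∞ g₀ (Metric.ball x₀.2 r) ∧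
      ContDiffOn ℝ ∞ g₁ (Metric.ball x₀.2 r) ∧
      ∀ x ∈ Metric.ball x₀ r, φ x = ψ x + g₀ x.2 + g₁ x.2 * x.1 := by
  have ho : IsOpen (Metric.ball x₀ r) := Metric.isOpen_ball
  -- Balls for the sup distance are products, so the slices at fixed u are discs and ζ-integration
  -- stays inside.
  have hm : ∀ x : ℂ × ℝ, x ∈ Metric.ball x₀ r ↔
      x.1 ∈ Metric.ball x₀.1 r ∧ x.2 ∈ Metric.ball x₀.2 r :=
    fun x => by simp [Prod.dist_eq]
  have hd := hφ.sub hψ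
  have hdz := hd.zDeriv ho
  have dz : ∀ x ∈ Metric.ball x₀ r, zDeriv (fun x => φ x - ψ x) x = zDeriv φ x - zDeriv ψ x :=
    fun x hx => zDeriv_sub (hφ.differentiableAt ho hx) (hψ.differentiableAt ho hx)
  have dzz : ∀ x ∈ Metric.ball x₀ r, zDeriv (zDeriv fun x => φ x - ψ x) x = 0 := fun x hx => by
    rw [zDeriv_congr (Filter.eventually_of_mem (ho.mem_nhds hx) dz),
      zDeriv_sub ((hφ.zDeriv ho).differentiableAt ho hx) ((hψ.zDeriv ho).differentiableAt ho hx),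
      h x hx, sub_self]
  have slice : ∀ {χ : ℂ × ℝ → ℂ}, IsProfile χ (Metric.ball x₀ r) →
      ContDiffOn ℝ ∞ (fun t => χ (x₀.1, t)) (Metric.ball x₀.2 r) := fun hχ =>
    hχ.1.comp (f := fun t : ℝ => (x₀.1, t)) (by fun_prop) fun t ht => (hm _).2
      ⟨Metric.mem_ball_self (lt_of_le_of_lt dist_nonneg (Metric.mem_ball.1 ht)), ht⟩
  have hconst : ∀ {k k' : ℂ → ℂ}, (∀ z ∈ Metric.ball x₀.1 r, HasDerivAt k (k' z) z) →
      (∀ z ∈ Metric.ball x₀.1 r, k' z = 0) → ∀ z ∈ Metric.ball x₀.1 r, k z = k x₀.1 := by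
    intro k k' hk h0 z hz
    refine (convex_ball x₀.1 r).is_const_of_fderivWithin_eq_zero (𝕜 := ℂ)
      (fun y hy => (hk y hy).differentiableAt.differentiableWithinAt) (fun y hy => ?_) hz
      (Metric.mem_ball_self (lt_of_le_of_lt dist_nonneg (Metric.mem_ball.1 hz)))
    rw [fderivWithin_of_isOpen Metric.isOpen_ball hy]
    have := (hk y hy).hasFDerivAt.fderiv
    rw [this, h0 y hy]
    ext
    simp
  have first : ∀ x ∈ Metric.ball x₀ r, zDeriv (fun x => φ x - ψ x) x
      = zDeriv (fun x => φ x - ψ x) (x₀.1, x.2) := by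
    intro x hx
    obtain ⟨h1, h2⟩ := (hm x).1 hx
    exact hconst (k := fun z => zDeriv (fun x => φ x - ψ x) (z, x.2)) (k' := fun z =>
      zDeriv (zDeriv fun x => φ x - ψ x) (z, x.2))
      (fun z hz => hdz.hasDerivAt_z ho (x := (z, x.2)) ((hm _).2 ⟨hz, h2⟩))
      (fun z hz => dzz (z, x.2) ((hm _).2 ⟨hz, h2⟩)) x.1 h1
  refine ⟨fun t => (φ (x₀.1, t) - ψ (x₀.1, t)) - zDeriv (fun x => φ x - ψ x) (x₀.1, t) * x₀.1,
    fun t => zDeriv (fun x => φ x - ψ x) (x₀.1, t),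
    (slice hd).sub ((slice hdz).mul contDiffOn_const), slice hdz, fun x hx => ?_⟩
  obtain ⟨h1, h2⟩ := (hm x).1 hx
  have := hconst (k := fun z => (φ (z, x.2) - ψ (z, x.2))
    - zDeriv (fun x => φ x - ψ x) (x₀.1, x.2) * z)
    (k' := fun z => zDeriv (fun x => φ x - ψ x) (z, x.2)
      - zDeriv (fun x => φ x - ψ x) (x₀.1, x.2) * 1)
    (fun z hz => (hd.hasDerivAt_z ho (x := (z, x.2)) ((hm _).2 ⟨hz, h2⟩)).sub
      ((hasDerivAt_id z).const_mul _))
    (fun z hz => by rw [first (z, x.2) ((hm _).2 ⟨hz, h2⟩)]; simp) x.1 h1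
  simp only [Prod.mk.eta] at this ⊢
  linear_combination this

/-- A profile has, near a point, a normal form with principal part `Φ` as soon as the second
`ζ`-derivatives agree. -/
theorem exists_normalForm {f : ℂ × ℝ → ℂ} {p : Spacetime} {c a u₀ : ℝ} {h : ℝ → ℂ}
    {Φ : ℂ × ℝ → ℂ} (ha : a ≠ 0) {Ω' : Set (ℂ × ℝ)} (hΩ' : IsOpen Ω')
    (hp : (p.1, p.2.1) ∈ Ω') (hf : IsProfile f Ω')
    (hh : ∀ᶠ t in 𝓝 p.2.1, ContDiffAt ℝ ∞ h t)
    (hΦ : IsProfile (fun x : ℂ × ℝ =>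
      Φ (exp (I * c) * (x.1 + h x.2), (x.2 + u₀) / a) / (a : ℂ) ^ 2) Ω')
    (heq : ∀ x ∈ Ω', zDeriv (zDeriv f) x = zDeriv (zDeriv fun x : ℂ × ℝ =>
      Φ (exp (I * c) * (x.1 + h x.2), (x.2 + u₀) / a) / (a : ℂ) ^ 2) x) :
    ∃ (s : ℝ → ℝ) (g : ℝ → ℂ), (∀ᶠ t in 𝓝 p.2.1, ContDiffAt ℝ ∞ h t ∧ ContDiffAt ℝ ∞ s t) ∧
      ∀ᶠ q in 𝓝 p, ∀ i j : Fin 4,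
      ppMetric f q i j =
        ∑ k, ∑ l, pd i (fun r => coordFn k (coordChange c a u₀ h s r)) q
          * pd j (fun r => coordFn l (coordChange c a u₀ h s r)) q
          * ppMetric (fun y => Φ y + g y.2 * y.1) (coordChange c a u₀ h s q) k l := by
  have ha' : (a : ℂ) ≠ 0 := by exact_mod_cast ha
  obtain ⟨S, hS, hSo, hpS⟩ := eventually_nhds_iff.1 hh
  obtain ⟨r₁, hr₁, hb₁⟩ := Metric.isOpen_iff.1 hΩ' _ hp
  obtain ⟨r₂, hr₂, hb₂⟩ := Metric.isOpen_iff.1 hSo _ hpS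
  obtain ⟨r, hr⟩ : ∃ r, r = min r₁ r₂ := ⟨_, rfl⟩
  have hr0 : 0 < r := hr ▸ lt_min hr₁ hr₂
  have hbΩ : Metric.ball ((p.1, p.2.1) : ℂ × ℝ) r ⊆ Ω' :=
    (Metric.ball_subset_ball (hr ▸ min_le_left _ _)).trans hb₁
  have hbS : Metric.ball p.2.1 r ⊆ S :=
    (Metric.ball_subset_ball (hr ▸ min_le_right _ _)).trans hb₂
  have hhS : ContDiffOn ℝ ∞ h (Metric.ball p.2.1 r) := fun t ht =>
    (hS t (hbS ht)).contDiffWithinAt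
  have hB : IsOpen (Metric.ball p.2.1 r) := Metric.isOpen_ball
  obtain ⟨g₀, g₁, sg₀, sg₁, hfg⟩ := eq_add_affine_of_zDeriv_zDeriv_eq (hf.mono hbΩ) (hΦ.mono hbΩ)
    fun x hx => heq x (hbΩ hx)
  have sh' : ContDiffOn ℝ ∞ (deriv h) (Metric.ball p.2.1 r) := hhS.deriv_of_isOpen hB (by simp)
  have sh'' : ContDiffOn ℝ ∞ (deriv (deriv h)) (Metric.ball p.2.1 r) :=
    sh'.deriv_of_isOpen hB (by simp)
  -- This is s′. With f = Φ/a² + g₀ + g₁ζ, the new linear term must be (g₁ − 2(h″)*)(ζ + h); the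
  -- ζ-free remainder g₀ − (g₁ − 2(h″)*)h matters only through its real part, which s′ − |h′|²
  -- absorbs.
  have sσ : ContDiffOn ℝ ∞ (fun t => (g₀ t - (g₁ t - 2 * conj (deriv (deriv h) t)) * h t
      + deriv h t * conj (deriv h t)).re) (Metric.ball p.2.1 r) :=
    reCLM.contDiff.comp_contDiffOn ((sg₀.sub ((sg₁.sub (contDiffOn_const.mul
      sh''.conj_complex)).mul hhS)).add (sh'.mul sh'.conj_complex))
  obtain ⟨s, hs, hsd⟩ := exists_primitive sσ
  -- at − u₀ is the old u at new u equal to t; a² and e^{−ic} undo the scaling of du² and the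
  -- rotation of ζ.
  refine ⟨s, fun t => a ^ 2 * (g₁ (a * t - u₀) - 2 * conj (deriv (deriv h) (a * t - u₀)))
    * exp (-(I * c)), ?_, ?_⟩
  · filter_upwards [hB.mem_nhds (Metric.mem_ball_self hr0)] with t ht
    exact ⟨hhS.contDiffAt (hB.mem_nhds ht), hs.contDiffAt (hB.mem_nhds ht)⟩
  · have hc : ContinuousAt (fun q : Spacetime => ((q.1, q.2.1) : ℂ × ℝ)) p := by fun_prop
    filter_upwards [hc.eventually_mem (Metric.ball_mem_nhds ((p.1, p.2.1) : ℂ × ℝ) hr0)] with q hq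
    have hq2 : q.2.1 ∈ Metric.ball p.2.1 r := by
      have := hq
      simp [Prod.dist_eq] at this
      exact this.2
    refine (ppMetric_pullback_iff ha hB hhS hs hq2).2 ?_
    have h1 := hfg _ hq
    have hu : a * ((q.2.1 + u₀) / a) - u₀ = q.2.1 := by field_simp; ring
    have hE : exp (-(I * c)) * exp (I * c) = 1 := by rw [← exp_add]; simp
    simp only [hu, (hsd _ hq2).deriv, h1]
    have hre := add_conj (g₀ q.2.1 - (g₁ q.2.1 - 2 * conj (deriv (deriv h) q.2.1)) * h q.2.1
      + deriv h q.2.1 * conj (deriv h q.2.1))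
    push_cast at hre
    have hE1 : ∀ y z : ℂ, (a : ℂ) ^ 2 * y * exp (-(I * c)) * (exp (I * c) * z) = a ^ 2 * (y * z) :=
      fun y z => by linear_combination (a : ℂ) ^ 2 * y * z * hE
    rw [hE1, ← hre]
    simp only [map_add, map_sub, map_mul, map_div₀, map_pow, conj_ofReal, conj_conj, map_ofNat]
    field_simp
    ring

/-! ## From normal forms to the precursor equation -/

namespace ReducesTo

variable {f : ℂ × ℝ → ℂ} {Ω : Set (ℂ × ℝ)} {e : Fin 4 → Spacetime → CVec} {Q : ℂ × ℝ → ℂ}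

/-- On the curve t ↦ E(t)y − h(t) the argument of G stays equal to y, so (UEQ)² is constant there.
As (UE)′ = PE, differentiation gives βU = wP + iP₂(ζ + h) − Uh′, whose ζ-derivative is the precursor
equation. Squaring makes the sign of Q irrelevant. -/
theorem precursorEq_of_sq_eq (R : ReducesTo f Ω e Q) {x₀ : ℂ × ℝ} {P : ℂ} {m : ℝ}
    {E E' h : ℝ → ℂ} {G : ℂ → ℂ}
    (hE : ∀ᶠ t in 𝓝 x₀.2, P.re * t + m ≠ 0 ∧ E t ≠ 0 ∧ HasDerivAt E (E' t) t ∧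
      (P.re * t + m) * E' t = I * P.im * E t ∧ DifferentiableAt ℝ h t)
    (hx : x₀ ∈ Ω)
    (hG : ∀ᶠ x in 𝓝 x₀, ((P.re * x.2 + m) * E x.2) ^ 2 * Q x ^ 2 = G ((x.1 + h x.2) / E x.2)) :
    ∀ᶠ x in 𝓝 x₀, PrecursorEq Q P m x := by
  have hΩ := R.isOpen
  have hev : ∀ᶠ x in 𝓝 x₀, levelVelocity Q x * (P.re * x.2 + m) = invLogDeriv Q x * P
      + I * P.im * (x.1 + h x.2) - (P.re * x.2 + m) * deriv h x.2 := by
    filter_upwards [hG.eventually_nhds, hΩ.mem_nhds hx, continuousAt_snd.eventually hE]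
      with x hGx hxΩ ⟨hU, hE0, hEd, hEE, hh⟩
    have hU' : (P.re : ℂ) * x.2 + m ≠ 0 := by exact_mod_cast hU
    obtain ⟨y, hy⟩ : ∃ y, y = (x.1 + h x.2) / E x.2 := ⟨_, rfl⟩
    have hyE : E x.2 * y = x.1 + h x.2 := by rw [hy]; field_simp
    have hz : HasDerivAt (fun t => E t * y - h t) (E' x.2 * y - deriv h x.2) x.2 :=
      (hEd.mul_const y).sub hh.hasDerivAt
    have hzx : ((E x.2 * y - h x.2, x.2) : ℂ × ℝ) = x := by rw [hyE]; ext <;> simp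
    have hQ := R.profile.hasDerivAt_curve hΩ hz (by rw [hzx]; exact hxΩ)
    have hUd : HasDerivAt (fun t : ℝ => (P.re : ℂ) * t + m) (P.re * 1 : ℂ) x.2 :=
      ((ofRealCLM.hasDerivAt (x := x.2)).const_mul (P.re : ℂ)).add_const _
    have hd := ((hUd.mul hEd).mul hQ).pow 2
    have hc : ContinuousAt (fun t : ℝ => ((E t * y - h t, t) : ℂ × ℝ)) x.2 :=
      hz.continuousAt.prodMk continuousAt_id
    have ht := hc.tendsto
    simp only [hzx] at ht
    have hconst : (fun t : ℝ => (((P.re : ℂ) * t + m) * E t * Q (E t * y - h t, t)) ^ 2)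
        =ᶠ[𝓝 x.2] fun _ => G y := by
      filter_upwards [ht.eventually hGx, hEd.continuousAt.eventually_ne hE0] with t h1 h2
      rw [mul_pow, h1]
      congr 1
      field_simp
      ring
    have h0 := hd.unique ((hasDerivAt_const x.2 (G y)).congr_of_eventuallyEq hconst)
    simp only [Pi.mul_apply, hzx] at h0
    have hQ0 := R.ne_zero x hxΩ
    have hQz := R.zDeriv_ne_zero x hxΩ
    -- The factor 2UEQ from the square is nonzero and is divided out.
    have h1 : ((P.re : ℂ) * 1 * E x.2 + ((P.re : ℂ) * x.2 + m) * E' x.2) * Q x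
        + ((P.re : ℂ) * x.2 + m) * E x.2 * ((E' x.2 * y - deriv h x.2) * zDeriv Q x
          + uDeriv Q x) = 0 := by
      have h2 : (2 : ℂ) * (((P.re : ℂ) * x.2 + m) * E x.2 * Q x) ≠ 0 :=
        mul_ne_zero two_ne_zero (mul_ne_zero (mul_ne_zero hU' hE0) hQ0)
      refine (mul_eq_zero.1 ?_).resolve_left h2
      simpa using h0
    have c := re_add_im P
    have h3 : P * Q x + (I * P.im * (x.1 + h x.2) - ((P.re : ℂ) * x.2 + m) * deriv h x.2)
        * zDeriv Q x + ((P.re : ℂ) * x.2 + m) * uDeriv Q x = 0 := by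
      refine mul_left_cancel₀ hE0 ?_
      rw [← hyE]
      linear_combination h1 - (Q x + E x.2 * y * zDeriv Q x) * hEE - E x.2 * Q x * c
    simp only [levelVelocity, invLogDeriv]
    field_simp
    linear_combination -h3
  filter_upwards [hev.eventually_nhds, hΩ.mem_nhds hx] with x h1 hxΩ
  have h2 := ((Continuous.prodMk_left x.2).continuousAt (x := x.1)).eventually h1
  have d1 := (R.isProfile_velocity.hasDerivAt_z hΩ hxΩ).mul_const ((P.re : ℂ) * x.2 + m)
  have d2 := (((R.isProfile_invLogDeriv.hasDerivAt_z hΩ hxΩ).mul_const P).add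
    (((hasDerivAt_id x.1).add_const (h x.2)).const_mul (I * P.im))).sub_const
      (((P.re : ℂ) * x.2 + m) * deriv h x.2)
  have := d1.unique (d2.congr_of_eventuallyEq h2)
  unfold PrecursorEq
  linear_combination this

theorem exp_mul_exp_neg (c : ℝ) : exp (I * c) * exp (-(I * c)) = 1 := by
  rw [← exp_add]; simp

theorem tendsto_change {c a u₀ : ℝ} {h : ℝ → ℂ} {x₀ : ℂ × ℝ} (hh : ContinuousAt h x₀.2) :
    Filter.Tendsto (fun x : ℂ × ℝ => ((exp (I * c) * (x.1 + h x.2), (x.2 + u₀) / a) : ℂ × ℝ))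
      (𝓝 x₀) (𝓝 (exp (I * c) * (x₀.1 + h x₀.2), (x₀.2 + u₀) / a)) := by
  refine ContinuousAt.prodMk ?_ (by fun_prop)
  exact continuousAt_const.mul (continuousAt_fst.add
    (ContinuousAt.comp (f := fun x : ℂ × ℝ => x.2) (x := x₀) hh continuousAt_snd))

theorem precursorEq_of_formA (R : ReducesTo f Ω e Q)
    (H : HasNormalForm f (region Ω) FormA) {p : Spacetime} (hp : p ∈ region Ω) :
    ∃ m : ℝ, m ≠ 0 ∧ ∀ᶠ x in 𝓝 (p.1, p.2.1), PrecursorEq Q 0 m x := by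
  obtain ⟨c, a, u₀, h, s, f', ha, hs, ⟨F, g, hF, hf'⟩, hm⟩ := H p hp
  obtain rfl : f' = fun y => F y.1 + g y.2 * y.1 := funext hf'
  have ha' : (a : ℂ) ≠ 0 := by exact_mod_cast ha
  refine ⟨a, ha, ?_⟩
  have hff := zDeriv_zDeriv_eq_of_normalForm (Φ := fun y => F y.1) R.isOpen R.profile_f hp ha hs
    (continuousAt_fst.eventually hF.eventually_analyticAt |>.mono
      fun y hy => hy.differentiableAt) hm
  refine R.precursorEq_of_sq_eq (E := fun _ => exp (-(I * c))) (E' := fun _ => 0) (h := h)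
    (G := fun y => deriv (deriv F) y / 2) ?_ hp ?_
  · filter_upwards [hs] with t ht
    exact ⟨by simpa using ha, exp_ne_zero _, hasDerivAt_const _ _, by simp,
      ht.1.differentiableAt (by simp)⟩
  · filter_upwards [hff, R.isOpen.mem_nhds hp] with x hx hxΩ
    have hE := exp_mul_exp_neg c
    have : (x.1 + h x.2) / exp (-(I * c)) = exp (I * c) * (x.1 + h x.2) := by
      rw [div_eq_iff (exp_ne_zero _)]
      linear_combination -(x.1 + h x.2) * hE
    rw [R.sq x hxΩ, hx, this]
    simp only [zero_re, ofReal_zero, zero_mul, zero_add]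
    field_simp
    linear_combination (deriv (deriv F) (exp (I * c) * (x.1 + h x.2)))
      * (exp (I * c) * exp (-(I * c)) + 1) * hE

theorem deriv_deriv_comp_mul_left (F : ℂ → ℂ) (k z : ℂ) :
    deriv (deriv fun z => F (k * z)) z = k ^ 2 * deriv (deriv F) (k * z) := by
  have h1 : (deriv fun z => F (k * z)) = fun z => k * deriv F (k * z) := by
    funext z
    simpa using deriv_comp_mul_left k F z
  rw [h1, deriv_const_mul_field, deriv_comp_mul_left k (deriv F) z, smul_eq_mul]
  ring

/-- In the old coordinates the form is F((ζ + h)/E), up to affine terms, with E = e^{−i(u + u₀)/a −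
ic}; it solves aE′ = −iE, whence U = a and P = −i. -/
theorem precursorEq_of_formC (R : ReducesTo f Ω e Q)
    (H : HasNormalForm f (region Ω) FormC) {p : Spacetime} (hp : p ∈ region Ω) :
    ∃ m : ℝ, ∀ᶠ x in 𝓝 (p.1, p.2.1), PrecursorEq Q (-I) m x := by
  obtain ⟨c, a, u₀, h, s, f', ha, hs, ⟨F, g, hF, hf'⟩, hm⟩ := H p hp
  obtain rfl : f' = fun y => F (exp (I * y.2) * y.1) + g y.2 * y.1 := funext hf'
  have ha' : (a : ℂ) ≠ 0 := by exact_mod_cast ha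
  refine ⟨a, ?_⟩
  have hcont : ContinuousAt (fun y : ℂ × ℝ => exp (I * y.2) * y.1)
      ((coordChange c a u₀ h s p).1, (coordChange c a u₀ h s p).2.1) := by fun_prop
  have hff := zDeriv_zDeriv_eq_of_normalForm (Φ := fun y => F (exp (I * y.2) * y.1))
    R.isOpen R.profile_f hp ha hs (by
      filter_upwards [hcont.eventually hF.eventually_analyticAt] with y hy
      exact hy.differentiableAt.comp y.1 (by fun_prop : DifferentiableAt ℂ
        (fun z => exp (I * y.2) * z) y.1)) hm
  refine R.precursorEq_of_sq_eq (E := fun t => exp (-(I * ((t + u₀) / a)) - I * c))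
    (E' := fun t => exp (-(I * ((t + u₀) / a)) - I * c) * (-(I * (1 / a)))) (h := h)
    (G := fun y => deriv (deriv F) y / 2) ?_ hp ?_
  · filter_upwards [hs] with t ht
    refine ⟨by simpa using ha, exp_ne_zero _, ?_, ?_, ht.1.differentiableAt (by simp)⟩
    · have h1 : HasDerivAt (fun t : ℝ => (t : ℂ)) 1 t := ofRealCLM.hasDerivAt
      exact (((((h1.add_const (u₀ : ℂ)).div_const (a : ℂ)).const_mul I).neg).sub_const
        (I * c)).cexp
    · simp
      field_simp
  · filter_upwards [hff, R.isOpen.mem_nhds hp] with x hx hxΩ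
    have hE : exp (-(I * ((x.2 + u₀) / a)) - I * c) * (exp (I * ((x.2 + u₀) / a)) * exp (I * c))
        = 1 := by
      rw [← exp_add, ← exp_add, ← exp_zero]; ring_nf
    obtain ⟨κ, hκ⟩ : ∃ κ, κ = exp (I * ((x.2 + u₀) / a)) := ⟨_, rfl⟩
    obtain ⟨E, hEd⟩ : ∃ E, E = exp (-(I * ((x.2 + u₀) / a)) - I * c) := ⟨_, rfl⟩
    have hκ' : exp (I * ((x.2 + u₀) / a : ℝ)) = κ := by rw [hκ]; push_cast; rfl
    rw [← hκ, ← hEd] at hE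
    have hE0 : E ≠ 0 := left_ne_zero_of_mul_eq_one hE
    have : (x.1 + h x.2) / E = κ * (exp (I * c) * (x.1 + h x.2)) := by
      rw [div_eq_iff hE0]
      linear_combination -(x.1 + h x.2) * hE
    rw [R.sq x hxΩ, hx, deriv_deriv_comp_mul_left]
    simp only [← hEd, this, hκ', neg_re, I_re, neg_zero, ofReal_zero, zero_mul, zero_add]
    generalize deriv (deriv F) (κ * (exp (I * c) * (x.1 + h x.2))) = D
    field_simp
    linear_combination D * (E * (κ * exp (I * c)) + 1) * hE

/-- Here E = ((u + u₀)/a)^{ik} e^{−ic} and U = u + u₀, so UE′ = ikE and P = 1 + ik. The factor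
û^{−2} combines with a^{−2} to give U^{−2}. -/
theorem precursorEq_of_formB (R : ReducesTo f Ω e Q) {k : ℝ}
    (H : HasNormalForm f (region Ω) (FormB k)) {p : Spacetime} (hp : p ∈ region Ω) :
    ∃ m : ℝ, ∀ᶠ x in 𝓝 (p.1, p.2.1), PrecursorEq Q (1 + I * k) m x := by
  obtain ⟨c, a, u₀, h, s, f', ha, hs, ⟨hpos, F, g, hF, hf'⟩, hm⟩ := H p hp
  obtain rfl : f' = fun y => F ((y.2 : ℂ) ^ (-(I * k)) * y.1) / (y.2 : ℂ) ^ 2 + g y.2 * y.1 :=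
    funext hf'
  have ha' : (a : ℂ) ≠ 0 := by exact_mod_cast ha
  have hpos' : 0 < (p.2.1 + u₀) / a := hpos
  have hevpos : ∀ᶠ t in 𝓝 p.2.1, 0 < (t + u₀) / a :=
    (by fun_prop : ContinuousAt (fun t : ℝ => (t + u₀) / a) p.2.1).eventually_const_lt hpos'
  refine ⟨u₀, ?_⟩
  have hcont : ContinuousAt (fun y : ℂ × ℝ => (y.2 : ℂ) ^ (-(I * k)) * y.1)
      ((coordChange c a u₀ h s p).1, (coordChange c a u₀ h s p).2.1) := by
    refine ContinuousAt.mul (ContinuousAt.cpow (by fun_prop) continuousAt_const ?_) continuousAt_fst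
    exact ofReal_mem_slitPlane.2 hpos
  have hff := zDeriv_zDeriv_eq_of_normalForm
    (Φ := fun y => F ((y.2 : ℂ) ^ (-(I * k)) * y.1) / (y.2 : ℂ) ^ 2)
    R.isOpen R.profile_f hp ha hs (by
      filter_upwards [hcont.eventually hF.eventually_analyticAt] with y hy
      exact (hy.differentiableAt.comp y.1 (by fun_prop : DifferentiableAt ℂ
        (fun z => (y.2 : ℂ) ^ (-(I * k)) * z) y.1)).div_const _) hm
  have hre : (1 + I * (k : ℂ)).re = 1 := by simp
  have him : (1 + I * (k : ℂ)).im = k := by simp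
  refine R.precursorEq_of_sq_eq
    (E := fun t => (((t + u₀) / a : ℝ) : ℂ) ^ (I * k) * exp (-(I * c)))
    (E' := fun t => (I * k) * (((t + u₀) / a : ℝ) : ℂ) ^ (I * k - 1) * ((1 / a : ℝ) : ℂ)
      * exp (-(I * c))) (h := h)
    (G := fun y => deriv (deriv F) y / 2) ?_ hp ?_
  · filter_upwards [hs, hevpos] with t ht htp
    have hne : (((t + u₀) / a : ℝ) : ℂ) ≠ 0 := by exact_mod_cast htp.ne'
    have hU0 : t + u₀ ≠ 0 := fun h0 => by rw [h0] at htp; simp at htp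
    rw [hre, him]
    refine ⟨by simpa using hU0, ?_, ?_, ?_, ht.1.differentiableAt (by simp)⟩
    · simp only [ne_eq, mul_eq_zero, exp_ne_zero, or_false, cpow_eq_zero_iff, hne, false_and,
        not_false_eq_true]
    · have h1 : HasDerivAt (fun t : ℝ => (((t + u₀) / a : ℝ) : ℂ)) ((1 / a : ℝ) : ℂ) t :=
        (((hasDerivAt_id t).add_const u₀).div_const a).ofReal_comp
      have h2 := (hasDerivAt_id ((((t + u₀) / a : ℝ) : ℂ))).cpow_const (c := I * k)
        (ofReal_mem_slitPlane.2 htp)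
      have h3 := HasDerivAt.comp t h2 h1
      simpa using h3.mul_const (exp (-(I * c)))
    · rw [cpow_sub _ _ hne, cpow_one]
      have hU0' : (t : ℂ) + u₀ ≠ 0 := by exact_mod_cast hU0
      push_cast
      field_simp
  · have hev2 : ∀ᶠ x in 𝓝 ((p.1, p.2.1) : ℂ × ℝ), 0 < (x.2 + u₀) / a :=
      (continuousAt_snd (p := ((p.1, p.2.1) : ℂ × ℝ))).eventually hevpos
    filter_upwards [hff, R.isOpen.mem_nhds hp, hev2] with x hx hxΩ htp
    have hne : (((x.2 + u₀) / a : ℝ) : ℂ) ≠ 0 := by exact_mod_cast htp.ne'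
    have hE : (((x.2 + u₀) / a : ℝ) : ℂ) ^ (I * k) * exp (-(I * c))
        * ((((x.2 + u₀) / a : ℝ) : ℂ) ^ (-(I * k)) * exp (I * c)) = 1 := by
      have := exp_mul_exp_neg c
      have h2 : (((x.2 + u₀) / a : ℝ) : ℂ) ^ (I * k) * (((x.2 + u₀) / a : ℝ) : ℂ) ^ (-(I * k))
          = 1 := by rw [← cpow_add _ _ hne]; simp
      linear_combination exp (I * c) * exp (-(I * c)) * h2 + this
    obtain ⟨T, hT⟩ : ∃ T : ℂ, T = (((x.2 + u₀) / a : ℝ) : ℂ) := ⟨_, rfl⟩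
    obtain ⟨E, hEd⟩ : ∃ E, E = (((x.2 + u₀) / a : ℝ) : ℂ) ^ (I * k) * exp (-(I * c)) := ⟨_, rfl⟩
    obtain ⟨l, hl⟩ : ∃ l, l = (((x.2 + u₀) / a : ℝ) : ℂ) ^ (-(I * k)) := ⟨_, rfl⟩
    have hTU : (x.2 : ℂ) + u₀ = a * T := by rw [hT]; push_cast; field_simp
    rw [← hEd, ← hl] at hE
    rw [← hT] at hne
    have hE0 : E ≠ 0 := left_ne_zero_of_mul_eq_one hE
    have : (x.1 + h x.2) / E = l * (exp (I * c) * (x.1 + h x.2)) := by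
      rw [div_eq_iff hE0]
      linear_combination -(x.1 + h x.2) * hE
    have hdd : ∀ z, deriv (deriv fun z => F (l * z) / T ^ 2) z
        = l ^ 2 * deriv (deriv F) (l * z) / T ^ 2 := by
      intro z
      have h1 : (deriv fun z => F (l * z) / T ^ 2)
          = fun z => (deriv fun z => F (l * z)) z / T ^ 2 :=
        funext fun z => deriv_div_const _
      rw [h1, deriv_div_const, deriv_deriv_comp_mul_left]
    rw [R.sq x hxΩ, hx]
    rw [← hT] at hEd hl
    simp only [← hT, hre, ofReal_one, one_mul, hTU]
    simp only [← hEd, ← hl, this, hdd]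
    generalize deriv (deriv F) (l * (exp (I * c) * (x.1 + h x.2))) = D
    field_simp
    linear_combination D * (E * (l * exp (I * c)) + 1) * hE

/-- Flow curves parametrized by u are unavailable, as U = 0 in this class. Instead Q²(ζ + h)² is
free of ζ, which gives w = −(ζ + h), so w_ζ = −1. -/
theorem invA_eq_one_of_formL (R : ReducesTo f Ω e Q)
    (H : HasNormalForm f (region Ω) FormL) {p : Spacetime} (hp : p ∈ region Ω) :
    invA f e p = 1 := by
  obtain ⟨c, a, u₀, h, s, f', ha, hs, ⟨hslit, g₁, g, hf'⟩, hm⟩ := H p hp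
  obtain rfl : f' = fun y => g₁ y.2 * log y.1 + g y.2 * y.1 := funext hf'
  have ha' : (a : ℂ) ≠ 0 := by exact_mod_cast ha
  have hΩ := R.isOpen
  have hslit' : exp (I * c) * (p.1 + h p.2.1) ∈ slitPlane := hslit
  have hff := zDeriv_zDeriv_eq_of_normalForm (Φ := fun y => g₁ y.2 * log y.1) hΩ R.profile_f
    hp ha hs (by
      have h1 := (continuousAt_fst (p := ((exp (I * c) * (p.1 + h p.2.1), (p.2.1 + u₀) / a)
        : ℂ × ℝ))).eventually_mem (isOpen_slitPlane.mem_nhds hslit')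
      filter_upwards [h1] with y hy
      exact (differentiableAt_log hy).const_mul _) hm
  have hT := tendsto_change (c := c) (a := a) (u₀ := u₀) (x₀ := (p.1, p.2.1)) (h := h)
    (hs.self_of_nhds.1.continuousAt)
  have hfst := (continuousAt_fst.tendsto.comp hT).eventually_mem (isOpen_slitPlane.mem_nhds hslit')
  have hev : ∀ᶠ x in 𝓝 ((p.1, p.2.1) : ℂ × ℝ),
      x ∈ Ω ∧ x.1 + h x.2 ≠ 0 ∧ Q x ^ 2 * (x.1 + h x.2) ^ 2
        = -g₁ ((x.2 + u₀) / a) / (2 * a ^ 2) := by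
    filter_upwards [hff, hfst, hΩ.mem_nhds hp] with x hx hsl hxΩ
    have hsl' : exp (I * c) * (x.1 + h x.2) ∈ slitPlane := hsl
    have h0 : exp (I * c) * (x.1 + h x.2) ≠ 0 := slitPlane_ne_zero hsl'
    have h0' := right_ne_zero_of_mul h0
    refine ⟨hxΩ, h0', ?_⟩
    have hd : (deriv fun z => g₁ ((x.2 + u₀) / a) * log z) =ᶠ[𝓝 (exp (I * c) * (x.1 + h x.2))]
        fun z => g₁ ((x.2 + u₀) / a) * z⁻¹ := by
      filter_upwards [isOpen_slitPlane.mem_nhds hsl'] with z hz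
      exact ((hasDerivAt_log hz).const_mul _).deriv
    rw [R.sq x hxΩ, hx, hd.deriv_eq, ((hasDerivAt_inv h0).const_mul _).deriv]
    have := exp_ne_zero (I * c)
    field_simp
  have hw : ∀ᶠ x in 𝓝 ((p.1, p.2.1) : ℂ × ℝ), invLogDeriv Q x = -(x.1 + h x.2) := by
    filter_upwards [hev.eventually_nhds] with x hx
    obtain ⟨hxΩ, h0, -⟩ := hx.self_of_nhds
    have h1 := ((Continuous.prodMk_left x.2).continuousAt (x := x.1)).eventually hx
    have d1 := ((R.profile.hasDerivAt_z hΩ hxΩ).pow 2).mul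
      (((hasDerivAt_id x.1).add_const (h x.2)).pow 2)
    have hc : (fun z => Q (z, x.2) ^ 2 * (z + h x.2) ^ 2) =ᶠ[𝓝 x.1]
        fun _ => -g₁ ((x.2 + u₀) / a) / (2 * a ^ 2) := h1.mono fun z hz => hz.2.2
    have d2 := d1.unique ((hasDerivAt_const x.1 _).congr_of_eventuallyEq hc)
    have hQ0 := R.ne_zero x hxΩ
    have hQz := R.zDeriv_ne_zero x hxΩ
    have d3 : (2 * Q x * (x.1 + h x.2)) * (zDeriv Q x * (x.1 + h x.2) + Q x) = 0 := by
      simp at d2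
      linear_combination d2
    have d4 := (mul_eq_zero.1 d3).resolve_left (mul_ne_zero (mul_ne_zero two_ne_zero hQ0) h0)
    rw [invLogDeriv]
    field_simp
    linear_combination d4
  have h2 := ((Continuous.prodMk_left p.2.1).continuousAt (x := p.1)).eventually hw
  have d1 := R.isProfile_invLogDeriv.hasDerivAt_z hΩ hp
  have d2 := d1.unique
    ((((hasDerivAt_id p.1).add_const (h p.2.1)).neg).congr_of_eventuallyEq h2)
  rw [R.invA_eq hp, spLift, d2]
  norm_num

end ReducesTo

/-! ## From the precursor equation to normal forms -/

/-- A function analytic on a disk has a second primitive. -/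
theorem exists_second_primitive {G : ℂ → ℂ} {y₀ : ℂ} {r : ℝ}
    (hG : DifferentiableOn ℂ G (Metric.ball y₀ r)) :
    ∃ F F₁ : ℂ → ℂ, ∀ y ∈ Metric.ball y₀ r, HasDerivAt F (F₁ y) y ∧ HasDerivAt F₁ (G y) y := by
  obtain ⟨F₁, hF₁⟩ := hG.isExactOn_ball
  obtain ⟨F, hF⟩ := DifferentiableOn.isExactOn_ball (f := F₁) (c := y₀) (r := r)
    fun y hy => (hF₁ y hy).differentiableAt.differentiableWithinAt
  exact ⟨F, F₁, fun y hy => ⟨hF y hy, hF₁ y hy⟩⟩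

theorem eq_affine_of_zDeriv_eq {φ : ℂ × ℝ → ℂ} {x₀ : ℂ × ℝ} {r : ℝ} {c : ℂ}
    (hφ : IsProfile φ (Metric.ball x₀ r)) (h : ∀ x ∈ Metric.ball x₀ r, zDeriv φ x = c) :
    ∃ g : ℝ → ℂ, ContDiffOn ℝ ∞ g (Metric.ball x₀.2 r) ∧
      ∀ x ∈ Metric.ball x₀ r, φ x = c * x.1 + g x.2 := by
  have ho : IsOpen (Metric.ball x₀ r) := Metric.isOpen_ball
  have pψ : IsProfile (fun x : ℂ × ℝ => c * x.1) (Metric.ball x₀ r) :=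
    (IsProfile.const _).mul IsProfile.fst
  have dψ : ∀ x ∈ Metric.ball x₀ r, zDeriv (fun x : ℂ × ℝ => c * x.1) x = c := by
    intro x hx
    rw [(pψ.hasDerivAt_z ho hx).unique ((hasDerivAt_id x.1).const_mul _), mul_one]
  obtain ⟨g₀, g₁, hg₀, -, hφg⟩ := eq_add_affine_of_zDeriv_zDeriv_eq hφ pψ fun x hx => by
    rw [zDeriv_congr (Filter.eventually_of_mem (ho.mem_nhds hx) h),
      zDeriv_congr (Filter.eventually_of_mem (ho.mem_nhds hx) dψ)]
  refine ⟨g₀, hg₀, fun x hx => ?_⟩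
  have hev : ∀ᶠ z in 𝓝 x.1, (z, x.2) ∈ Metric.ball x₀ r :=
    (Continuous.prodMk_left x.2).continuousAt.eventually_mem (ho.mem_nhds hx)
  have h1 := (hφ.hasDerivAt_z ho hx).unique (((((hasDerivAt_id x.1).const_mul c).add_const
    (g₀ x.2)).add ((hasDerivAt_id x.1).const_mul (g₁ x.2))).congr_of_eventuallyEq
      (hev.mono fun z hz => hφg _ hz))
  rw [h x hx] at h1
  linear_combination hφg x hx - x.1 * h1

/-- The second `ζ`-derivative of `F((ζ + h(u)) / E(u)) / C(u)`. -/
theorem isProfile_and_zDeriv_zDeriv_of_potential {F F₁ F₂ : ℂ → ℂ} {h E C : ℝ → ℂ} {s : Set ℂ}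
    {S : Set ℝ} {Ω : Set (ℂ × ℝ)} (hs : IsOpen s) (hΩ : IsOpen Ω)
    (hF : ∀ y ∈ s, HasDerivAt F (F₁ y) y ∧ HasDerivAt F₁ (F₂ y) y)
    (hh : ContDiffOn ℝ ∞ h S) (hE : ContDiffOn ℝ ∞ E S) (hC : ContDiffOn ℝ ∞ C S)
    (hE0 : ∀ t ∈ S, E t ≠ 0) (hC0 : ∀ t ∈ S, C t ≠ 0)
    (hm : ∀ x ∈ Ω, x.2 ∈ S ∧ (x.1 + h x.2) / E x.2 ∈ s) :
    IsProfile (fun x => F ((x.1 + h x.2) / E x.2) / C x.2) Ω ∧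
      ∀ x ∈ Ω, zDeriv (zDeriv fun x => F ((x.1 + h x.2) / E x.2) / C x.2) x
        = F₂ ((x.1 + h x.2) / E x.2) / (E x.2 ^ 2 * C x.2) := by
  have pE := IsProfile.comp_snd hE fun x hx => (hm x hx).1
  have pC := IsProfile.comp_snd hC fun x hx => (hm x hx).1
  have py : IsProfile (fun x => (x.1 + h x.2) / E x.2) Ω :=
    (IsProfile.fst.add (IsProfile.comp_snd hh fun x hx => (hm x hx).1)).div pE
      fun x hx => hE0 _ (hm x hx).1
  have pF := (py.comp_analytic hs (fun y hy => (hF y hy).1.differentiableAt.differentiableWithinAt)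
    fun x hx => (hm x hx).2).div pC fun x hx => hC0 _ (hm x hx).1
  have pF₁ := ((py.comp_analytic hs
    (fun y hy => (hF y hy).2.differentiableAt.differentiableWithinAt)
    fun x hx => (hm x hx).2).div pE fun x hx => hE0 _ (hm x hx).1).div pC
      fun x hx => hC0 _ (hm x hx).1
  have hy : ∀ x : ℂ × ℝ, HasDerivAt (fun z => (z + h x.2) / E x.2) (1 / E x.2) x.1 := fun x =>
    ((hasDerivAt_id x.1).add_const (h x.2)).div_const (E x.2)
  have first : ∀ x ∈ Ω, zDeriv (fun x => F ((x.1 + h x.2) / E x.2) / C x.2) x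
      = F₁ ((x.1 + h x.2) / E x.2) / E x.2 / C x.2 := by
    intro x hx
    rw [(pF.hasDerivAt_z hΩ hx).unique ((HasDerivAt.comp x.1 (hF _ (hm x hx).2).1 (hy x)).div_const
      (C x.2))]
    ring
  refine ⟨pF, fun x hx => ?_⟩
  rw [zDeriv_congr (Filter.eventually_of_mem (hΩ.mem_nhds hx) first),
    (pF₁.hasDerivAt_z hΩ hx).unique (((HasDerivAt.comp x.1 (hF _ (hm x hx).2).2 (hy x)).div_const
      (E x.2)).div_const (C x.2))]
  have := hE0 _ (hm x hx).1
  have := hC0 _ (hm x hx).1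
  field_simp

namespace ReducesTo

variable {f : ℂ × ℝ → ℂ} {Ω : Set (ℂ × ℝ)} {e : Fin 4 → Spacetime → CVec} {Q : ℂ × ℝ → ℂ}

/-- The integrated precursor equation: the combination `β U - w P` is affine in `ζ`. -/
theorem exists_affine_of_precursorEq (R : ReducesTo f Ω e Q) {x₀ : ℂ × ℝ} {r : ℝ} {P : ℂ} {m : ℝ}
    (hb : Metric.ball x₀ r ⊆ Ω) (hP : ∀ x ∈ Metric.ball x₀ r, PrecursorEq Q P m x) :
    ∃ g₀ : ℝ → ℂ, ContDiffOn ℝ ∞ g₀ (Metric.ball x₀.2 r) ∧ ∀ x ∈ Metric.ball x₀ r,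
      levelVelocity Q x * (P.re * x.2 + m) - invLogDeriv Q x * P = I * P.im * x.1 + g₀ x.2 := by
  have ho : IsOpen (Metric.ball x₀ r) := Metric.isOpen_ball
  have pU : IsProfile (fun x : ℂ × ℝ => (P.re : ℂ) * x.2 + m) (Metric.ball x₀ r) :=
    IsProfile.comp_snd (g := fun t : ℝ => (P.re : ℂ) * t + m) (s := Set.univ)
      ((contDiff_const.mul ofRealCLM.contDiff).add contDiff_const).contDiffOn fun _ _ => trivial
  have pZ := ((R.isProfile_velocity.mono hb).mul pU).sub
    ((R.isProfile_invLogDeriv.mono hb).mul (IsProfile.const P))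
  have dZ : ∀ x ∈ Metric.ball x₀ r, zDeriv (fun x : ℂ × ℝ =>
      levelVelocity Q x * (P.re * x.2 + m) - invLogDeriv Q x * P) x = I * P.im := by
    intro x hx
    rw [← hP x hx, (pZ.hasDerivAt_z ho hx).unique
      (((R.isProfile_velocity.hasDerivAt_z R.isOpen (hb hx)).mul_const
        ((P.re : ℂ) * x.2 + m)).sub
        ((R.isProfile_invLogDeriv.hasDerivAt_z R.isOpen (hb hx)).mul_const P))]
  exact eq_affine_of_zDeriv_eq pZ dZ

/-- Along the flow `t ↦ E(t) (y + κ(t))` of the precursor field, `U E Q` is constant. -/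
theorem exists_conserved (R : ReducesTo f Ω e Q) {x₀ : ℂ × ℝ} {r : ℝ} {P : ℂ} {m : ℝ}
    {E E' : ℝ → ℂ} (hr : 0 < r)
    (hb : Metric.ball x₀ r ⊆ Ω) (hP : ∀ x ∈ Metric.ball x₀ r, PrecursorEq Q P m x)
    (hEs : ContDiffOn ℝ ∞ E (Metric.ball x₀.2 r))
    (hE : ∀ t ∈ Metric.ball x₀.2 r, P.re * t + m ≠ 0 ∧ E t ≠ 0 ∧ HasDerivAt E (E' t) t ∧
      (P.re * t + m) * E' t = I * P.im * E t) :
    ∃ (h : ℝ → ℂ) (G : ℂ → ℂ) (ε : ℝ), ContDiffOn ℝ ∞ h (Metric.ball x₀.2 r) ∧ 0 < ε ∧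
      DifferentiableOn ℂ G (Metric.ball ((x₀.1 + h x₀.2) / E x₀.2) ε) ∧
      ∀ x ∈ Metric.ball x₀ r,
        (((x.1 + h x.2) / E x.2, x.2) : ℂ × ℝ) ∈ Metric.ball ((x₀.1 + h x₀.2) / E x₀.2, x₀.2) ε →
        (P.re * x.2 + m) * E x.2 * Q x = G ((x.1 + h x.2) / E x.2) := by
  have ho : IsOpen (Metric.ball x₀ r) := Metric.isOpen_ball
  have hB : IsOpen (Metric.ball x₀.2 r) := Metric.isOpen_ball
  have hU : ∀ t ∈ Metric.ball x₀.2 r, (P.re : ℂ) * t + m ≠ 0 := fun t ht => by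
    exact_mod_cast (hE t ht).1
  have ht₀ : x₀.2 ∈ Metric.ball x₀.2 r := Metric.mem_ball_self hr
  obtain ⟨g₀, hg₀, hZ⟩ := R.exists_affine_of_precursorEq hb hP
  have sU : ContDiff ℝ ∞ fun t : ℝ => (P.re : ℂ) * t + m :=
    (contDiff_const.mul ofRealCLM.contDiff).add contDiff_const
  have sσ : ContDiffOn ℝ ∞ (fun t => g₀ t * (((P.re : ℂ) * t + m) * E t)⁻¹)
      (Metric.ball x₀.2 r) :=
    hg₀.mul ((sU.contDiffOn.mul hEs).inv fun t ht => mul_ne_zero (hU t ht) (hE t ht).2.1)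
  -- The integrated equation makes the flow U dζ/du = iP₂ζ + g₀. Variation of constants with ζ = E(y
  -- + κ) leaves UEκ′ = g₀; then h = −Eκ.
  obtain ⟨κ, hκ, hκd⟩ := exists_primitive sσ
  obtain ⟨y₀, hy₀⟩ : ∃ y₀, y₀ = (x₀.1 + -(E x₀.2 * κ x₀.2)) / E x₀.2 := ⟨_, rfl⟩
  have hE₀ := (hE _ ht₀).2.1
  have hflow₀ : E x₀.2 * (y₀ + κ x₀.2) = x₀.1 := by
    rw [hy₀]; field_simp; ring
  have hcont : ContinuousAt (fun q : ℂ × ℝ => ((E q.2 * (q.1 + κ q.2), q.2) : ℂ × ℝ))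
      (y₀, x₀.2) := by
    have hEc := (hE _ ht₀).2.2.1.continuousAt
    have hκc := (hκd _ ht₀).continuousAt
    refine ContinuousAt.prodMk (ContinuousAt.mul ?_ (continuousAt_fst.add ?_)) continuousAt_snd
    · exact ContinuousAt.comp (f := fun q : ℂ × ℝ => q.2) (x := (y₀, x₀.2)) hEc continuousAt_snd
    · exact ContinuousAt.comp (f := fun q : ℂ × ℝ => q.2) (x := (y₀, x₀.2)) hκc continuousAt_snd
  obtain ⟨ε, hε, hball⟩ := Metric.eventually_nhds_iff_ball.1
    (hcont.eventually_mem (s := Metric.ball x₀ r) (ho.mem_nhds (by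
      simp only [hflow₀]; exact Metric.mem_ball_self hr)))
  have hmem : ∀ y t, y ∈ Metric.ball y₀ ε → t ∈ Metric.ball x₀.2 ε →
      ((E t * (y + κ t), t) : ℂ × ℝ) ∈ Metric.ball x₀ r := fun y t hy ht =>
    hball (y, t) (by rw [← ball_prod_same]; exact ⟨hy, ht⟩)
  have hsnd : ∀ x : ℂ × ℝ, x ∈ Metric.ball x₀ r → x.2 ∈ Metric.ball x₀.2 r := fun x hx => by
    simp only [Metric.mem_ball, Prod.dist_eq, max_lt_iff] at hx ⊢
    exact hx.2
  -- (UE)′ = PE cancels the change of Q along the flow, which is −PQ/U.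
  have hd : ∀ y ∈ Metric.ball y₀ ε, ∀ t ∈ Metric.ball x₀.2 ε, HasDerivAt (fun t : ℝ =>
      ((P.re : ℂ) * t + m) * E t * Q (E t * (y + κ t), t)) 0 t := by
    intro y hy t ht
    have hx := hmem y t hy ht
    have htr : t ∈ Metric.ball x₀.2 r := hsnd _ hx
    obtain ⟨-, hE0, hEd, hEE⟩ := hE t htr
    have hUd : HasDerivAt (fun t : ℝ => (P.re : ℂ) * t + m) (P.re * 1 : ℂ) t :=
      ((ofRealCLM.hasDerivAt (x := t)).const_mul (P.re : ℂ)).add_const _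
    have hQ := R.profile.hasDerivAt_curve R.isOpen (hEd.mul ((hκd t htr).const_add y)) (hb hx)
    have hUEQ := (hUd.mul hEd).mul hQ
    refine hUEQ.congr_deriv ?_
    have hz := hZ _ hx
    have hQz := R.zDeriv_ne_zero _ (hb hx)
    have hU0 := hU t htr
    simp only [levelVelocity, invLogDeriv] at hz
    simp only [Pi.mul_apply]
    generalize zDeriv Q (E t * (y + κ t), t) = q₁ at *
    generalize uDeriv Q (E t * (y + κ t), t) = q₂ at *
    generalize Q (E t * (y + κ t), t) = q at *
    field_simp at hz ⊢
    linear_combination (q + q₁ * E t * (y + κ t)) * hEE - E t * hz + E t * q * re_add_im P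
  -- G is UEQ at time x₀.2 as a function of the initial datum y; it is holomorphic because Q is
  -- holomorphic in ζ.
  refine ⟨fun t => -(E t * κ t), fun y => ((P.re : ℂ) * x₀.2 + m) * E x₀.2
    * Q (E x₀.2 * (y + κ x₀.2), x₀.2), ε, (hEs.mul hκ).neg, hε, ?_, ?_⟩
  · rw [← hy₀]
    intro y hy
    have hQ := R.profile.hasDerivAt_z R.isOpen (hb (hmem y x₀.2 hy (Metric.mem_ball_self hε)))
    have hlin : HasDerivAt (fun y => E x₀.2 * (y + κ x₀.2)) (E x₀.2 * 1) y :=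
      ((hasDerivAt_id y).add_const _).const_mul _
    exact ((HasDerivAt.comp y hQ hlin).const_mul _).differentiableAt.differentiableWithinAt
  · intro x hx hxy
    rw [← hy₀] at hxy
    obtain ⟨hy, ht⟩ : (x.1 + -(E x.2 * κ x.2)) / E x.2 ∈ Metric.ball y₀ ε ∧
        x.2 ∈ Metric.ball x₀.2 ε := by simpa [Prod.dist_eq] using hxy
    have hE0 := (hE _ (hsnd x hx)).2.1
    have hxe : (E x.2 * ((x.1 + -(E x.2 * κ x.2)) / E x.2 + κ x.2), x.2) = x := by
      ext
      · field_simp; ring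
      · rfl
    have hc := (convex_ball x₀.2 ε).is_const_of_fderivWithin_eq_zero (𝕜 := ℝ)
      (fun t ht => (hd _ hy t ht).differentiableAt.differentiableWithinAt) (fun t ht => by
        rw [fderivWithin_of_isOpen Metric.isOpen_ball ht, (hd _ hy t ht).hasFDerivAt.fderiv]
        ext; simp) ht (Metric.mem_ball_self hε)
    simp only [hxe] at hc
    exact hc

/-- A solution of the precursor equation makes `f` self-similar, up to terms affine in `ζ`. -/
theorem exists_potential (R : ReducesTo f Ω e Q) {x₀ : ℂ × ℝ} {P : ℂ} {m : ℝ} {E E' : ℝ → ℂ}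
    (hx : x₀ ∈ Ω) (hP : ∀ᶠ x in 𝓝 x₀, PrecursorEq Q P m x)
    (hE : ∀ᶠ t in 𝓝 x₀.2, ContDiffAt ℝ ∞ E t ∧ P.re * t + m ≠ 0 ∧ E t ≠ 0 ∧
      HasDerivAt E (E' t) t ∧ (P.re * t + m) * E' t = I * P.im * E t) :
    ∃ (h : ℝ → ℂ) (F : ℂ → ℂ) (Ω' : Set (ℂ × ℝ)), IsOpen Ω' ∧ x₀ ∈ Ω' ∧ Ω' ⊆ Ω ∧
      (∀ᶠ t in 𝓝 x₀.2, ContDiffAt ℝ ∞ h t) ∧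
      AnalyticAt ℂ F ((x₀.1 + h x₀.2) / E x₀.2) ∧
      IsProfile (fun x => F ((x.1 + h x.2) / E x.2) / ((P.re : ℂ) * x.2 + m) ^ 2) Ω' ∧
      ∀ x ∈ Ω', zDeriv (zDeriv f) x
        = zDeriv (zDeriv fun x => F ((x.1 + h x.2) / E x.2) / ((P.re : ℂ) * x.2 + m) ^ 2) x := by
  obtain ⟨r₁, hr₁, h₁⟩ := Metric.eventually_nhds_iff_ball.1 (hP.and (R.isOpen.mem_nhds hx))
  obtain ⟨r₂, hr₂, h₂⟩ := Metric.eventually_nhds_iff_ball.1 hE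
  obtain ⟨r, hr⟩ : ∃ r, r = min r₁ r₂ := ⟨_, rfl⟩
  have hr0 : 0 < r := hr ▸ lt_min hr₁ hr₂
  replace h₁ : ∀ x ∈ Metric.ball x₀ r, PrecursorEq Q P m x ∧ x ∈ Ω := fun x hx =>
    h₁ x (Metric.ball_subset_ball (hr ▸ min_le_left _ _) hx)
  replace h₂ : ∀ t ∈ Metric.ball x₀.2 r, _ := fun x hx =>
    h₂ x (Metric.ball_subset_ball (hr ▸ min_le_right _ _) hx)
  have hEs : ContDiffOn ℝ ∞ E (Metric.ball x₀.2 r) := fun t ht => (h₂ t ht).1.contDiffWithinAt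
  obtain ⟨h, G, ε, hh, hε, hG, hQ⟩ := R.exists_conserved hr0 (fun x hx => (h₁ x hx).2)
    (fun x hx => (h₁ x hx).1) hEs fun t ht => (h₂ t ht).2
  have hB : IsOpen (Metric.ball x₀.2 r) := Metric.isOpen_ball
  have hsnd : ∀ x : ℂ × ℝ, x ∈ Metric.ball x₀ r → x.2 ∈ Metric.ball x₀.2 r := fun x hx => by
    simp only [Metric.mem_ball, Prod.dist_eq, max_lt_iff] at hx ⊢
    exact hx.2
  have hE0 : ∀ t ∈ Metric.ball x₀.2 r, E t ≠ 0 := fun t ht => (h₂ t ht).2.2.1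
  have hU : ∀ t ∈ Metric.ball x₀.2 r, (P.re : ℂ) * t + m ≠ 0 := fun t ht => by
    exact_mod_cast (h₂ t ht).2.1
  -- f_ζζ = 2Q² = 2G²/(UE)², and the second ζ-derivative of F((ζ + h)/E)/U² is F″/(UE)²; hence F″ =
  -- 2G².
  obtain ⟨F, F₁, hF⟩ := exists_second_primitive (G := fun y => 2 * G y ^ 2)
    ((hG.pow 2).const_mul 2)
  have hc : ContinuousOn (fun x : ℂ × ℝ => (((x.1 + h x.2) / E x.2, x.2) : ℂ × ℝ))
      (Metric.ball x₀ r) := by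
    refine ContinuousOn.prodMk (ContinuousOn.div (continuousOn_fst.add ?_) ?_ fun x hx =>
      hE0 _ (hsnd x hx)) continuousOn_snd
    · exact hh.continuousOn.comp continuousOn_snd hsnd
    · exact hEs.continuousOn.comp continuousOn_snd hsnd
  have hΩ' := hc.isOpen_inter_preimage Metric.isOpen_ball
    (Metric.isOpen_ball (x := ((x₀.1 + h x₀.2) / E x₀.2, x₀.2)) (ε := ε))
  have sU : ContDiff ℝ ∞ fun t : ℝ => ((P.re : ℂ) * t + m) ^ 2 :=
    ((contDiff_const.mul ofRealCLM.contDiff).add contDiff_const).pow 2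
  obtain ⟨hpF, hzz⟩ := isProfile_and_zDeriv_zDeriv_of_potential (C := fun t => (P.re * t + m) ^ 2)
    Metric.isOpen_ball hΩ' hF hh hEs sU.contDiffOn hE0 (fun t ht => pow_ne_zero 2 (hU t ht))
    fun x hx => ⟨hsnd x hx.1, by
      have := hx.2
      simp only [Set.mem_preimage, Metric.mem_ball, Prod.dist_eq, max_lt_iff] at this
      exact this.1⟩
  refine ⟨h, F, _, hΩ', ⟨Metric.mem_ball_self hr0, Metric.mem_ball_self hε⟩,
    fun x hx => (h₁ x hx.1).2, ?_, ?_, hpF, fun x hx => ?_⟩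
  · filter_upwards [hB.mem_nhds (Metric.mem_ball_self hr0)] with t ht
    exact hh.contDiffAt (hB.mem_nhds ht)
  · have hFd : DifferentiableOn ℂ F (Metric.ball ((x₀.1 + h x₀.2) / E x₀.2) ε) := fun y hy =>
      (hF y hy).1.differentiableAt.differentiableWithinAt
    exact hFd.analyticAt (Metric.isOpen_ball.mem_nhds (Metric.mem_ball_self hε))
  · have h3 := hQ x hx.1 hx.2
    have h4 := R.sq x (h₁ x hx.1).2
    have := hE0 _ (hsnd x hx.1)
    have := hU _ (hsnd x hx.1)
    rw [hzz x hx, ← h3]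
    field_simp
    linear_combination -2 * h4

end ReducesTo

/-! ### The four normal forms -/

namespace ReducesTo

variable {f : ℂ × ℝ → ℂ} {Ω : Set (ℂ × ℝ)} {e : Fin 4 → Spacetime → CVec} {Q : ℂ × ℝ → ℂ}

/-- A solution of the precursor equation yields a normal form whose principal part is the
self-similar function of the corresponding scaling. -/
theorem exists_normalForm_of_precursorEq (R : ReducesTo f Ω e Q) {p : Spacetime}
    (hp : p ∈ region Ω) {P : ℂ} {m a u₀ : ℝ} {E E' : ℝ → ℂ} {Φ : (ℂ → ℂ) → ℂ × ℝ → ℂ} (ha : a ≠ 0)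
    (hP : ∀ᶠ x in 𝓝 (p.1, p.2.1), PrecursorEq Q P m x)
    (hE : ∀ᶠ t in 𝓝 p.2.1, ContDiffAt ℝ ∞ E t ∧ P.re * t + m ≠ 0 ∧ E t ≠ 0 ∧
      HasDerivAt E (E' t) t ∧ (P.re * t + m) * E' t = I * P.im * E t)
    (hΦ : ∀ F : ℂ → ℂ, ∀ᶠ t : ℝ in 𝓝 p.2.1, ∀ z : ℂ, Φ F (z, (t + u₀) / a) / (a : ℂ) ^ 2
      = F (z / E t) / ((P.re : ℂ) * t + m) ^ 2) :
    ∃ (h : ℝ → ℂ) (s : ℝ → ℝ) (F : ℂ → ℂ) (g : ℝ → ℂ),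
      AnalyticAt ℂ F ((p.1 + h p.2.1) / E p.2.1) ∧
      (∀ᶠ t in 𝓝 p.2.1, ContDiffAt ℝ ∞ h t ∧ ContDiffAt ℝ ∞ s t) ∧
      ∀ᶠ q in 𝓝 p, ∀ i j : Fin 4,
      ppMetric f q i j =
        ∑ k, ∑ l, pd i (fun r => coordFn k (coordChange 0 a u₀ h s r)) q
          * pd j (fun r => coordFn l (coordChange 0 a u₀ h s r)) q
          * ppMetric (fun y => Φ F y + g y.2 * y.1) (coordChange 0 a u₀ h s q) k l := by
  obtain ⟨h, F, Ω', hΩ', hpΩ', hsub, hh, hF, hprof, hzz⟩ :=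
    R.exists_potential (x₀ := (p.1, p.2.1)) hp hP hE
  obtain ⟨S, hS, hSo, hpS⟩ := eventually_nhds_iff.1 (hΦ F)
  have ho : IsOpen (Ω' ∩ {x | x.2 ∈ S}) := hΩ'.inter (hSo.preimage continuous_snd)
  have heq : ∀ x ∈ Ω' ∩ {x | x.2 ∈ S},
      Φ F (exp (I * (0 : ℝ)) * (x.1 + h x.2), (x.2 + u₀) / a) / (a : ℂ) ^ 2
        = F ((x.1 + h x.2) / E x.2) / ((P.re : ℂ) * x.2 + m) ^ 2 := fun x hx => by
    rw [ofReal_zero, mul_zero, exp_zero, one_mul]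
    exact hS x.2 hx.2 _
  -- No rotation is needed: F is unrestricted, so a constant phase can be absorbed in it.
  obtain ⟨s, g, hs, hm⟩ := exists_normalForm (Φ := Φ F) (c := 0) ha ho ⟨hpΩ', hpS⟩
    (R.profile_f.mono fun x hx => hsub hx.1) hh
    ((hprof.mono Set.inter_subset_left).congr ho heq) fun x hx => by
      rw [hzz x hx.1]
      refine zDeriv_congr ?_
      filter_upwards [ho.mem_nhds hx] with y hy
      exact zDeriv_congr ((Filter.eventually_of_mem (ho.mem_nhds hy) heq).mono fun z hz => hz.symm)
  exact ⟨h, s, F, g, hF, hs, hm⟩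

theorem hasNormalForm_formA (R : ReducesTo f Ω e Q)
    (hP : ∀ x ∈ Ω, PrecursorEq Q 0 1 x) : HasNormalForm f (region Ω) FormA := by
  intro p hp
  obtain ⟨h, s, F, g, hF, hs, hm⟩ := R.exists_normalForm_of_precursorEq (p := p) hp
    (P := 0) (m := 1)
    (a := 1) (u₀ := 0) (E := fun _ => 1) (E' := fun _ => 0) (Φ := fun F y => F y.1) one_ne_zero
    (Filter.eventually_of_mem (R.isOpen.mem_nhds hp) hP)
    (Filter.Eventually.of_forall fun t => ⟨contDiffAt_const, by simp, one_ne_zero,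
      hasDerivAt_const _ _, by simp⟩) fun F => by simp
  refine ⟨0, 1, 0, h, s, _, one_ne_zero, hs, ⟨F, g, ?_, fun y => rfl⟩, hm⟩
  simpa [coordChange] using hF

/-- U = m is constant, and E = e^{−iu/m} solves mE′ = −iE; rescaling u by a = m turns 1/E into
e^{iû} and U^{−2} into the a^{−2} of the pullback. -/
theorem hasNormalForm_formC (R : ReducesTo f Ω e Q) {m : ℝ} (hm0 : m ≠ 0)
    (hP : ∀ x ∈ Ω, PrecursorEq Q (-I) m x) : HasNormalForm f (region Ω) FormC := by
  intro p hp
  have hmc : (m : ℂ) ≠ 0 := by exact_mod_cast hm0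
  have hEz : ∀ (t : ℝ) (z : ℂ), z / exp (-(I * (t / m))) = exp (I * (t / m)) * z := fun t z => by
    rw [exp_neg]; field_simp
  have hE : ∀ t : ℝ, ContDiffAt ℝ ∞ (fun t : ℝ => exp (-(I * (t / m)))) t ∧
      HasDerivAt (fun t : ℝ => exp (-(I * (t / m)))) (exp (-(I * (t / m))) * (-(I * (1 / m)))) t :=
    fun t => by
    have h1 : ContDiff ℝ ∞ fun t : ℝ => -(I * ((t : ℂ) / m)) :=
      (contDiff_const.mul (ofRealCLM.contDiff.div_const _)).neg
    exact ⟨h1.cexp.contDiffAt,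
      (((ofRealCLM.hasDerivAt (x := t)).div_const (m : ℂ)).const_mul I).neg.cexp⟩
  obtain ⟨h, s, F, g, hF, hs, hm⟩ := R.exists_normalForm_of_precursorEq (p := p) hp
    (P := -I) (m := m)
    (a := m) (u₀ := 0) (E := fun t => exp (-(I * (t / m))))
    (E' := fun t => exp (-(I * (t / m))) * (-(I * (1 / m))))
    (Φ := fun F y => F (exp (I * y.2) * y.1)) hm0
    (Filter.eventually_of_mem (R.isOpen.mem_nhds hp) hP)
    (Filter.Eventually.of_forall fun t => ⟨(hE t).1, by simpa using hm0, exp_ne_zero _, (hE t).2,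
      by simp; field_simp⟩)
    fun F => Filter.Eventually.of_forall fun t z => by simp [hEz]
  refine ⟨0, m, 0, h, s, _, hm0, hs, ⟨F, g, ?_, fun y => rfl⟩, hm⟩
  rw [hEz] at hF
  simpa [coordChange] using hF

theorem hasNormalForm_formB (R : ReducesTo f Ω e Q) {k m : ℝ}
    (hm0 : ∀ p ∈ region Ω, p.2.1 + m ≠ 0)
    (hP : ∀ x ∈ Ω, PrecursorEq Q (1 + I * k) m x) : HasNormalForm f (region Ω) (FormB k) := by
  intro p hp
  -- U = u + m may be negative, whereas the form requires û > 0; a = ±1 adjusts the sign without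
  -- affecting a².
  obtain ⟨a, ha, hpa⟩ : ∃ a : ℝ, a ^ 2 = 1 ∧ 0 < (p.2.1 + m) / a := by
    rcases lt_or_gt_of_ne (hm0 p hp) with h0 | h0
    · exact ⟨-1, by norm_num, by rw [div_neg, div_one]; linarith⟩
    · exact ⟨1, by norm_num, by simpa using h0⟩
  have ha0 : a ≠ 0 := by rintro rfl; norm_num at ha
  have hac : (a : ℂ) ≠ 0 := by exact_mod_cast ha0
  have hac2 : (a : ℂ) ^ 2 = 1 := by exact_mod_cast ha
  have hev : ∀ᶠ t in 𝓝 p.2.1, 0 < (t + m) / a :=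
    (by fun_prop : ContinuousAt (fun t : ℝ => (t + m) / a) p.2.1).eventually_const_lt hpa
  have hre : (1 + I * (k : ℂ)).re = 1 := by simp
  have him : (1 + I * (k : ℂ)).im = k := by simp
  have hEz : ∀ (T z : ℂ), z / T ^ (I * k : ℂ) = T ^ (-(I * k : ℂ)) * z := fun T z => by
    rw [cpow_neg]; field_simp
  have hE : ∀ᶠ t : ℝ in 𝓝 p.2.1,
      ContDiffAt ℝ ∞ (fun t : ℝ => (((t + m) / a : ℝ) : ℂ) ^ (I * k)) t ∧
      (1 + I * (k : ℂ)).re * t + m ≠ 0 ∧ (((t + m) / a : ℝ) : ℂ) ^ (I * k) ≠ 0 ∧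
      HasDerivAt (fun t : ℝ => (((t + m) / a : ℝ) : ℂ) ^ (I * k))
        ((I * k) * (((t + m) / a : ℝ) : ℂ) ^ (I * k - 1) * ((1 / a : ℝ) : ℂ)) t ∧
      ((1 + I * (k : ℂ)).re * t + m)
        * ((I * k) * (((t + m) / a : ℝ) : ℂ) ^ (I * k - 1) * ((1 / a : ℝ) : ℂ))
        = I * (1 + I * (k : ℂ)).im * (((t + m) / a : ℝ) : ℂ) ^ (I * k) := by
    filter_upwards [hev] with t ht
    have hne : (((t + m) / a : ℝ) : ℂ) ≠ 0 := by exact_mod_cast ht.ne'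
    have hU0 : t + m ≠ 0 := fun h0 => by rw [h0] at ht; simp at ht
    have h1 : HasDerivAt (fun t : ℝ => (((t + m) / a : ℝ) : ℂ)) ((1 / a : ℝ) : ℂ) t :=
      (((hasDerivAt_id t).add_const m).div_const a).ofReal_comp
    rw [hre, him]
    refine ⟨?_, by simpa using hU0, ?_, ?_, ?_⟩
    · have h2 : AnalyticAt ℂ (fun z : ℂ => z ^ (I * k : ℂ)) (((t + m) / a : ℝ) : ℂ) :=
        analyticAt_id.cpow analyticAt_const (ofReal_mem_slitPlane.2 ht)
      have h3 : ContDiff ℝ ∞ fun t : ℝ => (((t + m) / a : ℝ) : ℂ) :=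
        ofRealCLM.contDiff.comp ((contDiff_id.add contDiff_const).div_const a)
      exact ContDiffAt.comp (f := fun t : ℝ => (((t + m) / a : ℝ) : ℂ)) t
        (h2.contDiffAt.restrict_scalars ℝ) h3.contDiffAt
    · simp only [ne_eq, cpow_eq_zero_iff, hne, false_and, not_false_eq_true]
    · have h2 := (hasDerivAt_id ((((t + m) / a : ℝ) : ℂ))).cpow_const (c := I * k)
        (ofReal_mem_slitPlane.2 ht)
      have h3 := HasDerivAt.comp t h2 h1
      rw [mul_one] at h3
      exact h3
    · rw [cpow_sub _ _ hne, cpow_one]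
      have hU0' : (t : ℂ) + m ≠ 0 := by exact_mod_cast hU0
      push_cast
      field_simp
  obtain ⟨h, s, F, g, hF, hs, hm⟩ := R.exists_normalForm_of_precursorEq (p := p) hp
    (a := a) (u₀ := m) (Φ := fun F y => F ((y.2 : ℂ) ^ (-(I * k)) * y.1) / (y.2 : ℂ) ^ 2) ha0
    (Filter.eventually_of_mem (R.isOpen.mem_nhds hp) hP) hE fun F => hev.mono fun t ht z => by
      have hTU : (t : ℂ) + m = a * (((t + m) / a : ℝ) : ℂ) := by push_cast; field_simp
      simp only [hre, ofReal_one, one_mul, hTU, hEz, mul_pow, hac2, div_one]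
  refine ⟨0, a, m, h, s, _, ha0, hs, ⟨hpa, F, g, ?_, fun y => rfl⟩, hm⟩
  rw [hEz] at hF
  simpa [coordChange] using hF

/-- A = 1 gives w = −ζ + g₀(u), so Q(ζ − g₀) = C(u) is free of ζ. Then f_ζζ = 2C²/(ζ − g₀)², the
second derivative of −2C² log(ζ − g₀). -/
theorem hasNormalForm_formL (R : ReducesTo f Ω e Q)
    (hA : ∀ p ∈ region Ω, invA f e p = 1) : HasNormalForm f (region Ω) FormL := by
  intro p hp
  have hΩ := R.isOpen
  obtain ⟨r, hr, hb⟩ := Metric.isOpen_iff.1 hΩ _ hp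
  have ho : IsOpen (Metric.ball ((p.1, p.2.1) : ℂ × ℝ) r) := Metric.isOpen_ball
  have hB : IsOpen (Metric.ball p.2.1 r) := Metric.isOpen_ball
  have dw : ∀ x ∈ Ω, zDeriv (invLogDeriv Q) x = -1 := by
    intro x hx
    have hx' : ((x.1, x.2, 0) : Spacetime) ∈ region Ω := hx
    have h1 := R.conj_invA hx'
    rw [hA _ hx', map_one] at h1
    simp only [spLift, Prod.mk.eta] at h1
    linear_combination h1 / 2
  obtain ⟨g₀, hg₀, hw⟩ := eq_affine_of_zDeriv_eq (R.isProfile_invLogDeriv.mono hb)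
    fun x hx => dw x (hb hx)
  have hsnd : ∀ x : ℂ × ℝ, x ∈ Metric.ball ((p.1, p.2.1) : ℂ × ℝ) r →
      x.2 ∈ Metric.ball p.2.1 r := fun x hx => by
    simp only [Metric.mem_ball, Prod.dist_eq, max_lt_iff] at hx ⊢
    exact hx.2
  have hlevel : ∀ x ∈ Metric.ball ((p.1, p.2.1) : ℂ × ℝ) r,
      zDeriv Q x * (x.1 + -g₀ x.2) + Q x * 1 = 0 := fun x hx => by
    have h1 := hw x hx
    have := R.zDeriv_ne_zero x (hb hx)
    rw [invLogDeriv, div_eq_iff this] at h1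
    linear_combination h1
  have hne : ∀ x ∈ Metric.ball ((p.1, p.2.1) : ℂ × ℝ) r, x.1 + -g₀ x.2 ≠ 0 := fun x hx h0 => by
    have h1 := hlevel x hx
    rw [h0] at h1
    exact R.ne_zero x (hb hx) (by linear_combination h1)
  have pC : IsProfile (fun x : ℂ × ℝ => Q x * (x.1 + -g₀ x.2))
      (Metric.ball ((p.1, p.2.1) : ℂ × ℝ) r) :=
    (R.profile.mono hb).mul (IsProfile.fst.add (IsProfile.comp_snd hg₀.neg hsnd))
  obtain ⟨C, hC, hQC⟩ := eq_affine_of_zDeriv_eq (c := 0) pC fun x hx => by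
    rw [(pC.hasDerivAt_z ho hx).unique ((R.profile.hasDerivAt_z hΩ (hb hx)).mul
      ((hasDerivAt_id x.1).add_const (-g₀ x.2)))]
    exact hlevel x hx
  -- The rotation brings the point onto the positive real axis, away from the cut of the principal
  -- logarithm.
  obtain ⟨c, hc⟩ : ∃ c : ℝ, exp (I * c) * (p.1 + -g₀ p.2.1) ∈ slitPlane := by
    refine ⟨-arg (p.1 + -g₀ p.2.1), ?_⟩
    have h0 := hne _ (Metric.mem_ball_self hr)
    have h1 : exp (I * (-arg (p.1 + -g₀ p.2.1) : ℝ)) * (p.1 + -g₀ p.2.1)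
        = (‖p.1 + -g₀ p.2.1‖ : ℂ) := by
      nth_rewrite 2 [← norm_mul_exp_arg_mul_I (p.1 + -g₀ p.2.1)]
      rw [mul_left_comm, ← exp_add]
      push_cast
      ring_nf
      simp
    rw [h1]
    exact ofReal_mem_slitPlane.2 (norm_pos_iff.2 h0)
  have hC0 : ∀ t ∈ Metric.ball p.2.1 r, C t ≠ 0 := fun t ht => by
    have hx : ((p.1, t) : ℂ × ℝ) ∈ Metric.ball ((p.1, p.2.1) : ℂ × ℝ) r := by
      rw [← ball_prod_same]; exact ⟨Metric.mem_ball_self hr, ht⟩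
    have h1 := hQC _ hx
    rw [zero_mul, zero_add] at h1
    rw [← h1]
    exact mul_ne_zero (R.ne_zero _ (hb hx)) (hne _ hx)
  have hcont : ContinuousOn (fun x : ℂ × ℝ => exp (I * c) * (x.1 + -g₀ x.2))
      (Metric.ball ((p.1, p.2.1) : ℂ × ℝ) r) :=
    continuousOn_const.mul (continuousOn_fst.add
      (hg₀.neg.continuousOn.comp continuousOn_snd hsnd))
  have hΩ' := hcont.isOpen_inter_preimage ho isOpen_slitPlane
  have hE : ∀ z, z / exp (-(I * c)) = exp (I * c) * z := fun z => by
    rw [exp_neg]; field_simp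
  -- The potential lemma divides by its coefficient, so −2C² enters as an inverse.
  obtain ⟨hpF, hzz⟩ := isProfile_and_zDeriv_zDeriv_of_potential (F := log) (F₁ := fun y => y⁻¹)
    (F₂ := fun y => -(y ^ 2)⁻¹) (h := fun t => -g₀ t) (E := fun _ => exp (-(I * c)))
    (C := fun t => (-2 * C t ^ 2)⁻¹) isOpen_slitPlane hΩ'
    (fun y hy => ⟨hasDerivAt_log hy, hasDerivAt_inv (slitPlane_ne_zero hy)⟩) hg₀.neg
    contDiffOn_const ((contDiffOn_const.mul (hC.pow 2)).inv fun t ht =>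
      mul_ne_zero (by norm_num) (pow_ne_zero 2 (hC0 t ht))) (fun _ _ => exp_ne_zero _)
    (fun t ht => inv_ne_zero (mul_ne_zero (by norm_num) (pow_ne_zero 2 (hC0 t ht))))
    fun x hx => ⟨hsnd x hx.1, by rw [hE]; exact hx.2⟩
  have heq : (fun x : ℂ × ℝ => (fun y : ℂ × ℝ => -2 * C y.2 ^ 2 * log y.1)
      (exp (I * c) * (x.1 + -g₀ x.2), (x.2 + (0 : ℝ)) / (1 : ℝ)) / ((1 : ℝ) : ℂ) ^ 2)
      = fun x => log ((x.1 + -g₀ x.2) / exp (-(I * c))) / (-2 * C x.2 ^ 2)⁻¹ := by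
    funext x
    rw [hE, div_inv_eq_mul]
    simp
    ring
  obtain ⟨s, g, hs, hm⟩ := exists_normalForm (f := f) (p := p) (c := c) (a := 1) (u₀ := 0)
    (h := fun t => -g₀ t) (Φ := fun y => -2 * C y.2 ^ 2 * log y.1) one_ne_zero hΩ'
    ⟨Metric.mem_ball_self hr, hc⟩ (R.profile_f.mono fun x hx => hb hx.1)
    (by
      filter_upwards [hB.mem_nhds (Metric.mem_ball_self hr)] with t ht
      exact hg₀.neg.contDiffAt (hB.mem_nhds ht))
    (by rw [heq]; exact hpF) fun x hx => by
      rw [heq, hzz x hx]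
      have h1 := hQC x hx.1
      have h2 := R.sq x (hb hx.1)
      have h3 := hne x hx.1
      have h4 := hC0 _ (hsnd x hx.1)
      have h5 := exp_ne_zero (-(I * c))
      rw [zero_mul, zero_add] at h1
      rw [← h1] at h4 ⊢
      field_simp
      linear_combination -2 * h2
  refine ⟨c, 1, 0, fun t => -g₀ t, s, _, one_ne_zero, hs, ⟨?_, fun t => -2 * C t ^ 2, g,
    fun y => rfl⟩, hm⟩
  exact hc

end ReducesTo

/-! ### Assembly of the five statements -/

theorem proposition5p6
    (Ω : Set (ℂ × ℝ)) (hΩ : IsOpen Ω) (hΩc : IsConnected Ω)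
    (f : ℂ × ℝ → ℂ) (hf : IsProfile f Ω)
    (e : Fin 4 → Spacetime → CVec) (he : IsNormalizedTetrad f (region Ω) e)
    (hα : ∀ p ∈ region Ω, npAlpha f e p ≠ 0) :
    -- class B₂₃
    (GenericB f (region Ω) e →
      (IsPrecursor f (region Ω) e ↔ ∃ k : ℝ, CondB f (region Ω) e k) ∧
      ∀ k : ℝ, CondB f (region Ω) e k ↔ HasNormalForm f (region Ω) (FormB k)) ∧
    -- class C₂₃
    (GenericC f (region Ω) e →
      (IsPrecursor f (region Ω) e ↔ CondC f (region Ω) e) ∧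
      (CondC f (region Ω) e ↔ HasNormalForm f (region Ω) FormC)) ∧
    -- class L₂₃: precursors with V¹ ≠ 0, V³ = 0
    (((∃ V, PreservesForms f (region Ω) e V ∧
          (∃ p ∈ region Ω, frameComp f e V 0 p ≠ 0) ∧
          ∀ p ∈ region Ω, frameComp f e V 2 p = 0) ↔
        ∀ p ∈ region Ω, invA f e p = 1) ∧
      ((∀ p ∈ region Ω, invA f e p = 1) ↔ HasNormalForm f (region Ω) FormL)) ∧
    -- class A₂₃: precursors with V¹ = 0, V³ ≠ 0
    (((∃ V, PreservesForms f (region Ω) e V ∧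
          (∀ p ∈ region Ω, frameComp f e V 0 p = 0) ∧
          ∃ p ∈ region Ω, frameComp f e V 2 p ≠ 0) ↔
        ∀ p ∈ region Ω, npMu f e p = 0) ∧
      ((∀ p ∈ region Ω, npMu f e p = 0) ↔ HasNormalForm f (region Ω) FormA)) ∧
    -- type (0,2) precursors are exactly these four classes
    (IsTypeZeroTwo f (region Ω) e →
      ((∀ p ∈ region Ω, invA f e p * conj (invA f e p) = 1) ∨
        ∀ p ∈ region Ω, invA f e p * conj (invA f e p) ≠ 1) →
      (IsPrecursor f (region Ω) e ↔
        (GenericB f (region Ω) e ∧ ∃ k : ℝ, CondB f (region Ω) e k) ∨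
        (GenericC f (region Ω) e ∧ CondC f (region Ω) e) ∨
        (∀ p ∈ region Ω, invA f e p = 1) ∨
        (∀ p ∈ region Ω, npMu f e p = 0))) := by
  obtain ⟨Q, R⟩ := he.exists_reducesTo hf hΩ hα
  refine ⟨fun hB => ⟨R.isPrecursor_iff_condB hΩc hB, fun k => ⟨fun hk => ?_, fun H =>
      R.condB_of_eventually hB fun p hp => R.precursorEq_of_formB H hp⟩⟩,
    fun hC => ⟨R.isPrecursor_iff_condC hΩc hC, fun hk => ?_, fun H =>
      R.condC_of_eventually hC fun p hp => R.precursorEq_of_formC H hp⟩,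
    ⟨R.exists_preservesForms_first_iff hΩc, R.hasNormalForm_formL,
      fun H p hp => R.invA_eq_one_of_formL H hp⟩,
    ⟨R.exists_preservesForms_third_iff hΩc, fun hμ => ?_, fun H p hp => ?_⟩,
    fun hT hA => R.isPrecursor_iff_of_isTypeZeroTwo hΩc hT hA⟩
  · obtain ⟨m, hm⟩ := R.exists_precursorEq_of_condB hΩc hB hk
    refine R.hasNormalForm_formB (m := m) (fun p hp => ?_) hm
    -- Re P = 1 gives U = u + m and P ≠ 0; the nonvanishing of U is what the normal form B needs.
    have hP : (1 + I * (k : ℂ)).re = 1 := by simp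
    have h := R.affine_ne_zero_of_precursorEq hp (hB p hp).2 (hm _ hp) (Or.inl fun h0 => by
      rw [h0] at hP; simp at hP)
    rwa [hP, one_mul] at h
  · obtain ⟨m, hm⟩ := R.exists_precursorEq_of_condC hΩc hC hk
    obtain ⟨x, hx⟩ := hΩc.nonempty
    have hx' : ((x.1, x.2, 0) : Spacetime) ∈ region Ω := hx
    refine R.hasNormalForm_formC (m := m) ?_ hm
    have h := R.affine_ne_zero_of_precursorEq hx' (hC _ hx').2.2 (hm _ hx) (Or.inl (by simp))
    simpa using h
  · exact R.hasNormalForm_formA fun x hx =>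
      R.precursorEq_of_mu_eq_zero (p := (x.1, x.2, 0)) hx (hμ _ hx)
  · obtain ⟨m, hm, h⟩ := R.precursorEq_of_formA H hp
    exact R.mu_eq_zero_of_precursorEq hm hp h.self_of_nhds
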